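/- **Setting.** Let $G$ be a finite (discrete) group with centre $Z(G)$, and let $\Sigma$ be an orbifold Riemann surface: a compact connected Riemann surface with distinct marked points $x_1,\dots,x_n$, where $x_j$ has stabiliser $\mathbb Z/d_j$ ($d_j\ge 1$). Put $\Sigma^*=\Sigma\setminus\{x_1,\dots,x_n\}$. Choose a finite good cover of $\Sigma$ by pairwise disjoint holomorphic coordinate discs $D_j\ni x_j$ (with $x_j$ at $0$, image the unit disc) and open sets $B_\alpha$ with $\bigcup_\alpha B_\alpha=\Sigma^*$, such that all nonempty intersections of at most three members are contractible, no four distinct members meet, and the nerve is a closed combinatorial surface (each edge lies in exactly two triangles, vertex links are connected), e.g. the open vertex stars of a triangulation having the $x_j$ as pairwise non-adjacent vertices. Let $\mathfrak D_j$ be the unit disc with $\mathfrak D_j\to D_j$, $z\mapsto z^{d_j}$, and let $\mathfrak Q_\Sigma$ be the resulting étale groupoid with objects $\bigsqcup_\alpha B_\alpha\sqcup\bigsqcup_j\mathfrak D_j$ (arrows compose from left to right): one arrow between points of $B_\alpha$ and $B_\beta$, or of $B_\alpha$ and $\mathfrak D_j$, lying over the same point of $\Sigma$, and, on $\mathfrak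 D_j$, the rotations by $d_j$-th roots of unity. A banded $G$-gerbe $\mathcal Y_\Sigma$ over $\Sigma$ is given by a normalised locally constant 2-cocycle $\tau$ on $\mathfrak Q_\Sigma$ with values in $Z(G)$, and is presented by the groupoid $G\times_\tau\mathfrak Q_\Sigma$, $(g,q)(h,r)=(gh\,\tau(q,r),qr)$. For $m=(m_1,\dots,m_n)$, $m_j\ge1$, let $p:\widetilde\Sigma_m\to\Sigma$ be the orbifold Riemann surface with the same underlying surface and stabiliser of order $m_jd_j$ at $x_j$, presented by the same cover with $z\mapsto z^{m_jd_j}$ on the discs $\widetilde{\mathfrak D}_j$; $p$ is $z\mapsto z^{m_j}$ on $\widetilde{\mathfrak D}_j$. A lifting is a section $\tilde f:\widetilde\Sigma_m\to p^*\mathcal Y_\Sigma$, i.e. a groupoid morphism $q\mapsto(F(q),q)$ from $\mathfrak Q_{\widetilde\Sigma_m}$ to $G\times_{p^*\tau}\mathfrak Q_{\widetilde\Sigma_m}$ with $F$ locally constant; $F_1,F_2$ are equivalent if $F_1(q)=\varphi(s(q))F_2(q)\varphi(t(q))^{-1}$ for a locally constant map $\varphi$ from the objects to $G$. Choose a standard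 system of generators of genus $g$: a base point, loops $a_i,b_i$ ($1\le i\le g$) in $\Sigma^*$, and loops $L_j=l_j\cdot\partial_j\cdot l_j^{-1}$ ($1\le j\le n$), where $\partial_j$ is a circle about $x_j$ in the coordinate of $D_j$, run through once counterclockwise from the endpoint $w_j$ of the path $l_j$, such that $\pi_1(\Sigma^*)$ is generated by them with the single relation $[a_1,b_1]\cdots[a_g,b_g]L_1\cdots L_n=1$, $[a,b]=aba^{-1}b^{-1}$. Cover these paths by chains of sets $B_\alpha$, such that all chains along the $a_i,b_i,l_j$ start in one fixed set, the chains along $a_i,b_i$ also end there, and the chain along $\partial_j$ starts and ends in the last set $B_{j,1}$ of the chain along $l_j$; for a path $\gamma$ let $F(\gamma)$ be the product of the values of $F$ on the successive arrows of its chain. Choose $z_j\in\mathfrak D_j$ over $w_j$. When $\tau$ is trivial over $\Sigma^*$ (i.e. $\tau(q,r)=1$ if $q,r$ are arrows between the $B_\alpha$), define: * $hol(\mathcal Y_\Sigma,\tau)(x_j)=\tau(q,q)\tau(q,q^2)\cdots\tau(q,q^{d_j-1})$, with $q$ the rotation by $2\pi/d_j$ in the stabiliser of $0\in\mathfrak D_j$;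 * $hol(\mathcal Y_\Sigma,\tau)(L_j,z_j)=\tau(g_1,r)\,\tau(h_{1},g_2)\,\tau(h_{2},g_3)\cdots\tau(h_{J},g_1')$, where $h_1,\dots,h_J$ are the successive arrows of the chain $B_{j,1},\dots,B_{j,J},B_{j,1}$ along $\partial_j$, $g_s$ is the arrow from $B_{j,s}$ to $\mathfrak D_j$ ending on the lift of $\partial_j$ starting at $z_j$, $r$ is the rotation by $2\pi/d_j$ at $z_j$, and $g_1'$ is the arrow from $B_{j,1}$ ending on the sheet reached after one turn. **Theorem.** Let $\mathcal Y_\Sigma$ be a banded $G$-gerbe over $\Sigma$. (1) If $n\ge1$, then $\mathcal Y_\Sigma$ can be represented by a cocycle trivial over $\Sigma^*$: every normalised $Z(G)$-valued 2-cocycle on $\mathfrak Q_\Sigma$ is cohomologous to one that is trivial over $\Sigma^*$. (2) Let $\mathcal Y_\Sigma$ be represented by $\tau_0$ and let $\tau$ be a cocycle trivial over $\Sigma^*$ with $\tau_0=\tau\cdot\delta\psi$ for a $Z(G)$-valued locally constant 1-cochain $\psi$. For every $m$, the equivalence classes of liftings $\widetilde\Sigma_m\to p^*\mathcal Y_\Sigma$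 are in bijection with the quotient by simultaneous conjugation by $G$ of the set of tuples $(\alpha_1,\beta_1,\dots,\alpha_g,\beta_g,\sigma_1,\dots,\sigma_n)\in G^{2g+n}$ with $$[\alpha_1,\beta_1]\cdots[\alpha_g,\beta_g]=hol(\mathcal Y_\Sigma,\tau)(L_1,z_1)\cdots hol(\mathcal Y_\Sigma,\tau)(L_n,z_n)\,\sigma_n\cdots\sigma_1,$$ $$\sigma_j^{m_jd_j}\,hol(\mathcal Y_\Sigma,\tau)(x_j)^{m_j}=1\qquad(1\le j\le n).$$ In particular the two sets have the same (finite) cardinality. The bijection sends the class of a lifting $F_0$ of $\tau_0$ to the class of $(F(a_1),F(b_1),\dots,F(a_g),F(b_g),F(\tilde g_{1,1}),\dots,F(\tilde g_{n,1}))$ whenever the lifting $F=F_0\cdot p^*\psi$ of $\tau$ satisfies $F(l_j)F(\tilde g_{1,j})=1$ for all $j$, where $\tilde g_{j,1}$ is the rotation by $2\pi/(m_jd_j)$ at $0\in\widetilde{\mathfrak D}_j$ and $\tilde g_{1,j}$ is the arrow from $B_{j,1}$ to $\widetilde{\mathfrak D}_j$ ending at a chosen point over $w_j$. -/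

import Mathlib

open scoped Manifold ContDiff unitInterval commutatorElement

noncomputable section

universe u v w u' v'

/-! ## Topological groupoids, banded gerbes over them, and liftings

Arrows compose from left to right: `mul q r` is "first `q`, then `r`", and is defined when the
target of `q` is the source of `r`. -/

/-- A topological groupoid `Arr ⇉ Obj`. -/
structure TopGroupoid : Type (max u v + 1) where
  Obj : Type u
  Arr : Type v
  [topObj : TopologicalSpace Obj]
  [topArr : TopologicalSpace Arr]
  src : Arr → Obj
  tgt : Arr → Obj
  one : Obj → Arr
  inv : Arr → Arr
  mul : ∀ q r : Arr, tgt q = src r → Arr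
  src_one : ∀ x, src (one x) = x
  tgt_one : ∀ x, tgt (one x) = x
  src_inv : ∀ q, src (inv q) = tgt q
  tgt_inv : ∀ q, tgt (inv q) = src q
  src_mul : ∀ q r h, src (mul q r h) = src q
  tgt_mul : ∀ q r h, tgt (mul q r h) = tgt r
  one_mul : ∀ q, mul (one (src q)) q (tgt_one _) = q
  mul_one : ∀ q, mul q (one (tgt q)) (src_one _).symm = q
  inv_mul : ∀ q, mul (inv q) q (tgt_inv q) = one (tgt q)
  mul_inv : ∀ q, mul q (inv q) (src_inv q).symm = one (src q)
  mul_assoc : ∀ q r s (h : tgt q = src r) (k : tgt r = src s),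
    mul (mul q r h) s ((tgt_mul q r h).trans k) = mul q (mul r s k) (h.trans (src_mul r s k).symm)
  continuous_src : Continuous src
  continuous_tgt : Continuous tgt
  continuous_one : Continuous one
  continuous_inv : Continuous inv
  continuous_mul :
    Continuous fun p : {p : Arr × Arr // tgt p.1 = src p.2} => mul p.1.1 p.1.2 p.2

attribute [instance] TopGroupoid.topObj TopGroupoid.topArr

namespace TopGroupoid

/-- A (continuous, strict) morphism of topological groupoids. -/
structure Hom (P : TopGroupoid.{u, v}) (Q : TopGroupoid.{u', v'}) where
  obj : P.Obj → Q.Obj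
  arr : P.Arr → Q.Arr
  continuous_obj : Continuous obj
  continuous_arr : Continuous arr
  src_arr : ∀ q, Q.src (arr q) = obj (P.src q)
  tgt_arr : ∀ q, Q.tgt (arr q) = obj (P.tgt q)
  map_mul : ∀ q r (h : P.tgt q = P.src r),
    arr (P.mul q r h) = Q.mul (arr q) (arr r)
      ((tgt_arr q).trans ((congrArg obj h).trans (src_arr r).symm))

theorem Hom.composable {P : TopGroupoid.{u, v}} {Q : TopGroupoid.{u', v'}} (p : Hom P Q) {q r : P.Arr}
    (h : P.tgt q = P.src r) : Q.tgt (p.arr q) = Q.src (p.arr r) :=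
  (p.tgt_arr q).trans ((congrArg p.obj h).trans (p.src_arr r).symm)

theorem mul_eq_one_of_idem (Q : TopGroupoid.{u, v}) (q : Q.Arr) (h : Q.tgt q = Q.src q)
    (hq : Q.mul q q h = q) : q = Q.one (Q.src q) := by
  have h1 := Q.mul_assoc (Q.inv q) q q (Q.tgt_inv q) h
  have h2 : Q.mul (Q.inv q) (Q.mul q q h) ((Q.tgt_inv q).trans (Q.src_mul q q h).symm)
      = Q.one (Q.tgt q) := by
    rw [← Q.inv_mul q]; congr 1
  rw [h2] at h1
  have h3 : Q.mul (Q.mul (Q.inv q) q (Q.tgt_inv q)) q ((Q.tgt_mul _ _ _).trans h) = q := by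
    conv_rhs => rw [← Q.one_mul q]
    congr 1
    rw [Q.inv_mul q, h]
  rw [h3, h] at h1
  exact h1

theorem Hom.map_one {P : TopGroupoid.{u, v}} {Q : TopGroupoid.{u', v'}} (p : Hom P Q) (x : P.Obj) :
    p.arr (P.one x) = Q.one (p.obj x) := by
  have h : P.tgt (P.one x) = P.src (P.one x) := by rw [P.tgt_one, P.src_one]
  have h1 : P.mul (P.one x) (P.one x) h = P.one x := by
    conv_rhs => rw [← P.one_mul (P.one x)]
    congr 1
    rw [P.src_one]
  have h2 := p.map_mul _ _ h
  rw [h1] at h2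
  have h3 := Q.mul_eq_one_of_idem _ _ h2.symm
  rw [h3, p.src_arr, P.src_one]

variable {G : Type w} [Group G] [TopologicalSpace G]

/-- A continuous (that is, locally constant) `Z(G)`-valued 1-cochain on `Q`. -/
structure Cochain1 (Q : TopGroupoid.{u, v}) (G : Type w) [Group G] [TopologicalSpace G] where
  val : Q.Arr → Subgroup.center G
  continuous_val : Continuous val

/-- A `G`-gerbe over `Q` with trivialised band, presented by a normalised continuous (that is,
locally constant) `Z(G)`-valued 2-cocycle `τ` on `Q`; the gerbe is the groupoid
`BandedGerbe.total` below. -/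
structure BandedGerbe (Q : TopGroupoid.{u, v}) (G : Type w) [Group G] [TopologicalSpace G] where
  tau : ∀ q r : Q.Arr, Q.tgt q = Q.src r → Subgroup.center G
  continuous_tau :
    Continuous fun p : {p : Q.Arr × Q.Arr // Q.tgt p.1 = Q.src p.2} => tau p.1.1 p.1.2 p.2
  one_left : ∀ q, tau (Q.one (Q.src q)) q (Q.tgt_one _) = 1
  one_right : ∀ q, tau q (Q.one (Q.tgt q)) (Q.src_one _).symm = 1
  cocycle : ∀ q r s (h : Q.tgt q = Q.src r) (k : Q.tgt r = Q.src s),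
    tau q r h * tau (Q.mul q r h) s ((Q.tgt_mul q r h).trans k)
      = tau r s k * tau q (Q.mul r s k) (h.trans (Q.src_mul r s k).symm)

namespace BandedGerbe

variable {P : TopGroupoid.{u, v}} {Q : TopGroupoid.{u', v'}}

theorem tau_inv (τ : BandedGerbe Q G) (q : Q.Arr) :
    τ.tau (Q.inv q) q (Q.tgt_inv q) = τ.tau q (Q.inv q) (Q.src_inv q).symm := by
  have h := τ.cocycle q (Q.inv q) q (Q.src_inv q).symm (Q.tgt_inv q)
  have h1 : τ.tau (Q.mul q (Q.inv q) (Q.src_inv q).symm) q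
      ((Q.tgt_mul _ _ _).trans (Q.tgt_inv q)) = 1 := by
    rw [← τ.one_left q]; congr 1; exact Q.mul_inv q
  have h2 : τ.tau q (Q.mul (Q.inv q) q (Q.tgt_inv q))
      ((Q.src_inv q).symm.trans (Q.src_mul _ _ _).symm) = 1 := by
    rw [← τ.one_right q]; congr 1; exact Q.inv_mul q
  rw [h1, h2] at h
  simpa using h.symm

/-- The groupoid `G ×_τ Q` with `(g, q)(h, r) = (g h τ(q, r), q r)`: it presents the gerbe. -/
def total [DiscreteTopology G] (τ : BandedGerbe Q G) : TopGroupoid.{u', max w v'} where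
  Obj := Q.Obj
  Arr := G × Q.Arr
  src a := Q.src a.2
  tgt a := Q.tgt a.2
  one x := (1, Q.one x)
  inv a := (a.1⁻¹ * ((τ.tau a.2 (Q.inv a.2) (Q.src_inv a.2).symm : Subgroup.center G) : G)⁻¹,
    Q.inv a.2)
  mul a b h := (a.1 * b.1 * (τ.tau a.2 b.2 h : Subgroup.center G), Q.mul a.2 b.2 h)
  src_one x := Q.src_one x
  tgt_one x := Q.tgt_one x
  src_inv a := Q.src_inv a.2
  tgt_inv a := Q.tgt_inv a.2
  src_mul a b h := Q.src_mul a.2 b.2 h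
  tgt_mul a b h := Q.tgt_mul a.2 b.2 h
  one_mul a := by
    refine Prod.ext ?_ (Q.one_mul a.2)
    simp [τ.one_left]
  mul_one a := by
    refine Prod.ext ?_ (Q.mul_one a.2)
    simp [τ.one_right]
  inv_mul a := by
    refine Prod.ext ?_ (Q.inv_mul a.2)
    have hz := Subgroup.mem_center_iff.mp
      (inv_mem (τ.tau a.2 (Q.inv a.2) (Q.src_inv a.2).symm).2) a.1
    simp only [τ.tau_inv]
    rw [_root_.mul_assoc a.1⁻¹, ← hz]
    simp
  mul_inv a := by
    refine Prod.ext ?_ (Q.mul_inv a.2)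
    dsimp only
    group
  mul_assoc a b c h k := by
    refine Prod.ext ?_ (Q.mul_assoc a.2 b.2 c.2 h k)
    have h1 := congrArg (Subtype.val) (τ.cocycle a.2 b.2 c.2 h k)
    have h2 := Subgroup.mem_center_iff.mp (τ.tau a.2 b.2 h).2 c.1
    simp only [Subgroup.coe_mul] at h1
    dsimp only
    rw [_root_.mul_assoc (a.1 * b.1), ← h2, ← _root_.mul_assoc (a.1 * b.1), _root_.mul_assoc _ _ (Subtype.val _), h1]
    group
  continuous_src := Q.continuous_src.comp continuous_snd
  continuous_tgt := Q.continuous_tgt.comp continuous_snd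
  continuous_one := continuous_const.prodMk Q.continuous_one
  continuous_inv := by
    have h : Continuous fun a : G × Q.Arr =>
        τ.tau a.2 (Q.inv a.2) (Q.src_inv a.2).symm :=
      τ.continuous_tau.comp (f := fun a : G × Q.Arr =>
        (⟨(a.2, Q.inv a.2), (Q.src_inv a.2).symm⟩ :
          {p : Q.Arr × Q.Arr // Q.tgt p.1 = Q.src p.2}))
        ((continuous_snd.prodMk (Q.continuous_inv.comp continuous_snd)).subtype_mk _)
    have h' := continuous_subtype_val.comp h
    exact ((continuous_of_discreteTopology (f := fun p : G × G => p.1⁻¹ * p.2⁻¹)).comp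
      (continuous_fst.prodMk h')).prodMk (Q.continuous_inv.comp continuous_snd)
  continuous_mul := by
    have e : Continuous fun p : {p : (G × Q.Arr) × (G × Q.Arr) // Q.tgt p.1.2 = Q.src p.2.2} =>
        (⟨(p.1.1.2, p.1.2.2), p.2⟩ : {p : Q.Arr × Q.Arr // Q.tgt p.1 = Q.src p.2}) := by
      fun_prop
    have h' := continuous_subtype_val.comp (τ.continuous_tau.comp e)
    have h1 : Continuous fun p : {p : (G × Q.Arr) × (G × Q.Arr) //
        Q.tgt p.1.2 = Q.src p.2.2} => (p.1.1.1, p.1.2.1) := by fun_prop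
    exact ((continuous_of_discreteTopology
      (f := fun p : (G × G) × G => p.1.1 * p.1.2 * p.2)).comp (h1.prodMk h')).prodMk
        (Q.continuous_mul.comp e)

/-- The pull-back `p^*τ` of a gerbe along a morphism `p`. -/
def pullback (τ : BandedGerbe Q G) (p : Hom P Q) : BandedGerbe P G where
  tau q r h := τ.tau (p.arr q) (p.arr r) (p.composable h)
  continuous_tau := by
    have hp := p.continuous_arr
    exact τ.continuous_tau.comp (f := fun x : {x : P.Arr × P.Arr // P.tgt x.1 = P.src x.2} =>
      (⟨(p.arr x.1.1, p.arr x.1.2), p.composable x.2⟩ :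
        {x : Q.Arr × Q.Arr // Q.tgt x.1 = Q.src x.2})) (by fun_prop)
  one_left q := by
    rw [← τ.one_left (p.arr q)]; congr 1; rw [p.map_one, p.src_arr]
  one_right q := by
    rw [← τ.one_right (p.arr q)]; congr 1; rw [p.map_one, p.tgt_arr]
  cocycle q r s h k := by
    have := τ.cocycle (p.arr q) (p.arr r) (p.arr s) (p.composable h) (p.composable k)
    simpa only [p.map_mul] using this

/-- `τ = τ' · δψ`. -/
def CohomologousVia (τ τ' : BandedGerbe Q G) (ψ : Cochain1 Q G) : Prop :=
  ∀ q r h, τ.tau q r h = τ'.tau q r h * (ψ.val q * ψ.val r * (ψ.val (Q.mul q r h))⁻¹)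

/-- A lifting over `p : P → Q` of the gerbe `τ` on `Q`: a morphism of groupoids
`P → G ×_{p^*τ} P` which is a section of the projection to `P`. -/
structure Lifting [DiscreteTopology G] (τ : BandedGerbe Q G) (p : Hom P Q) where
  hom : Hom P (τ.pullback p).total
  obj_eq : ∀ x, hom.obj x = x
  arr_snd : ∀ q, (hom.arr q).2 = q

/-- The component `F` of a lifting `q ↦ (F(q), q)`. -/
def Lifting.F [DiscreteTopology G] {τ : BandedGerbe Q G} {p : Hom P Q} (f : Lifting τ p) (q : P.Arr) : G :=
  (f.hom.arr q).1

/-- Two liftings are equivalent if `F₁(q) = φ(s(q)) F₂(q) φ(t(q))⁻¹` for a continuous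
(that is, locally constant) map `φ` from the objects to `G`. -/
def Lifting.setoid [DiscreteTopology G] (τ : BandedGerbe Q G) (p : Hom P Q) : Setoid (Lifting τ p) where
  r f₁ f₂ := ∃ φ : P.Obj → G, Continuous φ ∧
    ∀ q, f₁.F q = φ (P.src q) * f₂.F q * (φ (P.tgt q))⁻¹
  iseqv :=
    { refl := fun f => ⟨fun _ => 1, continuous_const, fun q => by simp⟩
      symm := by
        rintro f₁ f₂ ⟨φ, hφ, h⟩
        refine ⟨fun x => (φ x)⁻¹, continuous_of_discreteTopology.comp hφ, fun q => ?_⟩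
        rw [h q]; group
      trans := by
        rintro f₁ f₂ f₃ ⟨φ, hφ, h⟩ ⟨φ', hφ', h'⟩
        refine ⟨fun x => φ x * φ' x,
          (continuous_of_discreteTopology (f := fun p : G × G => p.1 * p.2)).comp
            (hφ.prodMk hφ'), fun q => ?_⟩
        rw [h q, h' q]; group }

/-- Equivalence classes of liftings. -/
def LiftingClass [DiscreteTopology G] (τ : BandedGerbe Q G) (p : Hom P Q) :=
  Quotient (Lifting.setoid τ p)

end BandedGerbe

end TopGroupoid

/-! ## Orbifold Riemann surfaces and the groupoids presenting them -/

/-- An orbifold structure on a Riemann surface `S`: `n` distinct marked points, the `j`-th one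
with stabiliser the cyclic group of order `ord j`. -/
structure OrbiStructure (S : Type u) (n : ℕ) where
  pt : Fin n → S
  pt_injective : Function.Injective pt
  ord : Fin n → ℕ+

/-- The open unit disc in `ℂ`. -/
abbrev Disc : Type := Metric.ball (0 : ℂ) 1

/-- The surface punctured at the marked points. -/
abbrev Punctured {S : Type u} {n : ℕ} (pt : Fin n → S) : Type u := {y : S // y ∉ Set.range pt}

/-- The members of a cover consisting of sets `B α` and of coordinate discs. -/
def coverPiece {S : Type u} [TopologicalSpace S] {n : ℕ} {ι : Type v} (B : ι → Set S)
    (chart : Fin n → OpenPartialHomeomorph S ℂ) : ι ⊕ Fin n → Set S :=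
  Sum.elim B fun j => (chart j).source

/-- A good cover of a Riemann surface with marked points `pt`: pairwise disjoint coordinate discs
`D j` around the marked points, and open sets `B α` covering the punctured surface, such that all
nonempty intersections are contractible, there are no quadruple intersections, and the nerve of
the cover is a closed combinatorial surface (every edge lies in two triangles, and all vertex links
are connected). For example the open stars of the vertices of a triangulation in which the marked
points are vertices, no two of them adjacent. -/
structure GoodCover {S : Type u} [TopologicalSpace S] [ChartedSpace ℂ S] {n : ℕ}
    (pt : Fin n → S) (ι : Type v) where
  /-- holomorphic coordinate on the disc `D j`, the source of `chart j` -/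
  chart : Fin n → OpenPartialHomeomorph S ℂ
  chart_mem : ∀ j, chart j ∈ IsManifold.maximalAtlas 𝓘(ℂ) ω S
  chart_target : ∀ j, (chart j).target = Metric.ball 0 1
  pt_mem : ∀ j, pt j ∈ (chart j).source
  chart_pt : ∀ j, chart j (pt j) = 0
  disjoint : ∀ j k, j ≠ k → Disjoint (chart j).source (chart k).source
  B : ι → Set S
  isOpen_B : ∀ α, IsOpen (B α)
  iUnion_B : ⋃ α, B α = (Set.range pt)ᶜ
  contractible_one : ∀ a, ContractibleSpace (coverPiece B chart a)
  contractible_two : ∀ a b, (coverPiece B chart a ∩ coverPiece B chart b).Nonempty →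
    ContractibleSpace ↥(coverPiece B chart a ∩ coverPiece B chart b)
  contractible_three : ∀ a b c, (coverPiece B chart a ∩ coverPiece B chart b ∩ coverPiece B chart c).Nonempty →
    ContractibleSpace ↥(coverPiece B chart a ∩ coverPiece B chart b ∩ coverPiece B chart c)
  no_four : ∀ a b c e, [a, b, c, e].Nodup → coverPiece B chart a ∩ coverPiece B chart b ∩ coverPiece B chart c ∩ coverPiece B chart e = ∅
  edge_two : ∀ a b, a ≠ b → (coverPiece B chart a ∩ coverPiece B chart b).Nonempty →
    {c | c ≠ a ∧ c ≠ b ∧ (coverPiece B chart a ∩ coverPiece B chart b ∩ coverPiece B chart c).Nonempty}.ncard = 2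
  link_connected : ∀ a b b', b ≠ a → b' ≠ a →
    (coverPiece B chart a ∩ coverPiece B chart b).Nonempty → (coverPiece B chart a ∩ coverPiece B chart b').Nonempty →
    Relation.ReflTransGen (fun c c' => c' ≠ a ∧ (coverPiece B chart a ∩ coverPiece B chart c ∩ coverPiece B chart c').Nonempty) b b'

namespace GoodCover

variable {S : Type u} [TopologicalSpace S] [ChartedSpace ℂ S] {n : ℕ}
  {pt : Fin n → S} {ι : Type v}

theorem pow_mem (d : ℕ+) (z : Disc) : (z : ℂ) ^ (d : ℕ) ∈ Metric.ball (0 : ℂ) 1 := by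
  have hz : ‖(z : ℂ)‖ < 1 := mem_ball_zero_iff.mp z.2
  simpa using pow_lt_one₀ (norm_nonneg _) hz d.ne_zero

theorem notMem_B (C : GoodCover pt ι) (j : Fin n) (α : ι) : pt j ∉ C.B α := fun h => by
  have : pt j ∈ ⋃ α, C.B α := Set.mem_iUnion.mpr ⟨α, h⟩
  rw [C.iUnion_B] at this
  exact this ⟨j, rfl⟩

theorem symm_zero (C : GoodCover pt ι) (j : Fin n) : (C.chart j).symm 0 = pt j := by
  rw [← C.chart_pt j, (C.chart j).left_inv (C.pt_mem j)]

theorem symm_mem (C : GoodCover pt ι) (j : Fin n) {w : ℂ} (hw : w ∈ Metric.ball (0 : ℂ) 1) :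
    (C.chart j).symm w ∈ (C.chart j).source :=
  (C.chart j).map_target (by rwa [C.chart_target])

theorem symm_inj (C : GoodCover pt ι) {j k : Fin n} {w w' : ℂ}
    (hw : w ∈ Metric.ball (0 : ℂ) 1) (hw' : w' ∈ Metric.ball (0 : ℂ) 1)
    (h : (C.chart j).symm w = (C.chart k).symm w') : j = k ∧ w = w' := by
  have hjk : j = k := by
    by_contra hne
    exact Set.disjoint_left.mp (C.disjoint j k hne) (C.symm_mem j hw) (h ▸ C.symm_mem k hw')
  subst hjk
  have e : (C.chart j).symm.source = Metric.ball 0 1 := C.chart_target j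
  exact ⟨rfl, (C.chart j).symm.injOn (e ▸ hw) (e ▸ hw') h⟩

theorem symm_notMem_range (C : GoodCover pt ι) (j : Fin n) {w : ℂ}
    (hw : w ∈ Metric.ball (0 : ℂ) 1) (h0 : w ≠ 0) : (C.chart j).symm w ∉ Set.range pt := by
  rintro ⟨k, hk⟩
  rw [← C.symm_zero k] at hk
  exact h0 (C.symm_inj (by simp) hw hk).2.symm

/-- The orbifold chart `𝔇 j → D j`, `z ↦ z ^ d` in the coordinate of `D j`; it is the quotient map
for the action of the `d`-th roots of unity on the disc `𝔇 j` by rotations. -/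
def proj (C : GoodCover pt ι) (d : Fin n → ℕ+) (j : Fin n) (z : Disc) : S :=
  (C.chart j).symm ((z : ℂ) ^ (d j : ℕ))

/-- The objects of the groupoid: the disjoint union of all `B α` and of the discs `𝔇 j`. -/
abbrev Obj (C : GoodCover pt ι) : Type (max u v) := (Σ α, C.B α) ⊕ (Fin n × Disc)

/-- `Rel d x y ζ` says that `ζ` labels an arrow from `x` to `y`. An arrow from `z` to `w` in `𝔇 j`
is a `d j`-th root of unity `ζ` with `w = ζ z`. There is exactly one arrow between a
point of `B α` and a point of `B β` or of `𝔇 j` if they lie over the same point of the surface, and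
none otherwise; the label of such an arrow, `1` or `z` or `z⁻¹`, carries no information, and is
chosen so that composition of arrows is multiplication of labels. -/
def Rel (C : GoodCover pt ι) (d : Fin n → ℕ+) : C.Obj → C.Obj → ℂ → Prop
  | .inl x, .inl y, ζ => (x.2 : S) = y.2 ∧ ζ = 1
  | .inl x, .inr (j, z), ζ => (x.2 : S) = C.proj d j z ∧ ζ = z
  | .inr (j, z), .inl y, ζ => (y.2 : S) = C.proj d j z ∧ ζ = (z : ℂ)⁻¹
  | .inr (j, z), .inr (k, w), ζ => j = k ∧ ζ ^ (d j : ℕ) = 1 ∧ (w : ℂ) = ζ * z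

theorem ne_zero_of_proj_mem (C : GoodCover pt ι) (d : Fin n → ℕ+) {j : Fin n} {z : Disc} {α : ι}
    (h : C.proj d j z ∈ C.B α) : (z : ℂ) ≠ 0 := fun h0 => by
  rw [proj, h0, zero_pow (d j).ne_zero, C.symm_zero] at h
  exact C.notMem_B j α h

theorem Rel.ne_zero {C : GoodCover pt ι} {d : Fin n → ℕ+} {x y : C.Obj} {ζ : ℂ}
    (h : C.Rel d x y ζ) : ζ ≠ 0 := by
  rcases x with ⟨α, x⟩ | ⟨j, z⟩ <;> rcases y with ⟨β, y⟩ | ⟨k, w⟩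
  · rw [h.2]; exact one_ne_zero
  · rw [h.2]; exact C.ne_zero_of_proj_mem d (h.1 ▸ x.2)
  · rw [h.2]; exact inv_ne_zero (C.ne_zero_of_proj_mem d (h.1 ▸ y.2))
  · rintro rfl
    have := h.2.1
    rw [zero_pow (d j).ne_zero] at this
    exact zero_ne_one this

theorem rel_one (C : GoodCover pt ι) (d : Fin n → ℕ+) (x : C.Obj) : C.Rel d x x 1 := by
  rcases x with ⟨α, x⟩ | ⟨j, z⟩
  · exact ⟨rfl, rfl⟩
  · exact ⟨rfl, one_pow _, (one_mul _).symm⟩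

theorem Rel.inv {C : GoodCover pt ι} {d : Fin n → ℕ+} {x y : C.Obj} {ζ : ℂ}
    (h : C.Rel d x y ζ) : C.Rel d y x ζ⁻¹ := by
  have h0 := h.ne_zero
  rcases x with ⟨α, x⟩ | ⟨j, z⟩ <;> rcases y with ⟨β, y⟩ | ⟨k, w⟩
  · exact ⟨h.1.symm, by rw [h.2, inv_one]⟩
  · exact ⟨h.1, by rw [h.2]⟩
  · exact ⟨h.1, by rw [h.2, inv_inv]⟩
  · obtain ⟨rfl, h1, h2⟩ := h
    exact ⟨rfl, by rw [inv_pow, h1, inv_one], by rw [h2]; field_simp⟩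

theorem proj_eq_of_mul (C : GoodCover pt ι) (d : Fin n → ℕ+) {j : Fin n} {z w : Disc} {ζ : ℂ}
    (h1 : ζ ^ (d j : ℕ) = 1) (h2 : (w : ℂ) = ζ * z) : C.proj d j w = C.proj d j z := by
  rw [proj, proj, h2, mul_pow, h1, one_mul]

theorem Rel.mul {C : GoodCover pt ι} {d : Fin n → ℕ+} {x y t : C.Obj} {ζ ξ : ℂ}
    (h : C.Rel d x y ζ) (k : C.Rel d y t ξ) : C.Rel d x t (ζ * ξ) := by
  rcases x with ⟨α, x⟩ | ⟨i, z⟩ <;> rcases y with ⟨β, y⟩ | ⟨j, w⟩ <;>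
    rcases t with ⟨γ, t⟩ | ⟨l, v⟩
  · exact ⟨h.1.trans k.1, by rw [h.2, k.2, one_mul]⟩
  · exact ⟨h.1.trans k.1, by rw [h.2, k.2, one_mul]⟩
  · exact ⟨h.1.trans k.1.symm,
      by rw [h.2, k.2]; exact mul_inv_cancel₀ (C.ne_zero_of_proj_mem d (k.1 ▸ t.2))⟩
  · obtain ⟨rfl, k1, k2⟩ := k
    exact ⟨h.1.trans (C.proj_eq_of_mul d k1 k2).symm, by rw [k2, h.2, mul_comm]⟩
  · exact ⟨k.1.symm.trans h.1, by rw [h.2, k.2, mul_one]⟩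
  · have hz := C.ne_zero_of_proj_mem d (h.1 ▸ y.2)
    obtain ⟨rfl, e⟩ := C.symm_inj (pow_mem _ _) (pow_mem _ _) (h.1.symm.trans k.1)
    refine ⟨rfl, ?_, ?_⟩
    · rw [h.2, k.2, mul_pow, ← e, inv_pow]
      exact inv_mul_cancel₀ (pow_ne_zero _ hz)
    · rw [h.2, k.2]; field_simp
  · obtain ⟨rfl, h1, h2⟩ := h
    refine ⟨k.1.trans (C.proj_eq_of_mul d h1 h2), ?_⟩
    have hw := C.ne_zero_of_proj_mem d (k.1 ▸ t.2)
    rw [h2] at hw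
    rw [k.2, h2, mul_inv]
    rw [← mul_assoc, mul_inv_cancel₀ (left_ne_zero_of_mul hw), one_mul]
  · obtain ⟨rfl, h1, h2⟩ := h
    obtain ⟨rfl, k1, k2⟩ := k
    exact ⟨rfl, by rw [mul_pow, h1, k1, one_mul], by rw [k2, h2]; ring⟩

/-- The arrows (source, target, label), with the subspace topology. -/
abbrev Arr (C : GoodCover pt ι) (d : Fin n → ℕ+) : Type (max u v) :=
  {q : C.Obj × C.Obj × ℂ // C.Rel d q.1 q.2.1 q.2.2}

/-- The étale groupoid presenting the orbifold Riemann surface with stabilisers of orders `d`. -/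
def groupoid (C : GoodCover pt ι) (d : Fin n → ℕ+) : TopGroupoid.{max u v, max u v} where
  Obj := C.Obj
  Arr := C.Arr d
  src q := q.1.1
  tgt q := q.1.2.1
  one x := ⟨(x, x, 1), C.rel_one d x⟩
  inv q := ⟨(q.1.2.1, q.1.1, q.1.2.2⁻¹), q.2.inv⟩
  mul q r h := ⟨(q.1.1, r.1.2.1, q.1.2.2 * r.1.2.2),
    q.2.mul (show C.Rel d q.1.2.1 _ _ from h ▸ r.2)⟩
  src_one _ := rfl
  tgt_one _ := rfl
  src_inv _ := rfl
  tgt_inv _ := rfl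
  src_mul _ _ _ := rfl
  tgt_mul _ _ _ := rfl
  one_mul q := by simp
  mul_one q := by simp
  inv_mul q := by simp [q.2.ne_zero]
  mul_inv q := by simp [q.2.ne_zero]
  mul_assoc q r s _ _ := by simp [_root_.mul_assoc]
  continuous_src := by fun_prop
  continuous_tgt := by fun_prop
  continuous_one := by fun_prop
  continuous_inv := by
    have : Continuous fun q : C.Arr d => q.1.2.2⁻¹ :=
      Continuous.inv₀ (by fun_prop) fun q => q.2.ne_zero
    fun_prop
  continuous_mul := by fun_prop

/-- The exponent attached to an object: `m j` on `𝔇 j` and `1` on all `B α`. -/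
def weight (C : GoodCover pt ι) (m : Fin n → ℕ+) : C.Obj → ℕ :=
  Sum.elim (fun _ => 1) fun p => m p.1

/-- On objects, the covering is the identity on all `B α` and `z ↦ z ^ m j` on `𝔇 j`. -/
def rootObj (C : GoodCover pt ι) (m : Fin n → ℕ+) : C.Obj → C.Obj :=
  Sum.map id fun p => (p.1, ⟨(p.2 : ℂ) ^ (m p.1 : ℕ), pow_mem _ _⟩)

theorem proj_root (C : GoodCover pt ι) (d m : Fin n → ℕ+) (j : Fin n) (z : Disc) :
    C.proj d j ⟨(z : ℂ) ^ (m j : ℕ), pow_mem _ _⟩ = C.proj (m * d) j z := by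
  simp [proj, pow_mul]

theorem Rel.root {C : GoodCover pt ι} {d m : Fin n → ℕ+} {x y : C.Obj} {ζ : ℂ}
    (h : C.Rel (m * d) x y ζ) :
    C.Rel d (C.rootObj m x) (C.rootObj m y) (ζ ^ max (C.weight m x) (C.weight m y)) := by
  have m1 : ∀ j, max 1 (m j : ℕ) = m j := fun j => max_eq_right (m j).2
  have m2 : ∀ j, max (m j : ℕ) 1 = m j := fun j => max_eq_left (m j).2
  rcases x with ⟨α, x⟩ | ⟨j, z⟩ <;> rcases y with ⟨β, y⟩ | ⟨k, w⟩
  · exact ⟨h.1, by rw [h.2, one_pow]⟩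
  · refine ⟨h.1.trans (C.proj_root d m k w).symm, ?_⟩
    rw [h.2]; simp [weight, m1]
  · refine ⟨h.1.trans (C.proj_root d m j z).symm, ?_⟩
    rw [h.2]; simp [weight, m2]
  · obtain ⟨rfl, h1, h2⟩ := h
    refine ⟨rfl, ?_, ?_⟩
    · simp only [weight, Sum.elim_inr, max_self]
      rw [← pow_mul]; simpa using h1
    · simp [weight, h2, mul_pow]

theorem Rel.root_mul {C : GoodCover pt ι} {d m : Fin n → ℕ+} {x y t : C.Obj} {ζ ξ : ℂ}
    (hq : C.Rel (m * d) x y ζ) (hr : C.Rel (m * d) y t ξ) :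
    (ζ * ξ) ^ max (C.weight m x) (C.weight m t)
      = ζ ^ max (C.weight m x) (C.weight m y) * ξ ^ max (C.weight m y) (C.weight m t) := by
  have m1 : ∀ j, max 1 (m j : ℕ) = m j := fun j => max_eq_right (m j).2
  have m2 : ∀ j, max (m j : ℕ) 1 = m j := fun j => max_eq_left (m j).2
  rcases x with ⟨α, x⟩ | ⟨i, z⟩ <;> rcases y with ⟨β, y⟩ | ⟨j, w⟩ <;>
    rcases t with ⟨γ, t⟩ | ⟨l, v⟩
  · simp [weight]
  · simp [weight, m1, hq.2]
  · have hw : (w : ℂ) ≠ 0 := C.ne_zero_of_proj_mem _ (hq.1 ▸ x.2)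
    have e1 : ζ = w := hq.2
    have e2 : ξ = (w : ℂ)⁻¹ := hr.2
    simp [weight, m1, m2, e1, e2, hw]
  · obtain ⟨rfl, -, -⟩ := hr
    simp [weight, m1, mul_pow]
  · simp [weight, m2, hr.2]
  · obtain ⟨rfl, e⟩ := C.symm_inj (pow_mem _ _) (pow_mem _ _) (hq.1.symm.trans hr.1)
    simp [weight, m1, m2, mul_pow]
  · obtain ⟨rfl, -, -⟩ := hq
    simp [weight, m2, mul_pow]
  · obtain ⟨rfl, -, -⟩ := hq
    obtain ⟨rfl, -, -⟩ := hr
    simp [weight, mul_pow]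

theorem continuous_pow_nat {Y : Type*} [TopologicalSpace Y] {f : Y → ℂ} {e : Y → ℕ}
    (hf : Continuous f) (he : Continuous e) : Continuous fun y => f y ^ e y := by
  have : Continuous fun p : ℂ × ℕ => p.1 ^ p.2 :=
    continuous_prod_of_discrete_right.mpr fun k => continuous_pow k
  exact this.comp (hf.prodMk he)

theorem continuous_weight (C : GoodCover pt ι) (m : Fin n → ℕ+) : Continuous (C.weight m) := by
  refine continuous_sum_dom.mpr ⟨continuous_const, ?_⟩
  exact (continuous_of_discreteTopology (f := fun j : Fin n => (m j : ℕ))).comp continuous_fst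

theorem continuous_rootObj (C : GoodCover pt ι) (m : Fin n → ℕ+) : Continuous (C.rootObj m) := by
  refine continuous_id.sumMap ?_
  refine continuous_fst.prodMk (Continuous.subtype_mk ?_ _)
  exact continuous_pow_nat (by fun_prop)
    ((continuous_of_discreteTopology (f := fun j : Fin n => (m j : ℕ))).comp continuous_fst)

/-- The covering `p` from the orbifold Riemann surface with stabilisers of orders `m j * d j` to
the one with stabilisers of orders `d j`. On the arrows of `𝔇 j` it is `ζ ↦ ζ ^ m j`. -/
def rootMap (C : GoodCover pt ι) (d m : Fin n → ℕ+) :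
    TopGroupoid.Hom (C.groupoid (m * d)) (C.groupoid d) where
  obj := C.rootObj m
  arr q := ⟨(C.rootObj m q.1.1, C.rootObj m q.1.2.1,
    q.1.2.2 ^ max (C.weight m q.1.1) (C.weight m q.1.2.1)), q.2.root⟩
  continuous_obj := C.continuous_rootObj m
  continuous_arr := by
    have h1 := C.continuous_rootObj m
    have h2 := C.continuous_weight m
    refine Continuous.subtype_mk ?_ _
    refine (h1.comp (by fun_prop)).prodMk ((h1.comp (by fun_prop)).prodMk ?_)
    exact continuous_pow_nat (by fun_prop) ((h2.comp (by fun_prop)).max (h2.comp (by fun_prop)))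
  src_arr _ := rfl
  tgt_arr _ := rfl
  map_mul q r h := by
    obtain ⟨⟨x, y, ζ⟩, hq⟩ := q
    obtain ⟨⟨y', t, ξ⟩, hr⟩ := r
    obtain rfl : y = y' := h
    refine Subtype.ext (Prod.ext rfl (Prod.ext rfl ?_))
    exact Rel.root_mul hq hr

/-! ### Particular arrows -/

/-- The arrow from `B α` to `B β` at a point of the intersection. -/
def arrBB (C : GoodCover pt ι) (d : Fin n → ℕ+) (α β : ι) (y : S) (hα : y ∈ C.B α)
    (hβ : y ∈ C.B β) : (C.groupoid d).Arr :=
  ⟨(.inl ⟨α, y, hα⟩, .inl ⟨β, y, hβ⟩, 1), rfl, rfl⟩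

/-- The arrow from `B α` to `𝔇 j` that ends at the point `z`. -/
def arrBD (C : GoodCover pt ι) (d : Fin n → ℕ+) (α : ι) (j : Fin n) (z : Disc)
    (h : C.proj d j z ∈ C.B α) : (C.groupoid d).Arr :=
  ⟨(.inl ⟨α, C.proj d j z, h⟩, .inr (j, z), z), rfl, rfl⟩

/-- The point `exp (2 π i s) z` of the disc. -/
def turn (z : Disc) (s : ℝ) : Disc :=
  ⟨Complex.exp (2 * Real.pi * s * Complex.I) * z, by
    have hz := z.2
    rw [mem_ball_zero_iff] at hz ⊢
    have : ‖Complex.exp (2 * Real.pi * s * Complex.I)‖ = 1 := by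
      have := Complex.norm_exp_ofReal_mul_I (2 * Real.pi * s)
      push_cast at this
      exact this
    rwa [norm_mul, this, one_mul]⟩

theorem turn_pow (z : Disc) (s : ℝ) (d : ℕ+) :
    (turn z (s / d) : ℂ) ^ (d : ℕ)
      = Complex.exp (2 * Real.pi * s * Complex.I) * (z : ℂ) ^ (d : ℕ) := by
  have hd : ((d : ℕ) : ℂ) ≠ 0 := Nat.cast_ne_zero.mpr d.ne_zero
  rw [turn, mul_pow, ← Complex.exp_nat_mul]
  congr 2
  push_cast
  field_simp

/-- The arrow of `𝔇 j` that starts at `z` and is the counterclockwise rotation by the angle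
`2 π k / d j`. -/
def arrRot (C : GoodCover pt ι) (d : Fin n → ℕ+) (j : Fin n) (z : Disc) (k : ℕ) :
    (C.groupoid d).Arr :=
  ⟨(.inr (j, z), .inr (j, turn z (k / d j)),
    Complex.exp (2 * Real.pi * ((k / d j : ℝ) : ℂ) * Complex.I)), rfl, by
      have hd : ((d j : ℕ) : ℂ) ≠ 0 := Nat.cast_ne_zero.mpr (d j).ne_zero
      rw [← Complex.exp_nat_mul]
      rw [Complex.exp_eq_one_iff]
      refine ⟨k, ?_⟩
      push_cast
      field_simp, rfl⟩

/-- The centre of a disc. -/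
def origin : Disc := ⟨0, by simp⟩

theorem turn_origin (s : ℝ) : turn origin s = origin :=
  Subtype.ext (mul_zero _)

/-- The arrow lies over the punctured surface: it goes from some `B α` to some `B β`. -/
def OverPunctured (C : GoodCover pt ι) (d : Fin n → ℕ+) (q : (C.groupoid d).Arr) : Prop :=
  q.1.1.isLeft ∧ q.1.2.1.isLeft

/-! ### Loops, chains of members of the cover along paths -/

/-- The punctured open unit disc. -/
abbrev PDisc : Type := {w : ℂ // w ∈ Metric.ball (0 : ℂ) 1 ∧ w ≠ 0}

/-- The point of the punctured disc `D j` with coordinate `w`. -/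
def circlePt (C : GoodCover pt ι) (j : Fin n) (w : PDisc) : Punctured pt :=
  ⟨(C.chart j).symm w, C.symm_notMem_range j w.2.1 w.2.2⟩

theorem turn_ne_zero (w : PDisc) (s : ℝ) : (turn ⟨w.1, w.2.1⟩ s : ℂ) ≠ 0 :=
  mul_ne_zero (Complex.exp_ne_zero _) w.2.2

/-- The circle through the point of `D j` with coordinate `w`, run through once counterclockwise
around the marked point. -/
def circle (C : GoodCover pt ι) (j : Fin n) (w : PDisc) :
    Path (C.circlePt j w) (C.circlePt j w) where
  toFun s := ⟨(C.chart j).symm (turn ⟨w.1, w.2.1⟩ s),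
    C.symm_notMem_range j (turn ⟨w.1, w.2.1⟩ s).2 (turn_ne_zero w s)⟩
  continuous_toFun := by
    refine Continuous.subtype_mk ?_ _
    refine (C.chart j).continuousOn_symm.comp_continuous ?_ fun s => ?_
    · unfold turn; fun_prop
    · rw [C.chart_target]; exact (turn ⟨w.1, w.2.1⟩ s).2
  source' := by
    refine Subtype.ext ?_
    simp [circlePt, turn]
  target' := by
    refine Subtype.ext ?_
    simp [circlePt, turn, Complex.exp_two_pi_mul_I]

/-- A chain of members `B (idx 0), …, B (idx len)` of the cover along a path `γ`, with
`idx 0 = α` and `idx len = β`: on the `s`-th interval of a subdivision of `[0, 1]` the path runs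
inside `B (idx s)`. (The values of `time` and `idx` beyond the indicated range are irrelevant.) -/
structure Chain (C : GoodCover pt ι) {x y : Punctured pt} (γ : Path x y) (α β : ι) where
  len : ℕ
  time : ℕ → I
  idx : ℕ → ι
  time_zero : time 0 = 0
  time_last : time (len + 1) = 1
  idx_zero : idx 0 = α
  idx_last : idx len = β
  time_le : ∀ s ≤ len, time s ≤ time (s + 1)
  mem : ∀ s ≤ len, ∀ r ∈ Set.Icc (time s) (time (s + 1)), (γ r : S) ∈ C.B (idx s)

namespace Chain

variable {C : GoodCover pt ι} {x y : Punctured pt} {γ : Path x y} {α β : ι}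

theorem mem_left (c : Chain C γ α β) (s : Fin c.len) :
    (γ (c.time (s + 1)) : S) ∈ C.B (c.idx s) :=
  c.mem s s.2.le _ ⟨c.time_le s s.2.le, le_rfl⟩

theorem mem_right (c : Chain C γ α β) (s : Fin c.len) :
    (γ (c.time (s + 1)) : S) ∈ C.B (c.idx (s + 1)) :=
  c.mem (s + 1) s.2 _ ⟨le_rfl, c.time_le (s + 1) s.2⟩

/-- The arrow from the `s`-th to the next member of the chain. -/
def arr (c : Chain C γ α β) (d : Fin n → ℕ+) (s : Fin c.len) : (C.groupoid d).Arr :=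
  C.arrBB d (c.idx s) (c.idx (s + 1)) (γ (c.time (s + 1))) (c.mem_left s) (c.mem_right s)

/-- The product of the values of `F` on the successive arrows of the chain. -/
def eval {G : Type w} [Group G] (c : Chain C γ α β) (d : Fin n → ℕ+)
    (F : (C.groupoid d).Arr → G) : G :=
  (List.ofFn fun s => F (c.arr d s)).prod

end Chain

/-- The class of a loop, in the fundamental group with concatenation of loops from left to right
as multiplication (Mathlib's fundamental group has the opposite multiplication). -/
def loopClass {Y : Type*} [TopologicalSpace Y] {y : Y} (γ : Path y y) :
    (FundamentalGroup Y y)ᵐᵒᵖ :=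
  MulOpposite.op (FundamentalGroup.fromPath (Path.Homotopic.Quotient.mk γ))

/-- The word `[a₁, b₁] ⋯ [a_g, b_g] c₁ ⋯ c_n`. -/
def surfaceWord {K : Type*} [Group K] {g n : ℕ} (a b : Fin g → K) (c : Fin n → K) : K :=
  (List.ofFn fun i => ⁅a i, b i⁆).prod * (List.ofFn c).prod

/-- A standard system of generators for a surface of genus `g` with `n` punctures: loops
`a i`, `b i` in the punctured surface, and loops `L j` which go along a path `l j` to a circle around
the `j`-th marked point, once around it counterclockwise, and back, such that the fundamental group
of the punctured surface is generated by them with the single relation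
`[a₁, b₁] ⋯ [a_g, b_g] L₁ ⋯ L_n = 1`; together with chains of members of the cover along these paths,
all of them starting at a member `base_idx` that contains the base point. -/
structure GeneratorSystem (C : GoodCover pt ι) (g : ℕ) where
  base : Punctured pt
  a : Fin g → Path base base
  b : Fin g → Path base base
  /-- coordinate of the end point of `l j` in the disc `D j` -/
  w : Fin n → PDisc
  l : ∀ j, Path base (C.circlePt j (w j))
  base_idx : ι
  /-- the member of the cover at the end point of `l j` -/
  end_idx : Fin n → ι
  chain_a : ∀ i, Chain C (a i) base_idx base_idx
  chain_b : ∀ i, Chain C (b i) base_idx base_idx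
  chain_l : ∀ j, Chain C (l j) base_idx (end_idx j)
  chain_circle : ∀ j, Chain C (C.circle j (w j)) (end_idx j) (end_idx j)
  surjective : Function.Surjective (FreeGroup.lift (Sum.elim (fun i => loopClass (a i))
    (Sum.elim (fun i => loopClass (b i))
      fun j => loopClass ((l j).trans ((C.circle j (w j)).trans (l j).symm)))))
  ker_eq : (FreeGroup.lift (Sum.elim (fun i => loopClass (a i))
    (Sum.elim (fun i => loopClass (b i))
      fun j => loopClass ((l j).trans ((C.circle j (w j)).trans (l j).symm))))).ker
    = Subgroup.normalClosure {surfaceWord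
        (fun i : Fin g => FreeGroup.of (Sum.inl i : Fin g ⊕ Fin g ⊕ Fin n))
        (fun i => FreeGroup.of (Sum.inr (Sum.inl i)))
        (fun j => FreeGroup.of (Sum.inr (Sum.inr j)))}

/-! ### Holonomies -/

section Holonomy

variable {G : Type w} [Group G] [TopologicalSpace G] {d : Fin n → ℕ+}

/-- The holonomy `τ(q, q) τ(q, q²) ⋯ τ(q, q^(d-1))` of the gerbe at the `j`-th marked point, where
`q` is the rotation by `2 π / d` in the stabiliser of the centre of `𝔇 j`. -/
def holPt (C : GoodCover pt ι) (τ : TopGroupoid.BandedGerbe (C.groupoid d) G) (j : Fin n) :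
    Subgroup.center G :=
  (List.ofFn fun k : Fin ((d j : ℕ) - 1) =>
    τ.tau (C.arrRot d j origin 1) (C.arrRot d j origin (k + 1))
      (congrArg (fun z => Sum.inr (j, z)) (turn_origin _))).prod

/-- The point over the point `circle s` of `D j` obtained by lifting the circle to `𝔇 j`. -/
theorem proj_turn (C : GoodCover pt ι) (j : Fin n) (w : PDisc) (z : Disc)
    (hz : (z : ℂ) ^ (d j : ℕ) = w) (s : I) :
    C.proj d j (turn z (s / d j)) = (C.circle j w s : S) := by
  rw [proj, turn_pow, hz]; rfl

theorem proj_eq_circlePt (C : GoodCover pt ι) (j : Fin n) (w : PDisc) (z : Disc)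
    (hz : (z : ℂ) ^ (d j : ℕ) = w) : C.proj d j z = (C.circlePt j w : S) := by
  rw [proj, hz]; rfl

theorem Chain.start_mem {C : GoodCover pt ι} {x y : Punctured pt} {γ : Path x y} {α β : ι}
    (c : Chain C γ α β) : (x : S) ∈ C.B α := by
  have := c.mem 0 (Nat.zero_le _) 0 ⟨c.time_zero.le, bot_le⟩
  rwa [γ.source, c.idx_zero] at this

/-- The holonomy around the circle through the point of `D j` with coordinate `w`, with respect to
a point `z` of `𝔇 j` over it and a chain of members `B₁, …, B_J, B₁` along the circle. With
`h_s` the arrow from `B_s` to the next member of the chain and `g_s` the arrows to `𝔇 j`,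
ending on the lift of the circle that starts at `z`, it is
`τ(g_1, q) τ(h_1, g_2) τ(h_2, g_3) ⋯ τ(h_J, g_1')`, where `q` is the rotation by `2 π / d` that
starts at `z`, and `g_1'` is the arrow from `B₁` that ends in the sheet reached after one turn. -/
def holLoop (C : GoodCover pt ι) (τ : TopGroupoid.BandedGerbe (C.groupoid d) G) (j : Fin n)
    (w : PDisc) (z : Disc) (hz : (z : ℂ) ^ (d j : ℕ) = w) {α : ι}
    (c : Chain C (C.circle j w) α α) : Subgroup.center G :=
  τ.tau (C.arrBD d α j z (by rw [C.proj_eq_circlePt j w z hz]; exact c.start_mem))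
      (C.arrRot d j z 1) rfl *
    (List.ofFn fun s : Fin c.len => τ.tau (c.arr d s)
      (C.arrBD d (c.idx (s + 1)) j (turn z ((c.time (s + 1) : ℝ) / d j))
        (by rw [C.proj_turn j w z hz]; exact c.mem_right s))
      (congrArg Sum.inl (Sigma.ext rfl (heq_of_eq (Subtype.ext (C.proj_turn j w z hz _).symm))))).prod

/-- The cocycle is trivial over the punctured surface. -/
def TrivialOnPunctured (C : GoodCover pt ι) (τ : TopGroupoid.BandedGerbe (C.groupoid d) G) : Prop :=
  ∀ q r h, C.OverPunctured d q → C.OverPunctured d r → τ.tau q r h = 1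

end Holonomy

end GoodCover

/-! ## The set of tuples -/

section Tuples

variable {G : Type w} [Group G]

/-- Tuples `(a₁, b₁, …, a_g, b_g, c₁, …, c_n)` in `G^(2g+n)`. -/
structure Tuple (G : Type w) (g n : ℕ) where
  a : Fin g → G
  b : Fin g → G
  c : Fin n → G

/-- The set of tuples with `[a₁, b₁] ⋯ [a_g, b_g] = h₁ ⋯ h_n c_n ⋯ c₁` and
`c_j ^ (m_j d_j) e_j ^ m_j = 1`. -/
def chi (g : ℕ) {n : ℕ} (d m : Fin n → ℕ+) (h e : Fin n → Subgroup.center G) :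
    Set (Tuple G g n) :=
  {t | (List.ofFn fun i => ⁅t.a i, t.b i⁆).prod
        = (((List.ofFn h).prod : Subgroup.center G) : G) * (List.ofFn t.c).reverse.prod ∧
      ∀ j, t.c j ^ (m j * d j : ℕ) * (e j : G) ^ (m j : ℕ) = 1}

/-- Simultaneous conjugation on a set of tuples. -/
def conjSetoid {g n : ℕ} (T : Set (Tuple G g n)) : Setoid T where
  r t t' := ∃ k : G, (∀ i, t.1.a i = k * t'.1.a i * k⁻¹) ∧ (∀ i, t.1.b i = k * t'.1.b i * k⁻¹) ∧
    ∀ j, t.1.c j = k * t'.1.c j * k⁻¹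
  iseqv :=
    { refl := fun t => ⟨1, by simp, by simp, by simp⟩
      symm := by
        rintro t t' ⟨k, h1, h2, h3⟩
        refine ⟨k⁻¹, fun i => ?_, fun i => ?_, fun j => ?_⟩
        · rw [h1]; group
        · rw [h2]; group
        · rw [h3]; group
      trans := by
        rintro t t' t'' ⟨k, h1, h2, h3⟩ ⟨k', h1', h2', h3'⟩
        refine ⟨k * k', fun i => ?_, fun i => ?_, fun j => ?_⟩
        · rw [h1, h1']; group
        · rw [h2, h2']; group
        · rw [h3, h3']; group }

end Tuples

section Values

variable {S : Type u} [TopologicalSpace S] [ChartedSpace ℂ S] {n g : ℕ}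
  {pt : Fin n → S} {ι : Type v} {G : Type w} [Group G] {C : GoodCover pt ι}

/-- The tuple `(F(a₁), F(b₁), …, F(a_g), F(b_g), F(g₁), …, F(g_n))`, where `F` of a loop is the
product along the chain and `g_j` is the generator of the stabiliser at the centre of `𝔇 j`. -/
def GoodCover.GeneratorSystem.tuple (Λ : C.GeneratorSystem g) (d : Fin n → ℕ+)
    (F : (C.groupoid d).Arr → G) : Tuple G g n where
  a i := (Λ.chain_a i).eval d F
  b i := (Λ.chain_b i).eval d F
  c j := F (C.arrRot d j GoodCover.origin 1)

/-- `F` is normalised at the discs: for each `j`, the product of `F` along the path `l j` is inverse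
to the value of `F` on the arrow to `𝔇 j` that ends at the point `z j` over the end point of `l j`. -/
def GoodCover.GeneratorSystem.Normalised (Λ : C.GeneratorSystem g) (d : Fin n → ℕ+)
    (F : (C.groupoid d).Arr → G) (z : Fin n → Disc)
    (hz : ∀ j, (z j : ℂ) ^ (d j : ℕ) = Λ.w j) : Prop :=
  ∀ j, (Λ.chain_l j).eval d F * F (C.arrBD d (Λ.end_idx j) j (z j)
    (by rw [C.proj_eq_circlePt j _ _ (hz j)]; exact (Λ.chain_circle j).start_mem)) = 1

end Values

end

/-! The statement is Čech theory for local systems, with a central twist at the discs. A lifting q ↦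
(F(q), q) is the same as a locally constant F on the arrows that is multiplicative up to the central
factor τ (`IsTwisted`). Multiplying F by ψ passes between cohomologous cocycles and respects gauge
equivalence, since ψ is central; so everything in (2) can be computed with the cocycle that is
trivial over the punctured surface.

For (1), τ is constant on triple intersections, hence a simplicial 2-cocycle on the nerve. After an
explicit correction it is alternating, and an alternating 2-cochain on a closed combinatorial
surface is a coboundary away from at least one puncture: a value on one triangle can be pushed
across an edge to the neighbouring triangle, and along a chain of triangles to one containing a
puncture, where it disappears (`PuncturedSurface.fill`, `PuncturedSurface.exists_bd_eq`).

For (2), the values of F over the punctured surface form an ordinary local system. Local systems are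
classified by monodromy: every representation of the fundamental group occurs
(`LocalSystem.exists_monodromy_eq`), and equal monodromies give gauge equivalent systems
(`LocalSystem.exists_gauge`). What remains are the values on the arrows into a disc and the value
σ_j on the generating rotation. The full rotation is a unit arrow, which forces the power relation
for σ_j. Following F once around the lifted circle ends one sheet further on and relates F(∂_j) to
σ_j (`valBD_eq_eval_circle`); after normalisation F(L_j) = σ_j⁻¹ hol(L_j)⁻¹, so the surface relation
becomes the displayed equation, the order of the σ_j being reversed by taking inverses.

Conversely, a tuple prescribes a representation and hence a local system. Its extension to the
arrows into a disc is a section over the universal cover of the punctured disc, a half-plane; the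
power relation makes this section invariant under the deck group, so that it descends
(`exists_discExtension`). The pieces are then glued (`isTwisted_glue`). Normalisation leaves as
freedom at a disc only a constant common to all generators, times a power of σ_j and a central
element; the latter two commute with σ_j, so tuples are determined up to simultaneous conjugation.

All this is applied to the pull-back p^*τ, with stabiliser orders m_j d_j: there the holonomy at a
marked point is raised to the power m_j, while the holonomy around a circle is unchanged. -/

noncomputable section

/-! ## Locally constant Čech cocycles and parallel transport -/

/-- A locally constant 1-cocycle with values in `G` on an open cover `U` of `Y`. -/
structure LocalSystem (Y : Type u) (ι : Type v) (G : Type w) [TopologicalSpace Y]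
    [TopologicalSpace G] [Group G] where
  U : ι → Set Y
  isOpen : ∀ α, IsOpen (U α)
  cover : ∀ y, ∃ α, y ∈ U α
  c : ι → ι → Y → G
  continuousOn : ∀ α β, ContinuousOn (c α β) (U α ∩ U β)
  mul : ∀ α β γ y, y ∈ U α → y ∈ U β → y ∈ U γ → c α β y * c β γ y = c α γ y

theorem ContinuousOn.eq_of_isPreconnected {X K : Type*} [TopologicalSpace X] [TopologicalSpace K]
    [DiscreteTopology K] {f : X → K} {s : Set X} (hf : ContinuousOn f s) (hs : IsPreconnected s)
    {x y : X} (hx : x ∈ s) (hy : y ∈ s) : f x = f y :=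
  hs.constant_of_mapsTo (T := Set.univ) (by rw [isDiscrete_univ_iff]; infer_instance) hf
    (Set.mapsTo_univ _ _) hx hy

namespace LocalSystem

variable {Y : Type u} {ι : Type v} {G : Type w} [TopologicalSpace Y]
    [TopologicalSpace G] [Group G]

theorem c_self (L : LocalSystem Y ι G) {α : ι} {y : Y} (h : y ∈ L.U α) : L.c α α y = 1 := by
  simpa using L.mul α α α y h h h

/-- The pull-back of a local system along a continuous map. -/
def comap {Z : Type*} [TopologicalSpace Z] (L : LocalSystem Y ι G) (f : C(Z, Y)) :
    LocalSystem Z ι G where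
  U α := f ⁻¹' L.U α
  isOpen α := (L.isOpen α).preimage f.continuous
  cover z := L.cover (f z)
  c α β z := L.c α β (f z)
  continuousOn α β := (L.continuousOn α β).comp f.continuous.continuousOn fun _ h => h
  mul α β γ z := L.mul α β γ (f z)

/-- A flat section of the torsor glued by the cocycle. -/
def IsSection (L : LocalSystem Y ι G) (s : ι → Y → G) : Prop :=
  (∀ α, ContinuousOn (s α) (L.U α)) ∧
    ∀ α β y, y ∈ L.U α → y ∈ L.U β → s α y = L.c α β y * s β y

theorem IsSection.comap {Z : Type*} [TopologicalSpace Z] {L : LocalSystem Y ι G} {s : ι → Y → G}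
    (hs : L.IsSection s) (f : C(Z, Y)) : (L.comap f).IsSection fun α z => s α (f z) :=
  ⟨fun α => (hs.1 α).comp f.continuous.continuousOn fun _ h => h, fun α β z => hs.2 α β (f z)⟩

/-- The map `h` is only required to agree pointwise with the composite, so that a section over a
larger domain can be restricted to a path given by its own formula. -/
theorem IsSection.comap_comap {Z W : Type*} [TopologicalSpace Z] [TopologicalSpace W]
    {L : LocalSystem Y ι G} {g : C(W, Y)} {s : ι → W → G} (hs : (L.comap g).IsSection s)
    (f : C(Z, W)) {h : C(Z, Y)} (hh : ∀ z, g (f z) = h z) :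
    (L.comap h).IsSection fun α z => s α (f z) := by
  obtain rfl : h = g.comp f := by ext z; exact (hh z).symm
  exact hs.comap f

variable [DiscreteTopology G]

/-- The covering space, with fibre `G`, defined by a local system. -/
def core (L : LocalSystem Y ι G) : FiberBundleCore ι Y G where
  baseSet := L.U
  isOpen_baseSet := L.isOpen
  indexAt y := (L.cover y).choose
  mem_baseSet_at y := (L.cover y).choose_spec
  coordChange α β y g := L.c β α y * g
  coordChange_self α y h g := by rw [L.c_self h, one_mul]
  continuousOn_coordChange α β := by
    have h1 : ContinuousOn (fun p : Y × G => L.c β α p.1) ((L.U α ∩ L.U β) ×ˢ Set.univ) :=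
      (L.continuousOn β α).comp continuous_fst.continuousOn fun p hp => ⟨hp.1.2, hp.1.1⟩
    exact (continuous_of_discreteTopology (f := fun p : G × G => p.1 * p.2)).comp_continuousOn
      (h1.prodMk continuous_snd.continuousOn)
  coordChange_comp α β γ y h g := by
    rw [← mul_assoc, L.mul γ β α y h.2 h.1.2 h.1.1]

/-- With discrete fibre the bundle `L.core` is a covering, so the identity of a simply connected
base lifts to it; the fibre coordinates of the lift in the local trivialisations form the section.
-/
theorem exists_section [SimplyConnectedSpace Y] [LocallyPathConnectedSpace Y]
    (L : LocalSystem Y ι G) : ∃ s, L.IsSection s := by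
  have cov : IsCoveringMap (Bundle.TotalSpace.proj : L.core.TotalSpace → Y) :=
    FiberBundle.isCoveringMap
  obtain ⟨y₀⟩ : Nonempty Y := inferInstance
  obtain ⟨F, ⟨-, hF⟩, -⟩ := cov.existsUnique_continuousMap_lifts (ContinuousMap.id Y) y₀
    ⟨y₀, (1 : G)⟩ rfl
  have hp : ∀ y, (F y).proj = y := fun y => congrFun hF y
  refine ⟨fun α y => (L.core.localTriv α (F y)).2, fun α => ?_, fun α β y hα hβ => ?_⟩
  · refine continuous_snd.comp_continuousOn
      ((L.core.localTriv α).continuousOn_toFun.comp F.continuous.continuousOn fun y hy => ?_)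
    change F y ∈ (L.core.localTriv α).source
    rw [L.core.mem_localTriv_source]
    change (F y).proj ∈ L.U α
    rwa [hp]
  · obtain ⟨v, e⟩ : ∃ v : G, ∀ α, (L.core.localTriv α (F y)).2
        = L.c α (L.cover (F y).proj).choose (F y).proj * v := ⟨(F y).snd, fun α => rfl⟩
    rw [hp] at e
    beta_reduce
    rw [e, e, ← L.mul _ _ _ _ hα hβ (L.cover y).choose_spec, mul_assoc]

/-- A section over Z of the system pulled back by `r` restricts along `i`. It is used for the
interval and the square as retracts of ℝ and ℝ². -/
theorem exists_section_of_retract {Z : Type*} [TopologicalSpace Z] [SimplyConnectedSpace Z]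
    [LocallyPathConnectedSpace Z] (r : C(Z, Y)) (i : C(Y, Z)) (h : ∀ y, r (i y) = y)
    (L : LocalSystem Y ι G) : ∃ s, L.IsSection s := by
  obtain ⟨s, hs⟩ := (L.comap r).exists_section
  refine ⟨fun α y => s α (i y), fun α => ?_, fun α β y hα hβ => ?_⟩
  · exact (hs.1 α).comp i.continuous.continuousOn fun y hy => show r (i y) ∈ L.U α by rwa [h]
  · have := hs.2 α β (i y) (show r (i y) ∈ L.U α by rwa [h]) (show r (i y) ∈ L.U β by rwa [h])
    change _ = L.c α β (r (i y)) * _ at this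
    rwa [h] at this

theorem exists_section_I (L : LocalSystem I ι G) : ∃ s, L.IsSection s :=
  L.exists_section_of_retract (Z := ℝ) ⟨Set.projIcc 0 1 zero_le_one, continuous_projIcc⟩
    ⟨Subtype.val, continuous_subtype_val⟩ fun y => Set.projIcc_val zero_le_one y

theorem exists_section_square (L : LocalSystem (I × I) ι G) : ∃ s, L.IsSection s :=
  L.exists_section_of_retract (Z := ℝ × ℝ)
    ⟨Prod.map (Set.projIcc 0 1 zero_le_one) (Set.projIcc 0 1 zero_le_one),
      continuous_projIcc.prodMap continuous_projIcc⟩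
    ⟨Prod.map Subtype.val Subtype.val, continuous_subtype_val.prodMap continuous_subtype_val⟩
    fun y => Prod.ext (Set.projIcc_val zero_le_one y.1) (Set.projIcc_val zero_le_one y.2)

/-- Two flat sections differ by a locally constant function. -/
theorem IsSection.div_eq [PreconnectedSpace Y] {L : LocalSystem Y ι G} {s t : ι → Y → G}
    (hs : L.IsSection s) (ht : L.IsSection t) {α β : ι} {x y : Y} (hx : x ∈ L.U α)
    (hy : y ∈ L.U β) : (s α x)⁻¹ * t α x = (s β y)⁻¹ * t β y := by
  have key : ∀ α β y, y ∈ L.U α → y ∈ L.U β → (s α y)⁻¹ * t α y = (s β y)⁻¹ * t β y := by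
    intro α β y hα hβ
    rw [hs.2 α β y hα hβ, ht.2 α β y hα hβ]
    group
  let f : Y → G := fun y => (s (L.cover y).choose y)⁻¹ * t (L.cover y).choose y
  have hf : ∀ α y, y ∈ L.U α → f y = (s α y)⁻¹ * t α y := fun α y h =>
    key _ _ _ (L.cover y).choose_spec h
  have hc : Continuous f := by
    refine continuous_iff_continuousAt.mpr fun y => ?_
    obtain ⟨α, hα⟩ := L.cover y
    have h1 : ContinuousOn (fun y => (s α y)⁻¹ * t α y) (L.U α) :=
      (continuous_of_discreteTopology (f := fun p : G × G => p.1⁻¹ * p.2)).comp_continuousOn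
        ((hs.1 α).prodMk (ht.1 α))
    exact (h1.congr fun y h => hf α y h).continuousAt ((L.isOpen α).mem_nhds hα)
  rw [← hf _ _ hx, ← hf _ _ hy]
  exact PreconnectedSpace.constant ‹_› hc

/-- Parallel transport along a path, with respect to trivialisations at its end points. -/
def transport (L : LocalSystem Y ι G) {x y : Y} (γ : Path x y) (α β : ι) : G :=
  (L.comap γ.toContinuousMap).exists_section_I.choose α 0 *
    ((L.comap γ.toContinuousMap).exists_section_I.choose β 1)⁻¹

variable {x y z : Y}

/-- Two sections along γ differ by a constant right factor, which cancels in the quotient; hence any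
section computes the transport. -/
theorem transport_eq (L : LocalSystem Y ι G) (γ : Path x y) {α β : ι} (hx : x ∈ L.U α)
    (hy : y ∈ L.U β) {s : ι → I → G} (hs : (L.comap γ.toContinuousMap).IsSection s) :
    L.transport γ α β = s α 0 * (s β 1)⁻¹ := by
  have h := hs.div_eq (L.comap γ.toContinuousMap).exists_section_I.choose_spec
    (α := α) (β := β) (x := 0) (y := 1) (show γ 0 ∈ L.U α by rwa [γ.source])
    (show γ 1 ∈ L.U β by rwa [γ.target])
  rw [transport]
  rw [inv_mul_eq_iff_eq_mul] at h
  rw [h]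
  group

/-- A section over the square of the homotopy restricts to sections along both paths. On the two
sides where the homotopy is stationary the relevant components are constant, so the end values
agree. -/
theorem transport_homotopic (L : LocalSystem Y ι G) {γ γ' : Path x y} (h : γ.Homotopic γ')
    {α β : ι} (hx : x ∈ L.U α) (hy : y ∈ L.U β) : L.transport γ α β = L.transport γ' α β := by
  obtain ⟨H⟩ := h
  obtain ⟨s, hs⟩ := (L.comap H.toContinuousMap).exists_section_square
  have h0 := L.transport_eq γ hx hy (s := fun α t => s α (0, t)) <|
    hs.comap_comap (⟨fun t : I => ((0 : I), t), by fun_prop⟩ : C(I, I × I)) H.apply_zero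
  have h1 := L.transport_eq γ' hx hy (s := fun α t => s α (1, t)) <|
    hs.comap_comap (⟨fun t : I => ((1 : I), t), by fun_prop⟩ : C(I, I × I)) H.apply_one
  have e0 : s α (0, 0) = s α (1, 0) := by
    have : Continuous fun t : I => s α (t, 0) := by
      refine continuousOn_univ.mp ((hs.1 α).comp (f := fun t : I => (t, (0 : I)))
        (by fun_prop) fun t _ => ?_)
      change H (t, 0) ∈ L.U α
      rwa [H.source]
    exact PreconnectedSpace.constant inferInstance this
  have e1 : s β (0, 1) = s β (1, 1) := by
    have : Continuous fun t : I => s β (t, 1) := by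
      refine continuousOn_univ.mp ((hs.1 β).comp (f := fun t : I => (t, (1 : I)))
        (by fun_prop) fun t _ => ?_)
      change H (t, 1) ∈ L.U β
      rwa [H.target]
    exact PreconnectedSpace.constant inferInstance this
  rw [h0, h1, e0, e1]

/-- One section along the concatenated path restricts to sections along the two halves, and the
values at the junction cancel. -/
theorem transport_trans (L : LocalSystem Y ι G) (γ : Path x y) (γ' : Path y z) {α β δ : ι}
    (hx : x ∈ L.U α) (hy : y ∈ L.U β) (hz : z ∈ L.U δ) :
    L.transport (γ.trans γ') α δ = L.transport γ α β * L.transport γ' β δ := by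
  obtain ⟨s, hs⟩ := (L.comap (γ.trans γ').toContinuousMap).exists_section_I
  let l : C(I, I) := ⟨fun t => ⟨(t : ℝ) / 2, by
    constructor <;> linarith [t.2.1, t.2.2]⟩, by fun_prop⟩
  let r : C(I, I) := ⟨fun t => ⟨((t : ℝ) + 1) / 2, by
    constructor <;> linarith [t.2.1, t.2.2]⟩, by fun_prop⟩
  have hl : ∀ t, (γ.trans γ') (l t) = γ t := fun t => by
    rw [Path.trans_apply]
    refine (dif_pos (show (t : ℝ) / 2 ≤ 1 / 2 by linarith [t.2.2])).trans ?_
    congr 1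
    exact Subtype.ext (show 2 * ((t : ℝ) / 2) = t by ring)
  have hr : ∀ t, (γ.trans γ') (r t) = γ' t := fun t => by
    rw [Path.trans_apply]
    split_ifs with h
    -- The second half meets the first branch of the concatenation only at its initial point, where
    -- γ has reached its end.
    · have h' : ((t : ℝ) + 1) / 2 ≤ 1 / 2 := h
      have ht : t = 0 := Subtype.ext (le_antisymm (by change (t : ℝ) ≤ 0; linarith) t.2.1)
      subst ht
      rw [γ'.source]
      convert γ.target using 2
      exact Subtype.ext (show 2 * (((0 : ℝ) + 1) / 2) = 1 by ring)
    · congr 1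
      exact Subtype.ext (show 2 * (((t : ℝ) + 1) / 2) - 1 = t by ring)
  have h0 := L.transport_eq γ hx hy (s := fun α t => s α (l t)) <|
    hs.comap_comap l hl
  have h1 := L.transport_eq γ' hy hz (s := fun α t => s α (r t)) <|
    hs.comap_comap r hr
  have e0 : l 0 = 0 := Subtype.ext (zero_div _)
  have e1 : l 1 = r 0 := Subtype.ext (show (1 : ℝ) / 2 = (0 + 1) / 2 by ring)
  have e2 : r 1 = 1 := Subtype.ext (show ((1 : ℝ) + 1) / 2 = 1 by norm_num)
  rw [L.transport_eq _ hx hz hs, h0, h1, e0, e1, e2]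
  group

theorem transport_of_subset (L : LocalSystem Y ι G) (γ : Path x y) {α : ι}
    (h : ∀ t, γ t ∈ L.U α) : L.transport γ α α = 1 := by
  obtain ⟨s, hs⟩ := (L.comap γ.toContinuousMap).exists_section_I
  have hx : x ∈ L.U α := γ.source ▸ h 0
  have hy : y ∈ L.U α := γ.target ▸ h 1
  have : Continuous (s α) := by
    refine continuousOn_univ.mp ((hs.1 α).mono fun t _ => h t)
  rw [L.transport_eq γ hx hy hs, PreconnectedSpace.constant inferInstance this (y := 1)]
  group

/-- A constant path only changes the trivialisation, so the cocycle itself can be recovered from the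
transport. -/
theorem transport_refl (L : LocalSystem Y ι G) {α β : ι} (hα : x ∈ L.U α) (hβ : x ∈ L.U β) :
    L.transport (Path.refl x) α β = L.c α β x := by
  obtain ⟨s, hs⟩ := (L.comap (Path.refl x).toContinuousMap).exists_section_I
  have : Continuous (s β) := by
    refine continuousOn_univ.mp ((hs.1 β).mono fun t _ => hβ)
  rw [L.transport_eq _ hα hβ hs, PreconnectedSpace.constant inferInstance this (y := 0),
    hs.2 α β 0 hα hβ, mul_inv_cancel_right]
  rfl

/-- The holonomy representation at a base point. -/
def monodromy (L : LocalSystem Y ι G) {x : Y} {α : ι} (hx : x ∈ L.U α) :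
    (FundamentalGroup Y x)ᵐᵒᵖ →* G where
  toFun γ := Quotient.lift (s := Path.Homotopic.setoid x x) (fun γ => L.transport γ α α)
    (fun _ _ h => L.transport_homotopic h hx hx) γ.unop
  map_one' := (L.transport_refl hx hx).trans (L.c_self hx)
  map_mul' γ δ := by
    obtain ⟨γ⟩ := γ
    obtain ⟨δ⟩ := δ
    induction γ using Quotient.inductionOn
    induction δ using Quotient.inductionOn
    exact L.transport_trans _ _ hx hx hx

theorem monodromy_loopClass (L : LocalSystem Y ι G) {x : Y} {α : ι} (hx : x ∈ L.U α)
    (γ : Path x x) : L.monodromy hx (GoodCover.loopClass γ) = L.transport γ α α := rfl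

end LocalSystem
end

noncomputable section

/-! ## The local system of a representation of the fundamental group -/

namespace LocalSystem

variable {Y : Type u} {ι : Type v} {G : Type w} [TopologicalSpace Y]
    [Group G]

/-- A compatible choice of path classes from a base point to the points of the set `V`. -/
def IsFrame {x : Y} (V : Set Y) (t : ∀ y, Path.Homotopic.Quotient x y) : Prop :=
  ∀ (y y' : Y) (ε : Path y y'), (∀ r, ε r ∈ V) →
    t y' = (t y).trans (Path.Homotopic.Quotient.mk ε)

/-- Fix one class from `x` to a point of V and continue it by paths inside V; the choice of these
does not matter because paths in V with common ends are homotopic. Taking the trivial class when `x`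
lies in V later makes the monodromy equal to the given representation, not merely conjugate to it.
-/
theorem exists_isFrame [PathConnectedSpace Y] (x : Y) {V : Set Y}
    (hV : ∀ y ∈ V, ∀ y' ∈ V, JoinedIn V y y')
    (hV' : ∀ (y y' : Y) (γ γ' : Path y y'), (∀ r, γ r ∈ V) → (∀ r, γ' r ∈ V) → γ.Homotopic γ') :
    ∃ t : ∀ y, Path.Homotopic.Quotient x y, IsFrame V t ∧ (x ∈ V → t x = .refl x) := by
  classical
  -- The reference point is `x` itself whenever possible; the condition fails only for empty V,
  -- where any classes will do.
  by_cases hne : ∃ y, y ∈ V ∧ (x ∈ V → y = x)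
  swap
  · have hV0 : ∀ y, y ∉ V := fun y hy => hne <| by
      by_cases hx : x ∈ V
      · exact ⟨x, hx, fun _ => rfl⟩
      · exact ⟨y, hy, fun h => absurd h hx⟩
    exact ⟨fun y => .mk (PathConnectedSpace.somePath x y), fun y y' ε h => absurd (h 0) (hV0 _),
      fun h => absurd h (hV0 _)⟩
  obtain ⟨y₀, hy₀, hx₀⟩ := hne
  obtain ⟨p, hp⟩ : ∃ p : Path.Homotopic.Quotient x y₀, ∀ h : x ∈ V,
      p = (Path.Homotopic.Quotient.refl x).cast rfl (hx₀ h) := by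
    by_cases h : x ∈ V
    · exact ⟨(Path.Homotopic.Quotient.refl x).cast rfl (hx₀ h), fun _ => rfl⟩
    · exact ⟨.mk (PathConnectedSpace.somePath x y₀), fun h' => absurd h' h⟩
  have ht : ∀ y (hy : y ∈ V), ∃ γ : Path y₀ y, ∀ r, γ r ∈ V := fun y hy => hV y₀ hy₀ y hy
  choose γ hγ using ht
  refine ⟨fun y => if hy : y ∈ V then p.trans (.mk (γ y hy)) else
    .mk (PathConnectedSpace.somePath x y), fun y y' ε h => ?_, fun h => ?_⟩
  · have hy : y ∈ V := ε.source ▸ h 0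
    have hy' : y' ∈ V := ε.target ▸ h 1
    dsimp only
    rw [dif_pos hy, dif_pos hy', Path.Homotopic.Quotient.trans_assoc,
      ← Path.Homotopic.Quotient.mk_trans]
    congr 1
    refine Path.Homotopic.Quotient.eq.mpr (hV' _ _ _ _ (hγ _ _) fun r => ?_)
    have : (γ y hy).trans ε r ∈ Set.range ((γ y hy).trans ε) := ⟨r, rfl⟩
    rw [Path.trans_range] at this
    rcases this with ⟨r, hr⟩ | ⟨r, hr⟩
    · exact hr ▸ hγ y hy r
    · exact hr ▸ h r
  · dsimp only
    rw [dif_pos h, hp h]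
    obtain rfl := hx₀ h
    rw [Path.Homotopic.Quotient.cast_rfl_rfl, Path.Homotopic.Quotient.refl_trans,
      ← Path.Homotopic.Quotient.mk_refl]
    exact Path.Homotopic.Quotient.eq.mpr (hV' _ _ _ _ (hγ _ _) fun r => h)

section OfRep

variable {x : Y} (ρ : (FundamentalGroup Y x)ᵐᵒᵖ →* G)

/-- The value of a representation on a class of loops. -/
def repVal (γ : Path.Homotopic.Quotient x x) : G :=
  ρ (MulOpposite.op (FundamentalGroup.fromPath γ))

theorem repVal_trans (γ δ : Path.Homotopic.Quotient x x) :
    repVal ρ (γ.trans δ) = repVal ρ γ * repVal ρ δ :=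
  map_mul ρ (MulOpposite.op (FundamentalGroup.fromPath γ))
    (MulOpposite.op (FundamentalGroup.fromPath δ))

theorem repVal_refl : repVal ρ (.refl x) = 1 := map_one ρ

theorem repVal_div_mul {y z : Y} (p q : Path.Homotopic.Quotient x y)
    (r : Path.Homotopic.Quotient y z) (s : Path.Homotopic.Quotient x z) :
    repVal ρ (p.trans q.symm) * repVal ρ ((q.trans r).trans s.symm)
      = repVal ρ ((p.trans r).trans s.symm) := by
  rw [← repVal_trans]
  congr 1
  simp only [Path.Homotopic.Quotient.trans_assoc]
  congr 1
  rw [← Path.Homotopic.Quotient.trans_assoc, Path.Homotopic.Quotient.symm_trans,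
    Path.Homotopic.Quotient.refl_trans]

variable [TopologicalSpace G] [DiscreteTopology G]
  (U : ι → Set Y) (hU : ∀ α, IsOpen (U α)) (hcov : ∀ y, ∃ α, y ∈ U α)
  (hj : ∀ α β, ∀ y ∈ U α ∩ U β, ∀ y' ∈ U α ∩ U β, JoinedIn (U α ∩ U β) y y')
  (t : ι → ∀ y, Path.Homotopic.Quotient x y) (ht : ∀ α, IsFrame (U α) (t α))

/-- The local system defined by a representation of the fundamental group, and frames. -/
def ofRep : LocalSystem Y ι G where
  U := U
  isOpen := hU
  cover := hcov
  c α β y := repVal ρ ((t α y).trans (t β y).symm)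
  continuousOn α β := by
    have : ∀ y ∈ U α ∩ U β, ∀ y' ∈ U α ∩ U β,
        repVal ρ ((t α y).trans (t β y).symm) = repVal ρ ((t α y').trans (t β y').symm) := by
      intro y hy y' hy'
      obtain ⟨ε, hε⟩ := hj α β y hy y' hy'
      rw [ht α y y' ε fun r => (hε r).1, ht β y y' ε fun r => (hε r).2]
      have h := repVal_div_mul ρ (t α y) (t β y) (.mk ε) ((t β y).trans (.mk ε))
      rw [Path.Homotopic.Quotient.trans_symm, repVal_refl, mul_one] at h
      exact h
    intro y hy
    exact continuousWithinAt_const.congr (fun y' hy' => this y' hy' y hy) rfl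
  mul α β γ y _ _ _ := by
    have := repVal_div_mul ρ (t α y) (t β y) (.refl y) (t γ y)
    simpa only [Path.Homotopic.Quotient.trans_refl] using this

/-- Along γ a section is given by applying ρ to: the frame up to γ(r), then the rest of γ, then back
along the frame at the end. It is locally constant because a frame absorbs short pieces of γ, and it
is trivial at r = 1. -/
theorem transport_ofRep {y z : Y} (γ : Path y z) {α β : ι} (hy : y ∈ U α) (hz : z ∈ U β) :
    (ofRep ρ U hU hcov hj t ht).transport γ α β
      = repVal ρ (((t α y).trans (.mk γ)).trans (t β z).symm) := by
  -- The values of γ at 0 and 1 are its ends only up to a propositional equality.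
  have cast : ∀ y' z' (h : y' = y) (h' : z' = z),
      repVal ρ (((t α y').trans (.mk (γ.cast h h'))).trans (t β z').symm)
        = repVal ρ (((t α y).trans (.mk γ)).trans (t β z).symm) := by
    rintro _ _ rfl rfl; rfl
  rw [← cast _ _ γ.source γ.target, ← Path.subpath_zero_one,
    transport_eq (s := fun α r => repVal ρ
      (((t α (γ r)).trans (.mk (γ.subpath r 1))).trans (t β (γ 1)).symm))]
  · rw [Path.subpath_self, Path.Homotopic.Quotient.mk_refl, Path.Homotopic.Quotient.trans_refl,
      Path.Homotopic.Quotient.trans_symm, repVal_refl, inv_one, mul_one]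
  · exact hy
  · exact hz
  · refine ⟨fun δ r hr => ContinuousAt.continuousWithinAt ?_, fun δ ε r _ _ => ?_⟩
    · have hr' : γ ⁻¹' U δ ∈ nhds r := ((hU δ).preimage γ.continuous).mem_nhds hr
      -- For `r'` near `r` the piece of γ between them stays in `U δ`, on either side of `r`, so the
      -- frame condition applies to it.
      have h1 : ∀ᶠ r' in nhds r, Set.uIcc r r' ⊆ γ ⁻¹' U δ :=
        ((tendsto_const_nhds (x := r)).uIcc Filter.tendsto_id).eventually
          (Filter.eventually_smallSets.mpr ⟨_, hr', fun _ h => h⟩)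
      refine (continuousAt_const (y := repVal ρ
        (((t δ (γ r)).trans (.mk (γ.subpath r 1))).trans (t β (γ 1)).symm))).congr ?_
      filter_upwards [h1] with r' h2
      rw [ht δ (γ r) (γ r') (γ.subpath r r') fun q => ?_, Path.Homotopic.Quotient.trans_assoc (t δ (γ r))
        (.mk (γ.subpath r r')), ← Path.Homotopic.Quotient.mk_trans,
        Path.Homotopic.Quotient.eq.mpr ⟨Path.Homotopy.subpathTransSubpath γ r r' 1⟩]
      have h3 : γ.subpath r r' q ∈ Set.range (γ.subpath r r') := ⟨q, rfl⟩
      rw [Path.range_subpath] at h3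
      obtain ⟨q', hq', e⟩ := h3
      exact e ▸ h2 hq'
    · exact (repVal_div_mul ρ _ _ _ _).symm

end OfRep

/-- Every representation of the fundamental group is the monodromy of a local system. -/
theorem exists_monodromy_eq [TopologicalSpace G] [DiscreteTopology G] [PathConnectedSpace Y] (x : Y) (U : ι → Set Y)
    (hU : ∀ α, IsOpen (U α)) (hcov : ∀ y, ∃ α, y ∈ U α)
    (hj : ∀ α β, ∀ y ∈ U α ∩ U β, ∀ y' ∈ U α ∩ U β, JoinedIn (U α ∩ U β) y y')
    (hs : ∀ α (y y' : Y) (γ γ' : Path y y'), (∀ r, γ r ∈ U α) → (∀ r, γ' r ∈ U α) →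
      γ.Homotopic γ')
    (ρ : (FundamentalGroup Y x)ᵐᵒᵖ →* G) :
    ∃ L : LocalSystem Y ι G, L.U = U ∧ ∀ α (hx : x ∈ L.U α), L.monodromy hx = ρ := by
  have hV : ∀ α, ∀ y ∈ U α, ∀ y' ∈ U α, JoinedIn (U α) y y' := fun α y hy y' hy' =>
    (hj α α y ⟨hy, hy⟩ y' ⟨hy', hy'⟩).mono Set.inter_subset_left
  choose t ht ht' using fun α => exists_isFrame x (hV α) (hs α)
  refine ⟨ofRep ρ U hU hcov hj t ht, rfl, fun α hx => ?_⟩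
  ext γ
  obtain ⟨γ⟩ := γ
  induction γ using Quotient.inductionOn with | _ γ => ?_
  change (ofRep ρ U hU hcov hj t ht).transport γ α α = _
  rw [transport_ofRep ρ U hU hcov hj t ht γ hx hx, ht' α hx,
    Path.Homotopic.Quotient.refl_trans]
  change repVal ρ (Path.Homotopic.Quotient.trans _ (Path.Homotopic.Quotient.symm
    (.mk (Path.refl x)))) = _
  rw [← Path.Homotopic.Quotient.mk_symm, Path.refl_symm, Path.Homotopic.Quotient.mk_refl,
    Path.Homotopic.Quotient.trans_refl]
  rfl

end LocalSystem
end

noncomputable section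

/-! ## Vanishing of the second cohomology of a punctured combinatorial surface -/

/-- The incidence properties of the triangles (allowed to be degenerate) of a connected closed
combinatorial surface, some vertices of which are regarded as punctures. -/
structure PuncturedSurface (ι κ : Type*) where
  T : ι ⊕ κ → ι ⊕ κ → ι ⊕ κ → Prop
  swap : ∀ {a b c}, T a b c → T b a c
  rot : ∀ {a b c}, T a b c → T b c a
  edge : ∀ {a b c}, T a b c → T a a b
  edge_le : ∀ {a b c d v}, a ≠ b → T a b c → T a b d → T a b v → c ≠ a → c ≠ b → d ≠ a → d ≠ b →
    v ≠ a → v ≠ b → c ≠ d → v = c ∨ v = d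
  link : ∀ {a b b'}, b ≠ a → b' ≠ a → T a a b → T a a b' →
    Relation.ReflTransGen (fun c c' => c' ≠ a ∧ T a c c') b b'
  conn : ∀ a b, Relation.ReflTransGen (fun c c' => T c c c') a b

namespace PuncturedSurface

variable {ι κ A : Type*} [CommGroup A] (K : PuncturedSurface ι κ)

/-- A nondegenerate triangle avoiding the punctures. -/
def Tri (α β γ : ι) : Prop :=
  α ≠ β ∧ β ≠ γ ∧ γ ≠ α ∧ K.T (.inl α) (.inl β) (.inl γ)

/-- Alternating 1-cochains. -/
def Skew (ψ : ι → ι → A) : Prop := (∀ α, ψ α α = 1) ∧ ∀ α β, ψ β α = (ψ α β)⁻¹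

theorem Skew.mul {ψ φ : ι → ι → A} (h : Skew ψ) (h' : Skew φ) :
    Skew fun α β => ψ α β * φ α β :=
  ⟨fun α => by simp only [h.1, h'.1, one_mul], fun α β => by simp only [h.2 α, h'.2 α, mul_inv]⟩

/-- The product of a 1-cochain along the boundary of a triangle. -/
def bd (ψ : ι → ι → A) (α β γ : ι) : A := ψ α β * ψ β γ * ψ γ α

theorem bd_mul (ψ φ : ι → ι → A) (α β γ : ι) :
    bd (fun α β => ψ α β * φ α β) α β γ = bd ψ α β γ * bd φ α β γ := by
  unfold bd
  rw [mul_mul_mul_comm (ψ α β), mul_mul_mul_comm (ψ α β * _)]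

theorem bd_rot (ψ : ι → ι → A) (α β γ : ι) : bd ψ β γ α = bd ψ α β γ := by
  unfold bd; rw [mul_comm, mul_assoc]

theorem bd_swap {ψ : ι → ι → A} (h : Skew ψ) (α β γ : ι) : bd ψ β α γ = (bd ψ α β γ)⁻¹ := by
  unfold bd; rw [h.2 α β, h.2 γ α, h.2 β γ, mul_inv, mul_inv, mul_right_comm]

/-- An alternating function on triangles is determined, up to inversion, by the set of vertices. -/
theorem eq_or_inv_of_set_eq {f : ι → ι → ι → A} {P : ι → ι → ι → Prop}
    (hr : ∀ α β γ, P α β γ → P β γ α)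
    (fr : ∀ α β γ, P α β γ → f β γ α = f α β γ) (fs : ∀ α β γ, P α β γ → f β α γ = (f α β γ)⁻¹)
    {α β γ α' β' γ' : ι} (h : P α β γ) (h1 : α ≠ β) (h2 : β ≠ γ) (h3 : γ ≠ α)
    (h1' : α' ≠ β') (h2' : β' ≠ γ') (h3' : γ' ≠ α')
    (he : ({α', β', γ'} : Set ι) = {α, β, γ}) :
    f α' β' γ' = f α β γ ∨ f α' β' γ' = (f α β γ)⁻¹ := by
  have ha : α' ∈ ({α, β, γ} : Set ι) := he ▸ by simp
  have hb : β' ∈ ({α, β, γ} : Set ι) := he ▸ by simp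
  have hc : γ' ∈ ({α, β, γ} : Set ι) := he ▸ by simp
  have e1 := fr α β γ h
  have e2 := fr β γ α (hr _ _ _ h)
  have e3 := fs α β γ h
  have e4 := fs β γ α (hr _ _ _ h)
  have e5 := fs γ α β (hr _ _ _ (hr _ _ _ h))
  simp only [Set.mem_insert_iff, Set.mem_singleton_iff] at ha hb hc
  rcases ha with rfl | rfl | rfl <;> rcases hb with rfl | rfl | rfl <;>
    rcases hc with rfl | rfl | rfl <;> first
    | exact absurd rfl h1'
    | exact absurd rfl h2'
    | exact absurd rfl h3'
    | (left; rfl)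
    | (left; assumption)
    | (left; rw [e2, e1])
    | (right; assumption)
    | (right; rw [e4, e1])
    | (right; rw [e5, e2, e1])

theorem bd_eq_one_of_set_eq {ψ : ι → ι → A} (h : Skew ψ) {α β γ α' β' γ' : ι}
    (h1 : α ≠ β) (h2 : β ≠ γ) (h3 : γ ≠ α) (h1' : α' ≠ β') (h2' : β' ≠ γ') (h3' : γ' ≠ α')
    (he : ({α', β', γ'} : Set ι) = {α, β, γ}) (hb : bd ψ α β γ = 1) : bd ψ α' β' γ' = 1 := by
  rcases eq_or_inv_of_set_eq (f := bd ψ) (P := fun _ _ _ => True) (by simp)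
    (fun _ _ _ _ => bd_rot _ _ _ _) (fun _ _ _ _ => bd_swap h _ _ _) trivial h1 h2 h3 h1' h2' h3'
    he with e | e <;> rw [e, hb]
  exact inv_one

/-- The triangle contains a puncture, or every 2-cochain supported on it is a coboundary. -/
def Fill (A : Type*) [CommGroup A] (a b c : ι ⊕ κ) : Prop :=
  ∀ α β γ, a = .inl α → b = .inl β → c = .inl γ → ∀ x : A, ∃ ψ : ι → ι → A, Skew ψ ∧
    bd ψ α β γ = x ∧ ∀ α' β' γ', K.Tri α' β' γ' → ({α', β', γ'} : Set ι) ≠ {α, β, γ} →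
      bd ψ α' β' γ' = 1

variable {K}

theorem Fill.rot {a b c : ι ⊕ κ} (h : K.Fill A a b c) : K.Fill A b c a := by
  intro β γ α hb hc ha x
  obtain ⟨ψ, h1, h2, h3⟩ := h α β γ ha hb hc x
  refine ⟨ψ, h1, by rw [bd_rot, h2], fun α' β' γ' ht hne => h3 _ _ _ ht fun e => hne (e.trans ?_)⟩
  rw [Set.insert_comm, Set.pair_comm α γ]

theorem Fill.swap {a b c : ι ⊕ κ} (h : K.Fill A a b c) : K.Fill A b a c := by
  intro β α γ hb ha hc x
  obtain ⟨ψ, h1, h2, h3⟩ := h α β γ ha hb hc x⁻¹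
  refine ⟨ψ, h1, by rw [bd_swap h1, h2, inv_inv],
    fun α' β' γ' ht hne => h3 _ _ _ ht fun e => hne (e.trans (Set.insert_comm _ _ _))⟩

open Classical in
/-- The 1-cochain supported on one edge. -/
def single (β γ : ι) (x : A) (α α' : ι) : A :=
  if α = β ∧ α' = γ then x else if α = γ ∧ α' = β then x⁻¹ else 1

theorem skew_single {β γ : ι} (h : β ≠ γ) (x : A) : Skew (single β γ x) := by
  refine ⟨fun α => ?_, fun α α' => ?_⟩
  · unfold single
    rw [if_neg fun e => h (e.1.symm.trans e.2), if_neg fun e => h (e.2.symm.trans e.1)]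
  · unfold single
    by_cases h1 : α = β ∧ α' = γ
    · obtain ⟨rfl, rfl⟩ := h1
      simp [h.symm]
    · by_cases h2 : α = γ ∧ α' = β
      · obtain ⟨rfl, rfl⟩ := h2
        simp [h.symm]
      · rw [if_neg h1, if_neg h2, if_neg fun e => h2 ⟨e.2, e.1⟩, if_neg fun e => h1 ⟨e.2, e.1⟩,
          inv_one]

theorem bd_single {δ β γ : ι} (h1 : δ ≠ β) (h2 : δ ≠ γ) (x : A) :
    bd (single β γ x) δ β γ = x := by
  simp [bd, single, h1, h2]

theorem bd_single_of_not_mem {β γ α' β' γ' : ι} (x : A)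
    (h : ¬(β ∈ ({α', β', γ'} : Set ι) ∧ γ ∈ ({α', β', γ'} : Set ι))) :
    bd (single β γ x) α' β' γ' = 1 := by
  have key : ∀ μ ν, μ ∈ ({α', β', γ'} : Set ι) → ν ∈ ({α', β', γ'} : Set ι) →
      single β γ x μ ν = 1 := by
    intro μ ν hμ hν
    unfold single
    rw [if_neg, if_neg]
    · rintro ⟨rfl, rfl⟩; exact h ⟨hν, hμ⟩
    · rintro ⟨rfl, rfl⟩; exact h ⟨hμ, hν⟩
  rw [bd, key _ _ (by simp) (by simp), key _ _ (by simp) (by simp), key _ _ (by simp) (by simp)]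
  simp

/-- If a nondegenerate triangle has the vertices `β ≠ γ`, its third vertex completes them. -/
theorem exists_third {P : ι → ι → ι → Prop} (hr : ∀ α β γ, P α β γ → P β γ α)
    (hs : ∀ α β γ, P α β γ → P β α γ) {β γ α' β' γ' : ι} (hP : P α' β' γ') (h1 : α' ≠ β')
    (h2 : β' ≠ γ') (h3 : γ' ≠ α') (hne : β ≠ γ) (hβ : β ∈ ({α', β', γ'} : Set ι))
    (hγ : γ ∈ ({α', β', γ'} : Set ι)) :
    ∃ δ, δ ≠ β ∧ δ ≠ γ ∧ P β γ δ ∧ ({α', β', γ'} : Set ι) = {δ, β, γ} := by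
  simp only [Set.mem_insert_iff, Set.mem_singleton_iff] at hβ hγ
  have q1 := hr _ _ _ hP
  have q2 := hr _ _ _ q1
  rcases hβ with rfl | rfl | rfl <;> rcases hγ with rfl | rfl | rfl <;>
    first | exact absurd rfl hne | skip
  · exact ⟨γ', h3, h2.symm, hP, by ext; simp; tauto⟩
  · exact ⟨β', h1.symm, h2, hs _ _ _ q2, by ext; simp; tauto⟩
  · exact ⟨γ', h2.symm, h3, hs _ _ _ hP, by ext; simp; tauto⟩
  · exact ⟨α', h1, h3.symm, q1, by ext; simp⟩
  · exact ⟨β', h2, h1.symm, q2, by ext; simp; tauto⟩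
  · exact ⟨α', h3.symm, h1, hs _ _ _ q1, by ext; simp; tauto⟩

/-- The cochain `single β γ x` is felt only by the two triangles on the edge βγ. Its value on the
new triangle is the desired one; its value on the old triangle is cancelled by a cochain that fills
the old triangle, or is irrelevant if the old triangle contains a puncture. -/
theorem Fill.step {a b c d : ι ⊕ κ} (h : K.Fill A a b c) (hbc : b ≠ c) (hab : a ≠ b) (hac : a ≠ c)
    (hdb : d ≠ b) (hdc : d ≠ c) (had : a ≠ d) (ha : K.T b c a) (hd : K.T b c d) :
    K.Fill A d b c := by
  rintro δ β γ rfl rfl rfl x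
  have hβγ : β ≠ γ := fun e => hbc (congrArg _ e)
  have hδβ : δ ≠ β := fun e => hdb (congrArg _ e)
  have hδγ : δ ≠ γ := fun e => hdc (congrArg _ e)
  -- the only triangles on the edge `β γ` are `a` and `δ`
  have third : ∀ α' β' γ', K.Tri α' β' γ' → β ∈ ({α', β', γ'} : Set ι) →
      γ ∈ ({α', β', γ'} : Set ι) → ∃ ε, (.inl ε = a ∨ ε = δ) ∧
        ({α', β', γ'} : Set ι) = {ε, β, γ} := by
    rintro α' β' γ' ⟨h1, h2, h3, ht⟩ hβ hγ
    obtain ⟨ε, e1, e2, e3, e4⟩ := exists_third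
      (P := fun α β γ => K.T (.inl α) (.inl β) (.inl γ)) (fun _ _ _ => K.rot)
      (fun _ _ _ => K.swap) ht h1 h2 h3 hβγ hβ hγ
    refine ⟨ε, ?_, e4⟩
    rcases K.edge_le hbc ha hd e3 hab hac hdb hdc (by simpa using e1) (by simpa using e2) had
      with e | e
    · exact Or.inl e
    · exact Or.inr (Sum.inl_injective e)
  rcases a with α | k
  · have hαβ : α ≠ β := fun e => hab (congrArg _ e)
    have hαγ : α ≠ γ := fun e => hac (congrArg _ e)
    have hαδ : α ≠ δ := fun e => had (congrArg _ e)
    have hset : ({δ, β, γ} : Set ι) ≠ {α, β, γ} := fun e => by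
      have : α ∈ ({δ, β, γ} : Set ι) := e ▸ by simp
      simp [hαβ, hαγ, hαδ] at this
    -- The value x⁻¹ compensates the x which the edge cochain puts on the old triangle.
    obtain ⟨ψ, h1, h2, h3⟩ := h α β γ rfl rfl rfl x⁻¹
    have hsk := h1.mul (skew_single hβγ x)
    refine ⟨_, hsk, ?_, fun α' β' γ' ht hne => ?_⟩
    · rw [bd_mul, bd_single hδβ hδγ, h3 δ β γ ⟨hδβ, hβγ, hδγ.symm, K.rot (K.rot hd)⟩ hset, one_mul]
    · by_cases hm : β ∈ ({α', β', γ'} : Set ι) ∧ γ ∈ ({α', β', γ'} : Set ι)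
      · obtain ⟨ε, e1 | rfl, e2⟩ := third _ _ _ ht hm.1 hm.2
        · obtain rfl := Sum.inl_injective e1
          refine bd_eq_one_of_set_eq hsk hαβ hβγ hαγ.symm ht.1 ht.2.1 ht.2.2.1 e2 ?_
          rw [bd_mul, h2, bd_single hαβ hαγ, inv_mul_cancel]
        · exact absurd e2 hne
      · rw [bd_mul, bd_single_of_not_mem x hm, mul_one]
        refine h3 _ _ _ ht fun e => hm ?_
        rw [e]; simp
  · refine ⟨_, skew_single hβγ x, bd_single hδβ hδγ x, fun α' β' γ' ht hne => ?_⟩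
    refine bd_single_of_not_mem x fun hm => ?_
    obtain ⟨ε, e1 | rfl, e2⟩ := third _ _ _ ht hm.1 hm.2
    · cases e1
    · exact hne e2

/-- Fillability spreads from a puncture along the edges of the surface: if all triangles at p are
fillable and q is adjacent to p, walk around the link of q, starting at p, and cross one edge at q
at each step. -/
theorem fill (k : κ) {a b c : ι ⊕ κ} (hab : a ≠ b) (hbc : b ≠ c) (hca : c ≠ a) (ht : K.T a b c) :
    K.Fill A a b c := by
  suffices H : ∀ a b c, a ≠ b → b ≠ c → c ≠ a → K.T a b c → K.Fill A a b c from
    H a b c hab hbc hca ht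
  clear hab hbc hca ht a b c
  intro a
  induction K.conn (.inr k) a with
  -- A triangle having the puncture as a vertex satisfies `Fill` vacuously.
  | refl => intro b c _ _ _ _ α _ _ h; cases h
  | @tail p q _ hpq ih =>
    by_cases hne : p = q
    · exact hne ▸ ih
    intro b c hqb hbc hcq ht
    have hqp : K.T q q p := K.edge (K.rot (K.rot hpq))
    -- The invariant of the walk around q: every nondegenerate triangle on the edge from q to the
    -- current vertex is fillable.
    have key : b ≠ q ∧ ∀ v, v ≠ q → v ≠ b → K.T q b v → K.Fill A q b v := by
      have walk := K.link hne hqb.symm hqp (K.edge ht)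
      clear hbc hcq hqb ht
      induction walk with
      | refl =>
        exact ⟨hne, fun v hvq hvp hT => (ih q v hne hvq.symm hvp (K.swap hT)).swap⟩
      | @tail v w _ hvw ih' =>
        obtain ⟨hwq, hT⟩ := hvw
        obtain ⟨hvq, hv⟩ := ih'
        by_cases hvw : v = w
        · exact hvw ▸ ⟨hvq, hv⟩
        have hf := hv w hwq (Ne.symm hvw) hT
        refine ⟨hwq, fun u huq huw hT' => ?_⟩
        -- The edge from q to w has only two third vertices: either u is the vertex v just left, or
        -- the filling is pushed across this edge.
        by_cases huv : u = v
        · subst huv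
          exact hf.swap.rot
        · exact (Fill.step (hf.swap) hwq.symm hvq hvw huq huw (Ne.symm huv) 
          (K.rot (K.rot (K.swap (K.rot hT)))) hT').rot
    exact key.2 c hcq hbc.symm ht

/-- Every alternating 2-cochain is a coboundary. -/
theorem exists_bd_eq [Finite ι] (k : κ) {f : ι → ι → ι → A}
    (fr : ∀ α β γ, K.Tri α β γ → f β γ α = f α β γ)
    (fs : ∀ α β γ, K.Tri α β γ → f β α γ = (f α β γ)⁻¹) :
    ∃ ψ : ι → ι → A, Skew ψ ∧ ∀ α β γ, K.Tri α β γ → bd ψ α β γ = f α β γ := by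
  classical
  cases nonempty_fintype ι
  -- The ordered triples are corrected one at a time, without disturbing the finitely many already
  -- treated.
  suffices H : ∀ s : Finset (ι × ι × ι), ∃ ψ : ι → ι → A, Skew ψ ∧
      ∀ t ∈ s, K.Tri t.1 t.2.1 t.2.2 → bd ψ t.1 t.2.1 t.2.2 = f t.1 t.2.1 t.2.2 by
    obtain ⟨ψ, h1, h2⟩ := H Finset.univ
    exact ⟨ψ, h1, fun α β γ h => h2 (α, β, γ) (Finset.mem_univ _) h⟩
  intro s
  induction s using Finset.induction_on with
  | empty => exact ⟨fun _ _ => 1, ⟨fun _ => rfl, fun _ _ => inv_one.symm⟩, by simp⟩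
  | insert t s _ ih =>
    obtain ⟨ψ, h1, h2⟩ := ih
    obtain ⟨α, β, γ⟩ := t
    by_cases ht : K.Tri α β γ ∧ bd ψ α β γ ≠ f α β γ
    swap
    · refine ⟨ψ, h1, fun t hts hT => ?_⟩
      rcases Finset.mem_insert.mp hts with rfl | hts
      · by_contra hne
        exact ht ⟨hT, hne⟩
      · exact h2 t hts hT
    obtain ⟨⟨n1, n2, n3, hT⟩, hne⟩ := ht
    -- φ carries exactly the defect of ψ on this triangle and vanishes on triangles with other
    -- vertices.
    obtain ⟨φ, h3, h4, h5⟩ := fill (K := K) (A := A) k (a := .inl α) (b := .inl β) (c := .inl γ)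
      (by simpa using n1) (by simpa using n2) (by simpa using n3) hT α β γ rfl rfl rfl
      ((bd ψ α β γ)⁻¹ * f α β γ)
    refine ⟨_, h1.mul h3, fun t hts hT' => ?_⟩
    rcases Finset.mem_insert.mp hts with rfl | hts
    · rw [bd_mul, h4, mul_inv_cancel_left]
    · rw [bd_mul, h5 _ _ _ hT', mul_one, h2 t hts hT']
      -- The defect is alternating; a triple already treated with the same vertices would therefore
      -- force the defect of the present one to be trivial.
      intro he
      refine hne ?_
      have e := eq_or_inv_of_set_eq (f := fun α β γ => (bd ψ α β γ)⁻¹ * f α β γ) (P := K.Tri)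
        (fun _ _ _ h => ⟨h.2.1, h.2.2.1, h.1, K.rot h.2.2.2⟩)
        (fun _ _ _ h => by rw [bd_rot, fr _ _ _ h])
        (fun _ _ _ h => by rw [bd_swap h1, fs _ _ _ h, mul_inv]) hT' hT'.1 hT'.2.1 hT'.2.2.1
        n1 n2 n3 he.symm
      rw [h2 t hts hT', inv_mul_cancel, inv_one, or_self, inv_mul_eq_one] at e
      exact e

end PuncturedSurface
end

noncomputable section

namespace GoodCover

variable {S : Type u} [TopologicalSpace S] [ChartedSpace ℂ S] {n : ℕ}
  {pt : Fin n → S} {ι : Type v}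

/-! ## The nerve of the cover -/

/-- The members of the cover. -/
abbrev piece (C : GoodCover pt ι) (a : ι ⊕ Fin n) : Set S := coverPiece C.B C.chart a

theorem isOpen_piece (C : GoodCover pt ι) (a : ι ⊕ Fin n) : IsOpen (C.piece a) := by
  rcases a with α | j
  · exact C.isOpen_B α
  · exact (C.chart j).open_source

theorem exists_mem_piece (C : GoodCover pt ι) (x : S) : ∃ a, x ∈ C.piece a := by
  by_cases h : x ∈ Set.range pt
  · obtain ⟨j, rfl⟩ := h
    exact ⟨.inr j, C.pt_mem j⟩
  · have : x ∈ ⋃ α, C.B α := by rw [C.iUnion_B]; exact h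
    obtain ⟨α, hα⟩ := Set.mem_iUnion.mp this
    exact ⟨.inl α, hα⟩

theorem piece_nonempty (C : GoodCover pt ι) (a : ι ⊕ Fin n) : (C.piece a).Nonempty := by
  have := C.contractible_one a
  exact Set.nonempty_coe_sort.mp inferInstance

/-- The union of the members reachable from `a` is open, and so is its complement, being the union
of the unreachable ones; connectedness of the surface excludes a proper such union. -/
theorem nerve_connected [PreconnectedSpace S] (C : GoodCover pt ι) (a b : ι ⊕ Fin n) :
    Relation.ReflTransGen (fun c c' => (C.piece c ∩ C.piece c').Nonempty) a b := by
  set R := fun c c' => (C.piece c ∩ C.piece c').Nonempty with hR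
  let W : Set S := ⋃ c ∈ {c | Relation.ReflTransGen R a c}, C.piece c
  have hW : IsOpen W := isOpen_biUnion fun c _ => C.isOpen_piece c
  have hW' : IsOpen Wᶜ := by
    have : Wᶜ = ⋃ c ∈ {c | ¬Relation.ReflTransGen R a c}, C.piece c := by
      ext x
      simp only [W, Set.mem_compl_iff, Set.mem_iUnion, Set.mem_ofPred_eq, exists_prop, not_exists,
        not_and]
      refine ⟨fun h => ?_, ?_⟩
      · obtain ⟨c, hc⟩ := C.exists_mem_piece x
        exact ⟨c, fun h' => h c h' hc, hc⟩
      · rintro ⟨c, h1, h2⟩ c' h3 h4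
        exact h1 (h3.tail ⟨x, h4, h2⟩)
    rw [this]
    exact isOpen_biUnion fun c _ => C.isOpen_piece c
  obtain ⟨x, hx⟩ := C.piece_nonempty a
  have huniv : W = Set.univ := IsClopen.eq_univ ⟨isOpen_compl_iff.mp hW', hW⟩
    ⟨x, Set.mem_biUnion (show Relation.ReflTransGen R a a from .refl) hx⟩
  obtain ⟨y, hy⟩ := C.piece_nonempty b
  have : y ∈ W := huniv ▸ Set.mem_univ y
  obtain ⟨c, hc, hyc⟩ := Set.mem_iUnion₂.mp this
  exact Relation.ReflTransGen.tail hc ⟨y, hyc, hy⟩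

/-- The nerve of a good cover as a punctured surface. -/
def nerve [PreconnectedSpace S] (C : GoodCover pt ι) : PuncturedSurface ι (Fin n) where
  T a b c := (C.piece a ∩ C.piece b ∩ C.piece c).Nonempty
  swap := fun ⟨x, hx⟩ => ⟨x, ⟨hx.1.2, hx.1.1⟩, hx.2⟩
  rot := fun ⟨x, hx⟩ => ⟨x, ⟨hx.1.2, hx.2⟩, hx.1.1⟩
  edge := fun ⟨x, hx⟩ => ⟨x, ⟨hx.1.1, hx.1.1⟩, hx.1.2⟩
  edge_le := by
    intro a b c d v hab hc hd hv hca hcb hda hdb hva hvb hcd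
    have h2 := C.edge_two a b hab (hc.mono Set.inter_subset_left)
    obtain ⟨x, y, -, hxy⟩ := Set.ncard_eq_two.mp h2
    have hc' : c ∈ ({x, y} : Set _) := hxy ▸ ⟨hca, hcb, hc⟩
    have hd' : d ∈ ({x, y} : Set _) := hxy ▸ ⟨hda, hdb, hd⟩
    have hv' : v ∈ ({x, y} : Set _) := hxy ▸ ⟨hva, hvb, hv⟩
    simp only [Set.mem_insert_iff, Set.mem_singleton_iff] at hc' hd' hv'
    rcases hc' with rfl | rfl <;> rcases hd' with rfl | rfl <;> tauto
  link := by
    rintro a b b' hb hb' ⟨x, hx⟩ ⟨x', hx'⟩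
    exact C.link_connected a b b' hb hb' ⟨x, hx.1.1, hx.2⟩ ⟨x', hx'.1.1, hx'.2⟩
  conn a b := by
    have h := C.nerve_connected a b
    induction h with
    | refl => exact .refl
    | tail _ h ih =>
      obtain ⟨x, hx⟩ := h
      exact ih.tail ⟨x, ⟨hx.1, hx.1⟩, hx.2⟩

/-! ## The punctured surface -/

/-- The member `B α` as a subset of the punctured surface. -/
def U (C : GoodCover pt ι) (α : ι) : Set (Punctured pt) := Subtype.val ⁻¹' C.B α

theorem isOpen_U (C : GoodCover pt ι) (α : ι) : IsOpen (C.U α) :=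
  (C.isOpen_B α).preimage continuous_subtype_val

theorem exists_mem_U (C : GoodCover pt ι) (y : Punctured pt) : ∃ α, y ∈ C.U α := by
  have : (y : S) ∈ ⋃ α, C.B α := by rw [C.iUnion_B]; exact y.2
  obtain ⟨α, hα⟩ := Set.mem_iUnion.mp this
  exact ⟨α, hα⟩

theorem B_subset (C : GoodCover pt ι) {α : ι} {x : S} (hx : x ∈ C.B α) : x ∉ Set.range pt := by
  have : x ∈ ⋃ α, C.B α := Set.mem_iUnion.mpr ⟨α, hx⟩
  rwa [C.iUnion_B] at this

/-- The inclusion of a subset of `B α` into the punctured surface. -/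
def inclB (C : GoodCover pt ι) {α : ι} {V : Set S} (hV : V ⊆ C.B α) : C(V, Punctured pt) :=
  ⟨fun x => ⟨x, C.B_subset (hV x.2)⟩, by fun_prop⟩

theorem joinedIn_U_inter (C : GoodCover pt ι) (α β : ι) (y : Punctured pt)
    (hy : y ∈ C.U α ∩ C.U β) (y' : Punctured pt) (hy' : y' ∈ C.U α ∩ C.U β) :
    JoinedIn (C.U α ∩ C.U β) y y' := by
  have := C.contractible_two (.inl α) (.inl β) ⟨y, hy⟩
  obtain ⟨γ⟩ := (inferInstance : PathConnectedSpace
    ↥(coverPiece C.B C.chart (.inl α) ∩ coverPiece C.B C.chart (.inl β))).joined ⟨y, hy⟩ ⟨y', hy'⟩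
  refine ⟨(γ.map (C.inclB (α := α) Set.inter_subset_left).continuous).cast (Subtype.ext rfl)
    (Subtype.ext rfl), fun r => ?_⟩
  exact (γ r).2

theorem joinedIn_U (C : GoodCover pt ι) (α : ι) (y : Punctured pt)
    (hy : y ∈ C.U α) (y' : Punctured pt) (hy' : y' ∈ C.U α) : JoinedIn (C.U α) y y' :=
  (C.joinedIn_U_inter α α y ⟨hy, hy⟩ y' ⟨hy', hy'⟩).mono Set.inter_subset_left

/-- Both paths lift to the contractible member `B α`, where they are homotopic; the homotopy is then
pushed to the punctured surface. -/
theorem homotopic_of_mem_U (C : GoodCover pt ι) (α : ι) (y y' : Punctured pt) (γ γ' : Path y y')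
    (h : ∀ r, γ r ∈ C.U α) (h' : ∀ r, γ' r ∈ C.U α) : γ.Homotopic γ' := by
  have := C.contractible_one (.inl α)
  have hy : y ∈ C.U α := γ.source ▸ h 0
  have hy' : y' ∈ C.U α := γ.target ▸ h 1
  let lift : ∀ γ : Path y y', (∀ r, γ r ∈ C.U α) →
      Path (⟨y, hy⟩ : coverPiece C.B C.chart (.inl α)) ⟨y', hy'⟩ := fun γ h =>
    { toFun := fun r => ⟨γ r, h r⟩
      continuous_toFun := by fun_prop
      source' := Subtype.ext (congrArg (Subtype.val : Punctured pt → S) γ.source)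
      target' := Subtype.ext (congrArg (Subtype.val : Punctured pt → S) γ.target) }
  exact (SimplyConnectedSpace.paths_homotopic (lift γ h) (lift γ' h')).map
    (C.inclB (α := α) (V := coverPiece C.B C.chart (.inl α)) subset_rfl)

/-! ## The left half-plane as the universal cover of the punctured disc -/

/-- The left half-plane. -/
abbrev HalfPlane : Type := {u : ℂ // u.re < 0}

theorem convex_halfPlane : Convex ℝ {u : ℂ | u.re < 0} := convex_halfSpace_re_lt 0

instance : ContractibleSpace HalfPlane :=
  convex_halfPlane.contractibleSpace ⟨-1, by simp⟩

instance : LocallyPathConnectedSpace HalfPlane :=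
  (isOpen_lt Complex.continuous_re continuous_const).locallyPathConnectedSpace

/-- The exponential map from the left half-plane to the unit disc. -/
def expDisc (u : HalfPlane) : Disc :=
  ⟨Complex.exp u, by
    rw [mem_ball_zero_iff, Complex.norm_exp]
    exact Real.exp_lt_one_iff.mpr u.2⟩

theorem continuous_expDisc : Continuous expDisc := by
  unfold expDisc; fun_prop

theorem exists_expDisc (z : Disc) (hz : (z : ℂ) ≠ 0) : ∃ u, expDisc u = z := by
  refine ⟨⟨Complex.log z, ?_⟩, Subtype.ext (Complex.exp_log hz)⟩
  rw [Complex.log_re]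
  exact Real.log_neg (norm_pos_iff.mpr hz) (mem_ball_zero_iff.mp z.2)

theorem expDisc_ne_zero (u : HalfPlane) : (expDisc u : ℂ) ≠ 0 := Complex.exp_ne_zero _

theorem continuous_proj (C : GoodCover pt ι) (d : Fin n → ℕ+) (j : Fin n) :
    Continuous (C.proj d j) := by
  refine (C.chart j).continuousOn_symm.comp_continuous (by fun_prop) fun z => ?_
  rw [C.chart_target]
  exact pow_mem _ _

theorem proj_notMem_range (C : GoodCover pt ι) (d : Fin n → ℕ+) (j : Fin n) {z : Disc}
    (hz : (z : ℂ) ≠ 0) : C.proj d j z ∉ Set.range pt :=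
  C.symm_notMem_range j (pow_mem _ _) (pow_ne_zero _ hz)

/-- The projection of the half-plane to the punctured surface. -/
def projH (C : GoodCover pt ι) (d : Fin n → ℕ+) (j : Fin n) : C(HalfPlane, Punctured pt) :=
  ⟨fun u => ⟨C.proj d j (expDisc u), C.proj_notMem_range d j (expDisc_ne_zero u)⟩,
    ((C.continuous_proj d j).comp continuous_expDisc).subtype_mk _⟩

theorem exists_projH (C : GoodCover pt ι) (j : Fin n) {x : Punctured pt}
    (hx : (x : S) ∈ (C.chart j).source) : ∃ u, C.projH (fun _ => 1) j u = x := by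
  have h1 : C.chart j x ∈ Metric.ball (0 : ℂ) 1 := by
    rw [← C.chart_target j]; exact (C.chart j).map_source hx
  have h2 : (C.chart j).symm (C.chart j x) = x := (C.chart j).left_inv hx
  have h0 : C.chart j x ≠ 0 := fun h => x.2 ⟨j, by rw [← h2, h, C.symm_zero]⟩
  obtain ⟨u, hu⟩ := exists_expDisc ⟨_, h1⟩ h0
  refine ⟨u, Subtype.ext ?_⟩
  change C.proj (fun _ => 1) j (expDisc u) = x
  rw [hu, proj]
  simpa using h2

theorem joined_of_mem_piece (C : GoodCover pt ι) (a : ι ⊕ Fin n) {x y : Punctured pt}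
    (hx : (x : S) ∈ C.piece a) (hy : (y : S) ∈ C.piece a) : Joined x y := by
  rcases a with α | j
  · exact (C.joinedIn_U α x hx y hy).joined
  · obtain ⟨u, rfl⟩ := C.exists_projH j hx
    obtain ⟨v, rfl⟩ := C.exists_projH j hy
    exact (PathConnectedSpace.joined u v).map (C.projH (fun _ => 1) j).continuous

/-- Follow a chain in the nerve. Two distinct members that meet have a common point off the marked
points, because distinct discs are disjoint and each `B α` avoids the marked points; and each member
stays path connected after puncturing. -/
theorem pathConnectedSpace_punctured [PreconnectedSpace S] (C : GoodCover pt ι)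
    (x₀ : Punctured pt) : PathConnectedSpace (Punctured pt) := by
  obtain ⟨α, hα⟩ := C.exists_mem_U x₀
  have key : ∀ a : ι ⊕ Fin n, ∀ y : Punctured pt, (y : S) ∈ C.piece a → Joined x₀ y := by
    intro a
    induction C.nerve_connected (.inl α) a with
    | refl => exact fun y hy => C.joined_of_mem_piece (.inl α) hα hy
    | @tail b c _ hbc ih =>
      intro y hy
      by_cases hne : b = c
      · exact ih y (hne ▸ hy)
      obtain ⟨x, hxb, hxc⟩ := hbc
      have hx : x ∉ Set.range pt := by
        rcases b with β | j
        · exact C.B_subset hxb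
        · rcases c with γ | k
          · exact C.B_subset hxc
          · exact absurd hxc (Set.disjoint_left.mp
              (C.disjoint j k fun e => hne (congrArg _ e)) hxb)
      exact (ih ⟨x, hx⟩ hxb).trans (C.joined_of_mem_piece c (x := ⟨x, hx⟩) hxc hy)
  have hj : ∀ y, Joined x₀ y := fun y => by
    obtain ⟨β, hβ⟩ := C.exists_mem_U y
    exact key (.inl β) y hβ
  exact ⟨⟨x₀⟩, fun x y => (hj x).symm.trans (hj y)⟩

end GoodCover
end

/-! ### Trivialising the cocycle over the punctured surface -/

noncomputable section

open scoped IsMulCommutative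

/-- Dividing by a coboundary preserves the cocycle identity. The letters a, …, f stand for the
values of the 1-cochain on the six edges of a tetrahedron; the additive form is within reach of
`abel`. -/
theorem add_cocycle_sub_coboundary {M : Type*} [AddCommGroup M] {A B D E : M} (h : A + D = B + E)
    (a b c d e f : M) : A + -(a + b + -c) + (D + -(c + d + -e))
      = B + -(b + d + -f) + (E + -(a + f + -e)) := by
  rw [← sub_eq_zero] at h ⊢
  rw [← h]
  abel

theorem cocycle_div_coboundary {M : Type*} [CommGroup M] {A B D E : M} (h : A * D = B * E)
    (a b c d e f : M) : A * (a * b * c⁻¹)⁻¹ * (D * (c * d * e⁻¹)⁻¹)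
      = B * (b * d * f⁻¹)⁻¹ * (E * (a * f * e⁻¹)⁻¹) :=
  add_cocycle_sub_coboundary (M := Additive M) h a b c d e f

namespace TopGroupoid.BandedGerbe

variable {Q : TopGroupoid.{u', v'}} {G : Type w} [Group G] [TopologicalSpace G]

/-- Replaces arrows inside `tau`, where the composability proof depends on them and obstructs
rewriting. -/
theorem tau_congr (τ : BandedGerbe Q G) {q q' r r' : Q.Arr} (hq : q = q') (hr : r = r')
    (h : Q.tgt q = Q.src r) : τ.tau q r h = τ.tau q' r' (hq ▸ hr ▸ h) := by
  subst hq hr; rfl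

/-- The cocycle `τ · (δψ)⁻¹`. -/
def twist [DiscreteTopology G] (τ : BandedGerbe Q G) (ψ : Cochain1 Q G)
    (hψ : ∀ x, ψ.val (Q.one x) = 1) : BandedGerbe Q G where
  tau q r h := τ.tau q r h * (ψ.val q * ψ.val r * (ψ.val (Q.mul q r h))⁻¹)⁻¹
  continuous_tau := by
    have h1 := ψ.continuous_val
    have h2 := τ.continuous_tau
    have h3 := ψ.continuous_val.comp Q.continuous_mul
    have h4 : Continuous fun p : {p : Q.Arr × Q.Arr // Q.tgt p.1 = Q.src p.2} => ψ.val p.1.1 :=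
      h1.comp (by fun_prop)
    have h5 : Continuous fun p : {p : Q.Arr × Q.Arr // Q.tgt p.1 = Q.src p.2} => ψ.val p.1.2 :=
      h1.comp (by fun_prop)
    exact (continuous_of_discreteTopology (f := fun x : ((Subgroup.center G × Subgroup.center G) ×
      Subgroup.center G) × Subgroup.center G => x.1.1.1 * (x.1.1.2 * x.1.2 * x.2⁻¹)⁻¹)).comp
      (((h2.prodMk h4).prodMk h5).prodMk h3)
  one_left q := by rw [τ.one_left, hψ, Q.one_mul]; simp
  one_right q := by rw [τ.one_right, hψ, Q.mul_one]; simp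
  cocycle q r s h k := by
    have := τ.cocycle q r s h k
    rw [Q.mul_assoc q r s h k]
    exact cocycle_div_coboundary this _ _ _ _ _ _

theorem cohomologousVia_twist [DiscreteTopology G] (τ : BandedGerbe Q G) (ψ : Cochain1 Q G)
    (hψ : ∀ x, ψ.val (Q.one x) = 1) : τ.CohomologousVia (τ.twist ψ hψ) ψ := fun _ _ _ =>
  (inv_mul_cancel_right _ _).symm

end TopGroupoid.BandedGerbe

namespace GoodCover

open TopGroupoid (BandedGerbe Cochain1)

variable {S : Type u} [TopologicalSpace S] [ChartedSpace ℂ S] {n : ℕ}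
  {pt : Fin n → S} {ι : Type v} {d : Fin n → ℕ+} {G : Type w} [Group G] [TopologicalSpace G]
  [DiscreteTopology G]

theorem arrBB_mul (C : GoodCover pt ι) {α β γ : ι} {y : S} (hα : y ∈ C.B α) (hβ : y ∈ C.B β)
    (hγ : y ∈ C.B γ) : (C.groupoid d).mul (C.arrBB d α β y hα hβ) (C.arrBB d β γ y hβ hγ) rfl
      = C.arrBB d α γ y hα hγ :=
  Subtype.ext (Prod.ext rfl (Prod.ext rfl (one_mul _)))

/-- The root of unity labelling the rotation by `2 π k / N`. -/
def rootLabel (N : ℕ+) (k : ℕ) : ℂ := Complex.exp (2 * Real.pi * ((k / N : ℝ) : ℂ) * Complex.I)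

theorem rootLabel_add (N : ℕ+) (a b : ℕ) :
    rootLabel N (a + b) = rootLabel N a * rootLabel N b := by
  rw [rootLabel, rootLabel, rootLabel, ← Complex.exp_add]
  congr 1
  push_cast
  ring

theorem rootLabel_zero (N : ℕ+) : rootLabel N 0 = 1 := by simp [rootLabel]

theorem rootLabel_eq_pow (N : ℕ+) (k : ℕ) : rootLabel N k = rootLabel N 1 ^ k := by
  induction k with
  | zero => rw [rootLabel_zero, pow_zero]
  | succ k ih => rw [rootLabel_add, ih, pow_succ]

theorem isPrimitiveRoot_rootLabel (N : ℕ+) : IsPrimitiveRoot (rootLabel N 1) N := by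
  have := Complex.isPrimitiveRoot_exp N N.ne_zero
  convert this using 1
  rw [rootLabel]
  congr 1
  push_cast
  ring

theorem exists_eq_rootLabel {N : ℕ+} {ζ : ℂ} (h : ζ ^ (N : ℕ) = 1) : ∃ k, ζ = rootLabel N k := by
  obtain ⟨k, -, hk⟩ := (isPrimitiveRoot_rootLabel N).eq_pow_of_pow_eq_one h
  exact ⟨k, by rw [rootLabel_eq_pow, hk]⟩

/-- An arrow with an end over the punctured surface is determined by its ends, and a root of unity
labelling an arrow of a disc is a power of the standard one. These four families therefore suffice
in all case distinctions. -/
theorem arr_cases (C : GoodCover pt ι) {d : Fin n → ℕ+} (q : (C.groupoid d).Arr) :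
    (∃ α β y hα hβ, q = C.arrBB d α β y hα hβ) ∨ (∃ α j z h, q = C.arrBD d α j z h) ∨
      (∃ α j z h, q = (C.groupoid d).inv (C.arrBD d α j z h)) ∨
      ∃ j z k, q = C.arrRot d j z k := by
  obtain ⟨⟨⟨α, x, hx⟩ | ⟨j, z⟩, ⟨β, y, hy⟩ | ⟨k, w⟩, ζ⟩, hq⟩ := q
  · have e1 : x = y := hq.1
    have e2 : ζ = 1 := hq.2
    subst e1 e2
    exact Or.inl ⟨α, β, x, hx, hy, rfl⟩
  · have e1 : x = C.proj d k w := hq.1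
    have e2 : ζ = w := hq.2
    subst e1 e2
    exact Or.inr (Or.inl ⟨α, k, w, hx, rfl⟩)
  · have e1 : y = C.proj d j z := hq.1
    have e2 : ζ = (z : ℂ)⁻¹ := hq.2
    subst e1 e2
    exact Or.inr (Or.inr (Or.inl ⟨β, j, z, hy, rfl⟩))
  · have e1 : j = k := hq.1
    subst e1
    obtain ⟨k, e2⟩ : ∃ k, ζ = rootLabel (d j) k := exists_eq_rootLabel hq.2.1
    have e3 : w = turn z (k / d j) := Subtype.ext (hq.2.2.trans (congrArg (· * (z : ℂ)) e2))
    subst e3 e2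
    exact Or.inr (Or.inr (Or.inr ⟨j, z, k, rfl⟩))

theorem OverPunctured.exists_eq {C : GoodCover pt ι} {q : (C.groupoid d).Arr}
    (h : C.OverPunctured d q) : ∃ α β y hα hβ, q = C.arrBB d α β y hα hβ := by
  rcases C.arr_cases q with h' | ⟨α, j, z, hz, rfl⟩ | ⟨α, j, z, hz, rfl⟩ | ⟨j, z, k, rfl⟩
  · exact h'
  · exact Bool.noConfusion h.2
  · exact Bool.noConfusion h.1
  · exact Bool.noConfusion h.1

theorem arrBB_composable {C : GoodCover pt ι} {α β β' γ : ι} {y y' : S} {hα : y ∈ C.B α}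
    {hβ : y ∈ C.B β} {hβ' : y' ∈ C.B β'} {hγ : y' ∈ C.B γ}
    (h : (C.groupoid d).tgt (C.arrBB d α β y hα hβ) = (C.groupoid d).src (C.arrBB d β' γ y' hβ' hγ)) :
    β = β' ∧ y = y' := by
  obtain ⟨rfl, h2⟩ := Sigma.mk.inj (Sum.inl_injective h)
  exact ⟨rfl, congrArg Subtype.val (eq_of_heq h2)⟩

/-- The index of the member of the cover in which an object lies. -/
def cls (C : GoodCover pt ι) : C.Obj → ι ⊕ Fin n := Sum.map Sigma.fst Prod.fst

theorem isLocallyConstant_cls (C : GoodCover pt ι) : IsLocallyConstant C.cls := by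
  refine (IsLocallyConstant.iff_exists_open _).mpr ?_
  rintro (⟨α, x⟩ | ⟨j, z⟩)
  · refine ⟨Sum.inl '' (Set.range (Sigma.mk α)), isOpenMap_inl _ isOpen_range_sigmaMk,
      ⟨_, ⟨x, rfl⟩, rfl⟩, ?_⟩
    rintro _ ⟨_, ⟨y, rfl⟩, rfl⟩
    rfl
  · refine ⟨Sum.inr '' (Prod.fst ⁻¹' {j}), isOpenMap_inr _
      ((isOpen_discrete _).preimage continuous_fst), ⟨_, rfl, rfl⟩, ?_⟩
    rintro _ ⟨⟨k, w⟩, rfl, rfl⟩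
    rfl

/-- A function of the members of the cover in which the ends of an arrow lie is continuous. -/
theorem continuous_of_cls (C : GoodCover pt ι) {K : Type*} [TopologicalSpace K]
    (f : ι ⊕ Fin n → ι ⊕ Fin n → K) :
    Continuous fun q : (C.groupoid d).Arr => f (C.cls q.1.1) (C.cls q.1.2.1) := by
  have h1 : IsLocallyConstant fun q : (C.groupoid d).Arr => C.cls q.1.1 :=
    C.isLocallyConstant_cls.comp_continuous (C.groupoid d).continuous_src
  have h2 : IsLocallyConstant fun q : (C.groupoid d).Arr => C.cls q.1.2.1 :=
    C.isLocallyConstant_cls.comp_continuous (C.groupoid d).continuous_tgt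
  exact ((h1.prodMk h2).comp fun p => f p.1 p.2).continuous

theorem continuous_arrBB (C : GoodCover pt ι) (α β : ι) {V : Set S} (h1 : V ⊆ C.B α)
    (h2 : V ⊆ C.B β) : Continuous fun y : V => (C.arrBB d α β y (h1 y.2) (h2 y.2) :
      (C.groupoid d).Arr) := by
  refine Continuous.subtype_mk ?_ _
  refine Continuous.prodMk ?_ (Continuous.prodMk ?_ continuous_const)
  · exact continuous_inl.comp (continuous_sigmaMk.comp (by fun_prop))
  · exact continuous_inl.comp (continuous_sigmaMk.comp (by fun_prop))

/-- The cocycle is constant on triple intersections. -/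
theorem tau_arrBB_eq (C : GoodCover pt ι) (τ : BandedGerbe (C.groupoid d) G) {α β γ : ι} {y y' : S}
    (hα : y ∈ C.B α) (hβ : y ∈ C.B β) (hγ : y ∈ C.B γ) (hα' : y' ∈ C.B α) (hβ' : y' ∈ C.B β)
    (hγ' : y' ∈ C.B γ) :
    τ.tau (C.arrBB d α β y hα hβ) (C.arrBB d β γ y hβ hγ) rfl
      = τ.tau (C.arrBB d α β y' hα' hβ') (C.arrBB d β γ y' hβ' hγ') rfl := by
  let V : Set S := C.B α ∩ C.B β ∩ C.B γ
  have : ContractibleSpace V := C.contractible_three (.inl α) (.inl β) (.inl γ) ⟨y, ⟨hα, hβ⟩, hγ⟩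
  have hc : Continuous fun x : V => τ.tau (C.arrBB d α β x x.2.1.1 x.2.1.2)
      (C.arrBB d β γ x x.2.1.2 x.2.2) rfl := by
    refine τ.continuous_tau.comp (Y := {p : (C.groupoid d).Arr × (C.groupoid d).Arr //
      (C.groupoid d).tgt p.1 = (C.groupoid d).src p.2}) (f := fun x : V =>
      ⟨(C.arrBB d α β x x.2.1.1 x.2.1.2, C.arrBB d β γ x x.2.1.2 x.2.2), rfl⟩) ?_
    refine Continuous.subtype_mk (Continuous.prodMk ?_ ?_) _
    · exact C.continuous_arrBB α β (fun x hx => hx.1.1) (fun x hx => hx.1.2)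
    · exact C.continuous_arrBB β γ (fun x hx => hx.1.2) (fun x hx => hx.2)
  exact PreconnectedSpace.constant (α := V) inferInstance hc (x := ⟨y, ⟨hα, hβ⟩, hγ⟩)
    (y := ⟨y', ⟨hα', hβ'⟩, hγ'⟩)

open Classical in
/-- The value of a cocycle on a triple intersection. -/
def tri (C : GoodCover pt ι) (τ : BandedGerbe (C.groupoid d) G) (α β γ : ι) :
    Subgroup.center G :=
  if h : ∃ y, y ∈ C.B α ∧ y ∈ C.B β ∧ y ∈ C.B γ then
    τ.tau (C.arrBB d α β h.choose h.choose_spec.1 h.choose_spec.2.1)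
      (C.arrBB d β γ h.choose h.choose_spec.2.1 h.choose_spec.2.2) rfl
  else 1

theorem tri_eq (C : GoodCover pt ι) (τ : BandedGerbe (C.groupoid d) G) {α β γ : ι} {y : S}
    (hα : y ∈ C.B α) (hβ : y ∈ C.B β) (hγ : y ∈ C.B γ) :
    C.tri τ α β γ = τ.tau (C.arrBB d α β y hα hβ) (C.arrBB d β γ y hβ hγ) rfl := by
  rw [tri, dif_pos ⟨y, hα, hβ, hγ⟩]
  exact C.tau_arrBB_eq τ _ _ _ _ _ _

theorem tri_cocycle (C : GoodCover pt ι) (τ : BandedGerbe (C.groupoid d) G) {α β γ δ : ι} {y : S}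
    (hα : y ∈ C.B α) (hβ : y ∈ C.B β) (hγ : y ∈ C.B γ) (hδ : y ∈ C.B δ) :
    C.tri τ α β γ * C.tri τ α γ δ = C.tri τ β γ δ * C.tri τ α β δ := by
  rw [C.tri_eq τ hα hβ hγ, C.tri_eq τ hα hγ hδ, C.tri_eq τ hβ hγ hδ, C.tri_eq τ hα hβ hδ]
  have h := τ.cocycle (C.arrBB d α β y hα hβ) (C.arrBB d β γ y hβ hγ) (C.arrBB d γ δ y hγ hδ) rfl rfl
  simp only [arrBB_mul] at h
  exact h

theorem tri_left (C : GoodCover pt ι) (τ : BandedGerbe (C.groupoid d) G) {α β : ι} {y : S}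
    (hα : y ∈ C.B α) (hβ : y ∈ C.B β) : C.tri τ α α β = 1 := by
  rw [C.tri_eq τ hα hα hβ]
  exact τ.one_left (C.arrBB d α β y hα hβ)

theorem tri_right (C : GoodCover pt ι) (τ : BandedGerbe (C.groupoid d) G) {α β : ι} {y : S}
    (hα : y ∈ C.B α) (hβ : y ∈ C.B β) : C.tri τ α β β = 1 := by
  rw [C.tri_eq τ hα hβ hβ]
  exact τ.one_right (C.arrBB d α β y hα hβ)

/-- Over the punctured surface, a cocycle is a coboundary. -/
theorem exists_tri_eq [PreconnectedSpace S] [Finite ι] (hn : 0 < n) (C : GoodCover pt ι)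
    (τ : BandedGerbe (C.groupoid d) G) :
    ∃ ψ : ι → ι → Subgroup.center G, (∀ α, ψ α α = 1) ∧ ∀ α β γ y, y ∈ C.B α → y ∈ C.B β →
      y ∈ C.B γ → C.tri τ α β γ = ψ α β * ψ β γ * (ψ α γ)⁻¹ := by
  classical
  -- An arbitrary order selects one of the two directions of each edge. Giving ψ₀ the common value
  -- of τ on α β α and β α β in one direction only makes the quotient f trivial there, which
  -- together with the cocycle identity makes f alternating.
  let : LinearOrder ι := IsWellOrder.linearOrder WellOrderingRel
  let ψ₀ : ι → ι → Subgroup.center G := fun α β => if β < α then C.tri τ α β α else 1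
  let f : ι → ι → ι → Subgroup.center G := fun α β γ =>
    C.tri τ α β γ * (ψ₀ α β * ψ₀ β γ * (ψ₀ α γ)⁻¹)⁻¹
  have hψ₀ : ∀ α, ψ₀ α α = 1 := fun α => if_neg (lt_irrefl α)
  have tri_symm : ∀ α β y, y ∈ C.B α → y ∈ C.B β → C.tri τ α β α = C.tri τ β α β := by
    intro α β y hα hβ
    have h := C.tri_cocycle τ hα hβ hα hβ
    rw [C.tri_left τ hα hβ, C.tri_right τ hα hβ, mul_one, mul_one] at h
    exact h
  have f_symm : ∀ α β y, y ∈ C.B α → y ∈ C.B β → f α β α = 1 := by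
    intro α β y hα hβ
    simp only [f, hψ₀, ψ₀]
    rcases lt_trichotomy α β with h | rfl | h
    · simp [h, h.not_gt, tri_symm α β y hα hβ]
    · simp [C.tri_left τ hα hα]
    · simp [h, h.not_gt]
  have f_cocycle : ∀ α β γ δ y, y ∈ C.B α → y ∈ C.B β → y ∈ C.B γ → y ∈ C.B δ →
      f α β γ * f α γ δ = f β γ δ * f α β δ := by
    intro α β γ δ y hα hβ hγ hδ
    have h := C.tri_cocycle τ hα hβ hγ hδ
    exact cocycle_div_coboundary h _ _ _ _ _ _
  have f_left : ∀ α β y, y ∈ C.B α → y ∈ C.B β → f α α β = 1 := by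
    intro α β y hα hβ
    simp [f, hψ₀, C.tri_left τ hα hβ]
  have f_right : ∀ α β y, y ∈ C.B α → y ∈ C.B β → f α β β = 1 := by
    intro α β y hα hβ
    simp [f, hψ₀, C.tri_right τ hα hβ]
  have f_swap : ∀ α β γ y, y ∈ C.B α → y ∈ C.B β → y ∈ C.B γ → f β α γ = (f α β γ)⁻¹ := by
    intro α β γ y hα hβ hγ
    have h := f_cocycle α β α γ y hα hβ hα hγ
    rw [f_symm α β y hα hβ, f_left α γ y hα hγ, one_mul] at h
    exact eq_inv_of_mul_eq_one_left h.symm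
  have f_swap' : ∀ α β γ y, y ∈ C.B α → y ∈ C.B β → y ∈ C.B γ → f α γ β = (f α β γ)⁻¹ := by
    intro α β γ y hα hβ hγ
    have h := f_cocycle α β γ β y hα hβ hγ hβ
    rw [f_symm β γ y hβ hγ, f_right α β y hα hβ, one_mul] at h
    exact eq_inv_of_mul_eq_one_right h
  obtain ⟨φ, h1, h2⟩ := PuncturedSurface.exists_bd_eq (K := C.nerve) ⟨0, hn⟩ (f := f)
    (by
      rintro α β γ ⟨-, -, -, y, ⟨hα, hβ⟩, hγ⟩
      rw [f_swap' β α γ y hβ hα hγ, f_swap α β γ y hα hβ hγ, inv_inv])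
    (by
      rintro α β γ ⟨-, -, -, y, ⟨hα, hβ⟩, hγ⟩
      exact f_swap α β γ y hα hβ hγ)
  have h3 : ∀ α β γ y, y ∈ C.B α → y ∈ C.B β → y ∈ C.B γ →
      f α β γ = φ α β * φ β γ * (φ α γ)⁻¹ := by
    intro α β γ y hα hβ hγ
    -- The combinatorial statement covers nondegenerate triangles only; on triples with a repetition
    -- both sides are trivial, since φ is alternating.
    by_cases e1 : α = β
    · subst e1
      rw [f_left α γ y hα hγ, h1.1]; simp
    by_cases e2 : β = γ
    · subst e2
      rw [f_right α β y hα hβ, h1.1]; simp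
    by_cases e3 : γ = α
    · subst e3
      rw [f_symm γ β y hγ hβ, h1.1, h1.2 γ β]; simp
    rw [← h2 α β γ ⟨e1, e2, e3, y, ⟨hα, hβ⟩, hγ⟩, PuncturedSurface.bd, h1.2 α γ]
  refine ⟨fun α β => ψ₀ α β * φ α β, fun α => by simp only [hψ₀, h1.1, one_mul],
    fun α β γ y hα hβ hγ => ?_⟩
  have h4 := h3 α β γ y hα hβ hγ
  simp only [f] at h4
  rw [mul_inv_eq_iff_eq_mul] at h4
  rw [h4, mul_inv, mul_mul_mul_comm (ψ₀ α β), mul_mul_mul_comm (ψ₀ α β * _), mul_comm]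

/-- A gerbe over an orbifold surface with at least one marked point is represented by a cocycle
that is trivial over the punctured surface. -/
theorem exists_trivialOnPunctured [PreconnectedSpace S] [Finite ι] (hn : 0 < n)
    (C : GoodCover pt ι) (τ : BandedGerbe (C.groupoid d) G) :
    ∃ τ' ψ, τ.CohomologousVia τ' ψ ∧ C.TrivialOnPunctured τ' := by
  obtain ⟨φ, h1, h2⟩ := C.exists_tri_eq hn τ
  -- Arrows with an end in a disc receive the value 1; they do not enter the condition over the
  -- punctured surface.
  let f : ι ⊕ Fin n → ι ⊕ Fin n → Subgroup.center G := fun a b =>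
    Sum.elim (fun α => Sum.elim (fun β => φ α β) (fun _ => 1) b) (fun _ => 1) a
  let ψ : Cochain1 (C.groupoid d) G := ⟨fun q => f (C.cls q.1.1) (C.cls q.1.2.1),
    C.continuous_of_cls f⟩
  have hψ : ∀ x, ψ.val ((C.groupoid d).one x) = 1 := by
    rintro (⟨α, x⟩ | ⟨j, z⟩)
    · exact h1 α
    · rfl
  refine ⟨τ.twist ψ hψ, ψ, τ.cohomologousVia_twist ψ hψ, ?_⟩
  intro q r h hq hr
  obtain ⟨α, β, x, hx, hy, rfl⟩ := hq.exists_eq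
  obtain ⟨β', γ, x', hy', ht, rfl⟩ := hr.exists_eq
  obtain ⟨rfl, rfl⟩ := arrBB_composable h
  have e := h2 α β γ x hx hy ht
  rw [C.tri_eq τ hx hy ht] at e
  change τ.tau (C.arrBB d α β x hx hy) (C.arrBB d β γ x hy ht) rfl
    * (φ α β * φ β γ * (φ α γ)⁻¹)⁻¹ = 1
  rw [e, mul_inv_cancel]

end GoodCover
end

noncomputable section

open scoped IsMulCommutative

namespace GoodCover

open TopGroupoid (BandedGerbe Cochain1)

variable {S : Type u} [TopologicalSpace S] [ChartedSpace ℂ S] {n : ℕ}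
  {pt : Fin n → S} {ι : Type v} {d : Fin n → ℕ+} {G : Type w} [Group G] [TopologicalSpace G]

/-! ## Arrows of the groupoid -/

theorem center_comm {G : Type*} [Group G] (t : Subgroup.center G) (g : G) : g * (t : G) = t * g :=
  Subgroup.mem_center_iff.mp t.2 g

theorem turn_turn (z : Disc) (s t : ℝ) : turn (turn z s) t = turn z (s + t) := by
  refine Subtype.ext ?_
  simp only [turn]
  rw [← mul_assoc, ← Complex.exp_add]
  congr 2
  push_cast
  ring

theorem turn_zero (z : Disc) : turn z 0 = z := by
  refine Subtype.ext ?_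
  simp [turn]

theorem turn_add_div (z : Disc) (a b : ℕ) (N : ℕ+) :
    turn (turn z (a / N)) (b / N) = turn z ((a + b : ℕ) / N) := by
  rw [turn_turn]
  congr 1
  push_cast
  ring

theorem proj_turn_div (C : GoodCover pt ι) (j : Fin n) (z : Disc) (k : ℕ) :
    C.proj d j (turn z (k / d j)) = C.proj d j z :=
  C.proj_eq_of_mul d (C.arrRot d j z k).2.2.1 rfl

theorem continuous_turn : Continuous fun p : Disc × ℝ => turn p.1 p.2 := by
  unfold turn; fun_prop

theorem arrRot_mul (C : GoodCover pt ι) (j : Fin n) (z : Disc) (a b : ℕ) :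
    (C.groupoid d).mul (C.arrRot d j z a) (C.arrRot d j (turn z (a / d j)) b) rfl
      = C.arrRot d j z (a + b) :=
  Subtype.ext (Prod.ext rfl (Prod.ext (congrArg (fun w => Sum.inr (j, w)) (turn_add_div z a b _))
    (rootLabel_add _ a b).symm))

theorem arrRot_congr (C : GoodCover pt ι) (j : Fin n) (z : Disc) {a b : ℕ}
    (h : rootLabel (d j) a = rootLabel (d j) b) : C.arrRot d j z a = C.arrRot d j z b := by
  refine Subtype.ext (Prod.ext rfl (Prod.ext (congrArg (fun w => Sum.inr (j, w)) ?_) h))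
  exact Subtype.ext (congrArg (· * (z : ℂ)) h)

theorem arrRot_zero (C : GoodCover pt ι) (j : Fin n) (z : Disc) :
    C.arrRot d j z 0 = (C.groupoid d).one (.inr (j, z)) := by
  refine Subtype.ext (Prod.ext rfl (Prod.ext (congrArg (fun w => Sum.inr (j, w)) ?_)
    (rootLabel_zero _)))
  simp [turn_zero]

theorem rootLabel_self (N : ℕ+) : rootLabel N N = rootLabel N 0 := by
  rw [rootLabel_eq_pow, (isPrimitiveRoot_rootLabel N).pow_eq_one, rootLabel_zero]

theorem arrBB_mul_arrBD (C : GoodCover pt ι) {α β : ι} {j : Fin n} {z : Disc}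
    (hα : C.proj d j z ∈ C.B α) (hβ : C.proj d j z ∈ C.B β) :
    (C.groupoid d).mul (C.arrBB d α β _ hα hβ) (C.arrBD d β j z hβ) rfl = C.arrBD d α j z hα :=
  Subtype.ext (Prod.ext rfl (Prod.ext rfl (one_mul _)))

theorem arrBB_congr (C : GoodCover pt ι) {α β : ι} {y y' : S} (h : y = y') (hα : y ∈ C.B α)
    (hβ : y ∈ C.B β) : C.arrBB d α β y hα hβ = C.arrBB d α β y' (h ▸ hα) (h ▸ hβ) := by
  subst h; rfl

theorem arrBD_congr (C : GoodCover pt ι) {α : ι} {j : Fin n} {z z' : Disc} (h : z = z')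
    (hz : C.proj d j z ∈ C.B α) : C.arrBD d α j z hz = C.arrBD d α j z' (h ▸ hz) := by
  subst h; rfl

theorem mem_turn (C : GoodCover pt ι) {α : ι} {j : Fin n} {z : Disc} (k : ℕ)
    (h : C.proj d j z ∈ C.B α) : C.proj d j (turn z (k / d j)) ∈ C.B α := by
  rwa [proj_turn_div]

theorem arrBD_mul_arrRot (C : GoodCover pt ι) {α : ι} {j : Fin n} {z : Disc} (k : ℕ)
    (h : C.proj d j z ∈ C.B α) :
    (C.groupoid d).mul (C.arrBD d α j z h) (C.arrRot d j z k) rfl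
      = C.arrBD d α j (turn z (k / d j)) (C.mem_turn k h) := by
  refine Subtype.ext (Prod.ext ?_ (Prod.ext rfl (mul_comm _ _)))
  exact congrArg Sum.inl (Sigma.ext rfl (heq_of_eq (Subtype.ext (C.proj_turn_div j z k).symm)))

theorem continuous_arrBD (C : GoodCover pt ι) (α : ι) (j : Fin n) :
    Continuous fun z : {z : Disc // C.proj d j z ∈ C.B α} =>
      (C.arrBD d α j z z.2 : (C.groupoid d).Arr) := by
  have h := C.continuous_proj d j
  refine Continuous.subtype_mk ?_ _
  refine Continuous.prodMk ?_ (Continuous.prodMk ?_ 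
    (continuous_subtype_val.comp continuous_subtype_val))
  · exact continuous_inl.comp (continuous_sigmaMk.comp
      ((h.comp continuous_subtype_val).subtype_mk _))
  · exact continuous_inr.comp (continuous_const.prodMk continuous_subtype_val)

theorem continuous_arrRot (C : GoodCover pt ι) (j : Fin n) (k : ℕ) :
    Continuous fun z : Disc => (C.arrRot d j z k : (C.groupoid d).Arr) := by
  have h : Continuous fun z : Disc => turn z (k / d j) := continuous_turn.comp (continuous_id.prodMk continuous_const)
  refine Continuous.subtype_mk ?_ _
  refine Continuous.prodMk ?_ (Continuous.prodMk ?_ continuous_const)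
  · exact continuous_inr.comp (continuous_const.prodMk continuous_id)
  · exact continuous_inr.comp (continuous_const.prodMk h)

instance : PreconnectedSpace Disc :=
  Subtype.preconnectedSpace (convex_ball (0 : ℂ) 1).isPreconnected

/-! ## The cocycle on a stabiliser -/

theorem tau_continuous_comp {Q : TopGroupoid.{u', v'}} (τ : BandedGerbe Q G) {X : Type*}
    [TopologicalSpace X] {f g : X → Q.Arr} (hf : Continuous f) (hg : Continuous g)
    (h : ∀ x, Q.tgt (f x) = Q.src (g x)) : Continuous fun x => τ.tau (f x) (g x) (h x) :=
  τ.continuous_tau.comp (f := fun x => (⟨(f x, g x), h x⟩ :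
    {p : Q.Arr × Q.Arr // Q.tgt p.1 = Q.src p.2})) (by fun_prop)

/-- The values of a cocycle on the stabiliser of the centre of `𝔇 j`. -/
def stab (C : GoodCover pt ι) (τ : BandedGerbe (C.groupoid d) G) (j : Fin n) (a b : ℕ) :
    Subgroup.center G :=
  τ.tau (C.arrRot d j origin a) (C.arrRot d j origin b)
    (congrArg (fun z => Sum.inr (j, z)) (turn_origin _))

/-- The value is locally constant in the starting point and the disc is connected, so it can be
computed at the centre. -/
theorem tau_arrRot [DiscreteTopology G] (C : GoodCover pt ι) (τ : BandedGerbe (C.groupoid d) G)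
    (j : Fin n) (z : Disc) (a b : ℕ) :
    τ.tau (C.arrRot d j z a) (C.arrRot d j (turn z (a / d j)) b) rfl = C.stab τ j a b := by
  have h : Continuous fun z : Disc => turn z (a / d j) := continuous_turn.comp (continuous_id.prodMk continuous_const)
  have hc := tau_continuous_comp τ (C.continuous_arrRot (d := d) j a)
    ((C.continuous_arrRot (d := d) j b).comp h) fun _ => rfl
  refine (PreconnectedSpace.constant inferInstance hc (y := origin)).trans ?_
  exact τ.tau_congr rfl (congrArg (fun z => C.arrRot d j z b) (turn_origin _)) _

section

variable (C : GoodCover pt ι) (τ : BandedGerbe (C.groupoid d) G) (j : Fin n)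

theorem stab_cocycle (a b c : ℕ) :
    C.stab τ j a b * C.stab τ j (a + b) c = C.stab τ j b c * C.stab τ j a (b + c) := by
  have e : ∀ k : ℕ, turn origin (k / d j) = origin := fun k => turn_origin _
  have e' : ∀ k, (C.groupoid d).tgt (C.arrRot d j origin k) = Sum.inr (j, origin) := fun k =>
    congrArg (fun z => Sum.inr (j, z)) (turn_origin _)
  have m : ∀ a b, (C.groupoid d).mul (C.arrRot d j origin a) (C.arrRot d j origin b) (e' a)
      = C.arrRot d j origin (a + b) := by
    intro a b
    rw [← C.arrRot_mul]
    congr 1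
    rw [e]
  have h := τ.cocycle (C.arrRot d j origin a) (C.arrRot d j origin b) (C.arrRot d j origin c)
    (e' a) (e' b)
  simp only [m] at h
  exact h

theorem stab_zero_left (b : ℕ) : C.stab τ j 0 b = 1 := by
  exact (τ.tau_congr (C.arrRot_zero j _) rfl _).trans (τ.one_left (C.arrRot d j origin b))

theorem stab_zero_right (a : ℕ) : C.stab τ j a 0 = 1 := by
  exact (τ.tau_congr rfl ((C.arrRot_zero j origin).trans (congrArg (C.groupoid d).one
    (congrArg (fun z => Sum.inr (j, z)) (turn_origin (a / d j)).symm))) _).trans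
    (τ.one_right (C.arrRot d j origin a))

theorem stab_congr {a a' b b' : ℕ} (ha : rootLabel (d j) a = rootLabel (d j) a')
    (hb : rootLabel (d j) b = rootLabel (d j) b') : C.stab τ j a b = C.stab τ j a' b' :=
  τ.tau_congr (C.arrRot_congr j _ ha) (C.arrRot_congr j _ hb) _

/-- Induction with the cocycle identity for the rotations 1, a, 1: the stabiliser is cyclic, so its
cocycle is symmetric against the generator. -/
theorem stab_comm (a : ℕ) : C.stab τ j a 1 = C.stab τ j 1 a := by
  induction a with
  | zero => rw [stab_zero_left, stab_zero_right]
  | succ a ih =>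
    have h := C.stab_cocycle τ j 1 a 1
    rw [ih] at h
    rw [add_comm a 1] at h ⊢
    exact mul_left_cancel h

/-- The product `τ(q, q) ⋯ τ(q, q^(k-1))`, where `q` generates the stabiliser. -/
def holPow (k : ℕ) : Subgroup.center G := ∏ i ∈ Finset.range k, C.stab τ j 1 i

theorem holPow_succ (k : ℕ) : C.holPow τ j (k + 1) = C.holPow τ j k * C.stab τ j 1 k :=
  Finset.prod_range_succ _ _

/-- `holPow` starts with the trivial factor of index 0, while `holPt` starts at index 1; both end at
d − 1. -/
theorem holPow_self : C.holPow τ j (d j) = C.holPt τ j := by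
  obtain ⟨k, hk⟩ : ∃ k, (d j : ℕ) = k + 1 := ⟨(d j : ℕ) - 1, (Nat.succ_pred_eq_of_pos (d j).2).symm⟩
  have h : C.holPt τ j = ∏ i ∈ Finset.range ((d j : ℕ) - 1), C.stab τ j 1 (i + 1) := by
    rw [holPt, List.prod_ofFn, Finset.prod_range]
    rfl
  rw [h, hk, holPow, Finset.prod_range_succ', stab_zero_right, mul_one, Nat.add_sub_cancel]

/-- The factors are periodic in the exponent with period d, so m·d of them form m full periods. -/
theorem holPow_mul (m : ℕ) : C.holPow τ j (m * d j) = C.holPt τ j ^ m := by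
  induction m with
  | zero => simp [holPow]
  | succ m ih =>
    rw [add_mul, one_mul, holPow, Finset.prod_range_add, pow_succ]
    congr 1
    rw [← holPow_self, holPow]
    refine Finset.prod_congr rfl fun i _ => C.stab_congr τ j rfl ?_
    rw [rootLabel_add, rootLabel_eq_pow, mul_comm m, pow_mul,
      (isPrimitiveRoot_rootLabel _).pow_eq_one, one_pow, one_mul]

/-- The values on the stabiliser of a lifting that takes the value `x` on the generator. -/
def powVal (x : G) (k : ℕ) : G := x ^ k * (C.holPow τ j k : G)

variable {C τ j}

theorem powVal_zero (x : G) : C.powVal τ j x 0 = 1 := by simp [powVal, holPow]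

theorem powVal_one (x : G) : C.powVal τ j x 1 = x := by
  simp [powVal, holPow, stab_zero_right]

theorem powVal_one_add (x : G) (k : ℕ) :
    C.powVal τ j x (1 + k) = x * C.powVal τ j x k * (C.stab τ j 1 k : G) := by
  rw [add_comm, powVal, powVal, holPow_succ, pow_succ', Subgroup.coe_mul]
  simp only [mul_assoc]

/-- The partial products in `holPow` are chosen to make powers of x multiplicative up to the
cocycle; the induction step is the cocycle identity for 1, a, b. -/
theorem powVal_add (x : G) (a b : ℕ) :
    C.powVal τ j x (a + b) = C.powVal τ j x a * C.powVal τ j x b * (C.stab τ j a b : G) := by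
  induction a with
  | zero => rw [powVal_zero, stab_zero_left]; simp
  | succ a ih =>
    have h := congrArg (Subtype.val) (C.stab_cocycle τ j 1 a b)
    simp only [Subgroup.coe_mul] at h
    rw [add_comm a 1] at *
    rw [add_assoc, powVal_one_add, ih, powVal_one_add]
    rw [mul_assoc (x * _) (C.stab τ j 1 a : G), ← center_comm (C.stab τ j 1 a),
      mul_assoc (x * _), mul_assoc (C.powVal τ j x b) (C.stab τ j 1 a : G), h]
    simp only [mul_assoc]

/-- The power relation for x is what makes `powVal` depend on the root of unity only, that is,
descend from ℕ to the finite stabiliser. -/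
theorem powVal_congr {x : G} (hx : C.powVal τ j x (d j) = 1) {a b : ℕ}
    (h : rootLabel (d j) a = rootLabel (d j) b) : C.powVal τ j x a = C.powVal τ j x b := by
  have key : ∀ m k, C.powVal τ j x (m * d j + k) = C.powVal τ j x k := by
    intro m k
    induction m with
    | zero => simp
    | succ m ih =>
      rw [add_mul, one_mul, add_right_comm, powVal_add, hx, ih,
        C.stab_congr τ j rfl (rootLabel_self _), stab_zero_right]
      simp
  have hr := isPrimitiveRoot_rootLabel (d j)
  rw [rootLabel_eq_pow, rootLabel_eq_pow _ b, pow_eq_pow_mod a hr.pow_eq_one,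
    pow_eq_pow_mod b hr.pow_eq_one] at h
  have h' := hr.pow_inj (Nat.mod_lt _ (d j).2) (Nat.mod_lt _ (d j).2) h
  rw [← Nat.div_add_mod a (d j), ← Nat.div_add_mod b (d j), mul_comm, key, mul_comm, key, h']

end

end GoodCover
end

/-! ### The cocycle on arrows into a disc, and the holonomy around a circle -/

noncomputable section

open scoped IsMulCommutative

theorem continuousOn_dite {X K : Type*} [TopologicalSpace X] [TopologicalSpace K] {p : X → Prop}
    [DecidablePred p] (f : ∀ x, p x → K) (k : K) (hf : Continuous fun x : {x // p x} => f x x.2) :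
    ContinuousOn (fun x => if h : p x then f x h else k) {x | p x} := by
  rw [continuousOn_iff_continuous_domRestrict]
  refine hf.congr fun x => ?_
  exact (dif_pos x.2).symm

theorem List.prod_ofFn_mul_center {G : Type*} [Group G] {N : ℕ} (a : Fin N → G)
    (t : Fin N → Subgroup.center G) :
    (List.ofFn fun k => a k * (t k : G)).prod
      = (List.ofFn a).prod * ((List.ofFn t).prod : Subgroup.center G) := by
  induction N with
  | zero => simp
  | succ N ih =>
    simp only [List.ofFn_succ, List.prod_cons, ih, Subgroup.coe_mul]
    rw [mul_assoc, mul_assoc, ← mul_assoc (t 0 : G), ← GoodCover.center_comm (t 0), mul_assoc]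

namespace GoodCover

open TopGroupoid (BandedGerbe Cochain1)

variable {S : Type u} [TopologicalSpace S] [ChartedSpace ℂ S] {n : ℕ}
  {pt : Fin n → S} {ι : Type v} {d : Fin n → ℕ+} {G : Type w} [Group G] [TopologicalSpace G]

/-- A family of functions along a path, locally constant on the members of the cover, whose values
at the times of a chain are related by the factors `κ`. -/
theorem Chain.telescope {C : GoodCover pt ι} {x y : Punctured pt} {γ : Path x y} {α β : ι}
    (c : Chain C γ α β) {H : Type*} [Group H] [TopologicalSpace H] [DiscreteTopology H]
    (s : ι → I → H) (hs : ∀ α, ContinuousOn (s α) {r | (γ r : S) ∈ C.B α}) (κ : Fin c.len → H)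
    (hκ : ∀ k : Fin c.len, s (c.idx k) (c.time (k + 1))
      = κ k * s (c.idx (k + 1)) (c.time (k + 1))) :
    s α 0 = (List.ofFn κ).prod * s β 1 := by
  have const : ∀ k ≤ c.len, s (c.idx k) (c.time k) = s (c.idx k) (c.time (k + 1)) := by
    intro k hk
    refine ((hs (c.idx k)).mono fun r hr => c.mem k hk r hr).eq_of_isPreconnected
      (Set.ordConnected_Icc.isPreconnected) (Set.left_mem_Icc.mpr (c.time_le k hk))
      (Set.right_mem_Icc.mpr (c.time_le k hk))
  have key : ∀ k ≤ c.len, s α 0 = ((List.ofFn κ).take k).prod * s (c.idx k) (c.time k) := by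
    intro k hk
    induction k with
    | zero => simp [c.idx_zero, c.time_zero]
    | succ k ih =>
      rw [ih (by omega), List.prod_take_succ _ _ (by simpa using hk), const k (by omega),
        hκ ⟨k, hk⟩]
      simp [mul_assoc]
  have := key c.len le_rfl
  rw [const _ le_rfl, c.time_last, c.idx_last] at this
  rwa [List.take_of_length_le (by simp)] at this

section Cocycle

variable (C : GoodCover pt ι) (τ : BandedGerbe (C.groupoid d) G)

open Classical in
/-- The cocycle on the arrow from `B α` to `B β` followed by the arrow to a point of `𝔇 j`. -/
def tauBBD (α β : ι) (j : Fin n) (z : Disc) : Subgroup.center G :=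
  if h : C.proj d j z ∈ C.B α ∧ C.proj d j z ∈ C.B β then
    τ.tau (C.arrBB d α β _ h.1 h.2) (C.arrBD d β j z h.2) rfl else 1

open Classical in
/-- The cocycle on the arrow from `B α` to a point of `𝔇 j` followed by a rotation. -/
def tauBDR (α : ι) (j : Fin n) (k : ℕ) (z : Disc) : Subgroup.center G :=
  if h : C.proj d j z ∈ C.B α then τ.tau (C.arrBD d α j z h) (C.arrRot d j z k) rfl else 1

variable {C} {α β γ : ι} {j : Fin n} {z : Disc}

theorem tauBBD_eq (hα : C.proj d j z ∈ C.B α) (hβ : C.proj d j z ∈ C.B β) :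
    C.tauBBD τ α β j z = τ.tau (C.arrBB d α β _ hα hβ) (C.arrBD d β j z hβ) rfl :=
  dif_pos ⟨hα, hβ⟩

theorem tauBDR_eq (k : ℕ) (hα : C.proj d j z ∈ C.B α) :
    C.tauBDR τ α j k z = τ.tau (C.arrBD d α j z hα) (C.arrRot d j z k) rfl :=
  dif_pos hα

theorem continuousOn_tauBBD (α β : ι) (j : Fin n) : ContinuousOn (C.tauBBD τ α β j)
    {z | C.proj d j z ∈ C.B α ∧ C.proj d j z ∈ C.B β} := by
  classical
  refine (continuousOn_dite (p := fun z => C.proj d j z ∈ C.B α ∧ C.proj d j z ∈ C.B β)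
    (fun z h => τ.tau (C.arrBB d α β _ h.1 h.2) (C.arrBD d β j z h.2) rfl) 1 ?_).congr
      fun z _ => ?_
  · refine tau_continuous_comp τ ?_ ?_ fun _ => rfl
    · exact (C.continuous_arrBB (d := d) α β (V := C.B α ∩ C.B β) Set.inter_subset_left
        Set.inter_subset_right).comp (f := fun z : {z : Disc // C.proj d j z ∈ C.B α ∧
          C.proj d j z ∈ C.B β} => (⟨C.proj d j z, z.2⟩ : ↥(C.B α ∩ C.B β)))
        (((C.continuous_proj d j).comp continuous_subtype_val).subtype_mk _)
    · exact (C.continuous_arrBD (d := d) β j).comp (f := fun z : {z : Disc // C.proj d j z ∈ C.B α ∧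
          C.proj d j z ∈ C.B β} => (⟨z, z.2.2⟩ : {z : Disc // C.proj d j z ∈ C.B β}))
        (continuous_subtype_val.subtype_mk _)
  · unfold tauBBD; congr

theorem continuousOn_tauBDR (α : ι) (j : Fin n) (k : ℕ) : ContinuousOn (C.tauBDR τ α j k)
    {z | C.proj d j z ∈ C.B α} := by
  classical
  refine (continuousOn_dite (p := fun z => C.proj d j z ∈ C.B α)
    (fun z h => τ.tau (C.arrBD d α j z h) (C.arrRot d j z k) rfl) 1 ?_).congr fun z _ => ?_
  · exact tau_continuous_comp τ (C.continuous_arrBD (d := d) α j)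
      ((C.continuous_arrRot (d := d) j k).comp continuous_subtype_val) fun _ => rfl
  · unfold tauBDR; congr

variable {τ}

/-- In the cocycle identity the term on the two arrows over the punctured surface drops out, so
these values form an honest 1-cocycle in α and β. This is what permits them to twist a local system
on the half-plane. -/
theorem tauBBD_trans (hτ : C.TrivialOnPunctured τ) (hα : C.proj d j z ∈ C.B α)
    (hβ : C.proj d j z ∈ C.B β) (hγ : C.proj d j z ∈ C.B γ) :
    C.tauBBD τ α γ j z = C.tauBBD τ α β j z * C.tauBBD τ β γ j z := by
  rw [tauBBD_eq τ hα hγ, tauBBD_eq τ hα hβ, tauBBD_eq τ hβ hγ]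
  have h := τ.cocycle (C.arrBB d α β _ hα hβ) (C.arrBB d β γ _ hβ hγ) (C.arrBD d γ j z hγ) rfl rfl
  rw [hτ (C.arrBB d α β _ hα hβ) (C.arrBB d β γ _ hβ hγ) rfl ⟨rfl, rfl⟩ ⟨rfl, rfl⟩, one_mul] at h
  simp only [arrBB_mul, arrBB_mul_arrBD] at h
  rw [h, mul_comm]

/-- The cocycle identity for an arrow between two members, an arrow into the disc and a rotation: it
compares the twist on two sheets. -/
theorem tauBBD_mul_tauBDR (k : ℕ) (hα : C.proj d j z ∈ C.B α) (hβ : C.proj d j z ∈ C.B β) :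
    C.tauBBD τ α β j z * C.tauBDR τ α j k z
      = C.tauBDR τ β j k z * C.tauBBD τ α β j (turn z (k / d j)) := by
  rw [tauBBD_eq τ hα hβ, tauBDR_eq τ k hα, tauBDR_eq τ k hβ,
    tauBBD_eq τ (C.mem_turn k hα) (C.mem_turn k hβ)]
  have h := τ.cocycle (C.arrBB d α β _ hα hβ) (C.arrBD d β j z hβ) (C.arrRot d j z k) rfl rfl
  simp only [arrBB_mul_arrBD, arrBD_mul_arrRot] at h
  rw [h]
  congr 1
  exact τ.tau_congr (C.arrBB_congr (C.proj_turn_div j z k).symm hα hβ) rfl _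

theorem tauBDR_mul_tauBDR [DiscreteTopology G] (a b : ℕ) (hα : C.proj d j z ∈ C.B α) :
    C.tauBDR τ α j a z * C.tauBDR τ α j b (turn z (a / d j))
      = C.stab τ j a b * C.tauBDR τ α j (a + b) z := by
  rw [tauBDR_eq τ a hα, tauBDR_eq τ b (C.mem_turn a hα), tauBDR_eq τ (a + b) hα]
  have h := τ.cocycle (C.arrBD d α j z hα) (C.arrRot d j z a) (C.arrRot d j (turn z (a / d j)) b)
    rfl rfl
  simp only [arrRot_mul, arrBD_mul_arrRot, tau_arrRot] at h
  exact h

theorem tauBDR_zero (hα : C.proj d j z ∈ C.B α) : C.tauBDR τ α j 0 z = 1 := by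
  rw [tauBDR_eq τ 0 hα]
  exact (τ.tau_congr rfl (C.arrRot_zero j z) _).trans (τ.one_right (C.arrBD d α j z hα))

theorem tauBDR_congr {a b : ℕ} (h : rootLabel (d j) a = rootLabel (d j) b)
    (hα : C.proj d j z ∈ C.B α) : C.tauBDR τ α j a z = C.tauBDR τ α j b z := by
  rw [tauBDR_eq τ a hα, tauBDR_eq τ b hα]
  exact τ.tau_congr rfl (C.arrRot_congr j z h) _

variable {w : PDisc}

/-- The values of a cocycle on the arrows of a chain along a circle, followed by the arrows to the
lift of the circle. -/
def circleVal (τ : BandedGerbe (C.groupoid d) G) (j : Fin n) (z : Disc)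
    (c : Chain C (C.circle j w) α α) (k : Fin c.len) : Subgroup.center G :=
  C.tauBBD τ (c.idx k) (c.idx (k + 1)) j (turn z ((c.time (k + 1) : ℝ) / d j))

theorem proj_turn_mem (hz : (z : ℂ) ^ (d j : ℕ) = w) (r : I) :
    C.proj d j (turn z (r / d j)) ∈ C.B β ↔ (C.circle j w r : S) ∈ C.B β := by
  rw [C.proj_turn j w z hz]

theorem holLoop_eq (hz : (z : ℂ) ^ (d j : ℕ) = w) (c : Chain C (C.circle j w) α α) :
    C.holLoop τ j w z hz c = C.tauBDR τ α j 1 z * (List.ofFn (circleVal τ j z c)).prod := by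
  rw [holLoop]
  congr 1
  · exact (tauBDR_eq τ 1 _).symm
  · congr 2
    funext k
    rw [circleVal, tauBBD_eq τ ((proj_turn_mem hz _).mpr (c.mem_left k))
      ((proj_turn_mem hz _).mpr (c.mem_right k))]
    exact τ.tau_congr (C.arrBB_congr (C.proj_turn j w z hz _).symm _ _) rfl _

theorem continuous_turn_div (z : Disc) (N : ℕ+) : Continuous fun r : I => turn z (r / N) :=
  continuous_turn.comp (f := fun r : I => (z, (r : ℝ) / N)) (by fun_prop)

theorem start_mem_disc (hz : (z : ℂ) ^ (d j : ℕ) = w) (c : Chain C (C.circle j w) α α) :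
    C.proj d j z ∈ C.B α := by
  rw [C.proj_eq_circlePt j w z hz]; exact c.start_mem

/-- The holonomy around a circle does not depend on the point over its starting point. -/
theorem holLoop_turn [DiscreteTopology G] (hz : (z : ℂ) ^ (d j : ℕ) = w)
    (c : Chain C (C.circle j w) α α) (k : ℕ)
    (hz' : (turn z (k / d j) : ℂ) ^ (d j : ℕ) = w) :
    C.holLoop τ j w (turn z (k / d j)) hz' c = C.holLoop τ j w z hz c := by
  have hα := start_mem_disc hz c
  -- Along the lifted circle, `tauBDR` for the rotation by k jumps at each change of member by the
  -- ratio of the factors on the two sheets; telescoping turns the ratio of the two products into a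
  -- comparison at the ends.
  have tel := c.telescope (s := fun δ r => C.tauBDR τ δ j k (turn z (r / d j)))
    (κ := fun i => circleVal τ j (turn z (k / d j)) c i * (circleVal τ j z c i)⁻¹)
    (fun δ => (continuousOn_tauBDR τ δ j k).comp (continuous_turn_div z (d j)).continuousOn
      fun r hr => (proj_turn_mem hz r).mpr hr)
    (fun i => by
      have h := tauBBD_mul_tauBDR (τ := τ) k ((proj_turn_mem hz _).mpr (c.mem_left i))
        ((proj_turn_mem hz _).mpr (c.mem_right i))
      have e : turn (turn z ((c.time (i + 1) : ℝ) / d j)) (k / d j)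
          = turn (turn z (k / d j)) ((c.time (i + 1) : ℝ) / d j) := by
        rw [turn_turn, turn_turn, add_comm]
      rw [e] at h
      rw [circleVal, circleVal]
      rw [mul_right_comm, ← div_eq_mul_inv, eq_div_iff_mul_eq', mul_comm, h, mul_comm])
  -- Rotating by 1 and by k in either order gives the same total; the correction terms agree by
  -- `stab_comm`.
  have h1 := tauBDR_mul_tauBDR (τ := τ) 1 k hα
  have h2 := tauBDR_mul_tauBDR (τ := τ) k 1 hα
  rw [stab_comm, add_comm k 1, ← h1] at h2
  rw [holLoop_eq, holLoop_eq]
  simp only [List.prod_ofFn, Finset.prod_mul_distrib, Finset.prod_inv_distrib] at tel ⊢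
  have e0 : turn z (((0 : I) : ℝ) / d j) = z := by simp [turn_zero]
  have e1 : turn z (((1 : I) : ℝ) / d j) = turn z ((1 : ℕ) / d j) := by simp
  rw [e0, e1] at tel
  rw [tel] at h2
  rw [← mul_right_inj (C.tauBDR τ α j k (turn z ((1 : ℕ) / d j)))]
  generalize (∏ i, circleVal τ j (turn z (k / d j)) c i) = A at *
  generalize (∏ i, circleVal τ j z c i) = B at *
  rw [← mul_assoc _ _ B, mul_comm _ (C.tauBDR τ α j 1 z), ← h2]
  rw [mul_right_comm _ _ B, mul_right_comm _ _ B, inv_mul_cancel_right, ← mul_assoc, mul_comm _ A,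
    ← mul_assoc]

end Cocycle

end GoodCover
end

noncomputable section

open scoped IsMulCommutative

theorem GoodCover.mul_center_right_comm {G : Type*} [Group G] (g : G) (t : Subgroup.center G)
    (h : G) : g * (t : G) * h = g * h * (t : G) := by
  rw [mul_assoc, mul_assoc, center_comm]

/-! ## Liftings as twisted functions on the arrows -/

namespace TopGroupoid.BandedGerbe

variable {P : TopGroupoid.{u, v}} {Q : TopGroupoid.{u', v'}} {G : Type w} [Group G]
  [TopologicalSpace G]

/-- `F` is continuous, and multiplicative up to the cocycle `τ`. -/
structure IsTwisted (τ : BandedGerbe Q G) (F : Q.Arr → G) : Prop where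
  continuous : Continuous F
  map_mul : ∀ q r h, F (Q.mul q r h) = F q * F r * (τ.tau q r h : G)

namespace IsTwisted

variable {τ : BandedGerbe Q G} {F : Q.Arr → G}

theorem map_one (hF : τ.IsTwisted F) (x : Q.Obj) : F (Q.one x) = 1 := by
  have h := hF.map_mul (Q.one (Q.src (Q.one x))) (Q.one x) (Q.tgt_one _)
  rw [Q.one_mul, τ.one_left, Q.src_one] at h
  simpa using h

theorem map_inv (hF : τ.IsTwisted F) (q : Q.Arr) :
    F (Q.inv q) = (F q)⁻¹ * ((τ.tau q (Q.inv q) (Q.src_inv q).symm : Subgroup.center G) : G)⁻¹ := by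
  have h := hF.map_mul q (Q.inv q) (Q.src_inv q).symm
  rw [Q.mul_inv, hF.map_one] at h
  rw [eq_mul_inv_iff_mul_eq]
  exact eq_inv_of_mul_eq_one_right ((_root_.mul_assoc _ _ _).symm.trans h.symm)

theorem conj [DiscreteTopology G] (hF : τ.IsTwisted F) {φ : Q.Obj → G} (hφ : Continuous φ)
    {F' : Q.Arr → G} (h : ∀ q, F' q = φ (Q.src q) * F q * (φ (Q.tgt q))⁻¹) : τ.IsTwisted F' where
  continuous := by
    have h1 := hF.continuous
    have h2 := hφ.comp Q.continuous_src
    have h3 := hφ.comp Q.continuous_tgt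
    rw [funext h]
    exact (continuous_of_discreteTopology (f := fun p : (G × G) × G => p.1.1 * p.1.2 * p.2⁻¹)).comp
      ((h2.prodMk h1).prodMk h3)
  map_mul q r hqr := by
    rw [h, h, h, Q.src_mul, Q.tgt_mul, hF.map_mul, hqr]
    simp only [_root_.mul_assoc, inv_mul_cancel_left]
    rw [GoodCover.center_comm]

end IsTwisted

variable [DiscreteTopology G]

theorem Lifting.isTwisted {τ : BandedGerbe Q G} {p : Hom P Q} (f : τ.Lifting p) :
    (τ.pullback p).IsTwisted f.F where
  continuous := continuous_fst.comp f.hom.continuous_arr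
  map_mul q r h := by
    have h1 := congrArg Prod.fst (f.hom.map_mul q r h)
    refine h1.trans ?_
    change f.F q * f.F r * (((τ.pullback p).tau (f.hom.arr q).2 (f.hom.arr r).2 _ :
      Subgroup.center G) : G) = _
    congr 2
    exact (τ.pullback p).tau_congr (f.arr_snd q) (f.arr_snd r) _

/-- The lifting with a given component. -/
def Lifting.mk' (τ : BandedGerbe Q G) (p : Hom P Q) (F : P.Arr → G)
    (hF : (τ.pullback p).IsTwisted F) : τ.Lifting p where
  hom :=
    { obj := id
      arr := fun q => (F q, q)
      continuous_obj := continuous_id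
      continuous_arr := hF.continuous.prodMk continuous_id
      src_arr := fun _ => rfl
      tgt_arr := fun _ => rfl
      map_mul := fun q r h => Prod.ext (hF.map_mul q r h) rfl }
  obj_eq _ := rfl
  arr_snd _ := rfl

/-- The coboundary of ψ compensates exactly for the factors ψ in F', because these are central and
can be collected. -/
theorem CohomologousVia.isTwisted {τ τ' : BandedGerbe Q G} {ψ : Cochain1 Q G}
    (h : τ.CohomologousVia τ' ψ) (p : Hom P Q) {F F' : P.Arr → G}
    (hF' : ∀ q, F' q = F q * (ψ.val (p.arr q) : G)) :
    (τ.pullback p).IsTwisted F ↔ (τ'.pullback p).IsTwisted F' := by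
  have hψ := ψ.continuous_val.comp p.continuous_arr
  have e : ∀ q r hqr, F q * F r * ((τ.pullback p).tau q r hqr : G)
      * (ψ.val (p.arr (P.mul q r hqr)) : G) = F' q * F' r * ((τ'.pullback p).tau q r hqr : G) := by
    intro q r hqr
    rw [hF', hF']
    have h1 := h (p.arr q) (p.arr r) (p.composable hqr)
    have h2 : (τ.pullback p).tau q r hqr = (τ'.pullback p).tau q r hqr *
      (ψ.val (p.arr q) * ψ.val (p.arr r) * (ψ.val (p.arr (P.mul q r hqr)))⁻¹) := by
      rw [p.map_mul]; exact h1
    rw [h2]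
    simp only [Subgroup.coe_mul, InvMemClass.coe_inv, ← _root_.mul_assoc, inv_mul_cancel_right]
    rw [GoodCover.mul_center_right_comm _ (ψ.val (p.arr q)) (F r),
      GoodCover.mul_center_right_comm _ _ (ψ.val (p.arr q) : G),
      GoodCover.mul_center_right_comm _ _ (ψ.val (p.arr r) : G)]
  constructor
  · intro hF
    refine ⟨?_, fun q r hqr => ?_⟩
    · rw [funext hF']
      exact (continuous_of_discreteTopology (f := fun p : G × Subgroup.center G =>
        p.1 * (p.2 : G))).comp (hF.continuous.prodMk hψ)
    · rw [hF', hF.map_mul, e]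
  · intro hF
    refine ⟨?_, fun q r hqr => ?_⟩
    · have : F = fun q => F' q * ((ψ.val (p.arr q))⁻¹ : Subgroup.center G) := by
        funext q; rw [hF']; simp
      rw [this]
      exact (continuous_of_discreteTopology (f := fun p : G × Subgroup.center G =>
        p.1 * ((p.2⁻¹ : Subgroup.center G) : G))).comp (hF.continuous.prodMk hψ)
    · have := hF.map_mul q r hqr
      rw [hF', ← e] at this
      exact mul_right_cancel this

end TopGroupoid.BandedGerbe

/-! ### Values of a twisted function along chains and at the discs -/

namespace GoodCover

open TopGroupoid (BandedGerbe Cochain1)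

variable {S : Type u} [TopologicalSpace S] [ChartedSpace ℂ S] {n : ℕ}
  {pt : Fin n → S} {ι : Type v} {d : Fin n → ℕ+} {G : Type w} [Group G] [TopologicalSpace G]
  {C : GoodCover pt ι} {τ : BandedGerbe (C.groupoid d) G}

/-- A section along γ is constant on each interval of the chain and changes by the cocycle when the
member changes; the product telescopes to the quotient of its end values. -/
theorem Chain.eval_eq_transport [DiscreteTopology G] {x y : Punctured pt} {γ : Path x y} {α β : ι}
    (c : Chain C γ α β) (L : LocalSystem (Punctured pt) ι G) (hU : L.U = C.U)
    {F : (C.groupoid d).Arr → G} (hF : ∀ α β (y : Punctured pt) hα hβ,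
      F (C.arrBB d α β y hα hβ) = L.c α β y) :
    c.eval d F = L.transport γ α β := by
  obtain ⟨s, hs⟩ := (L.comap γ.toContinuousMap).exists_section_I
  have hx : x ∈ L.U α := by
    rw [hU]
    have := c.mem 0 (Nat.zero_le _) 0 (by rw [c.time_zero]; exact ⟨le_rfl, unitInterval.nonneg _⟩)
    rw [c.idx_zero, γ.source] at this
    exact this
  have hy : y ∈ L.U β := by
    rw [hU]
    have := c.mem c.len le_rfl 1 (by rw [c.time_last]; exact ⟨unitInterval.le_one _, le_rfl⟩)
    rw [c.idx_last, γ.target] at this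
    exact this
  have hs1 : ∀ α, ContinuousOn (s α) {r | (γ r : S) ∈ C.B α} := by
    intro α
    refine (hs.1 α).mono fun r hr => ?_
    change γ r ∈ L.U α
    rw [hU]; exact hr
  have tel := c.telescope s hs1 (fun k => F (c.arr d k)) (fun k => by
    rw [Chain.arr, hF]
    refine hs.2 _ _ _ ?_ ?_
    · change γ _ ∈ L.U _; rw [hU]; exact c.mem_left k
    · change γ _ ∈ L.U _; rw [hU]; exact c.mem_right k)
  rw [L.transport_eq γ hx hy hs, tel, mul_inv_cancel_right]
  rfl

/-- Along the lift to `𝔇 j` of a circle around the marked point. -/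
theorem Chain.circle_telescope [DiscreteTopology G] {α : ι} {j : Fin n} {z : Disc} {w : PDisc}
    (c : Chain C (C.circle j w) α α)
    (F : (C.groupoid d).Arr → G) (s : ι → I → G)
    (hs : ∀ α, ContinuousOn (s α) {r | (C.circle j w r : S) ∈ C.B α})
    (hrel : ∀ α β (r : I) hα hβ, s α r = F (C.arrBB d α β (C.circle j w r) hα hβ) * s β r
      * (C.tauBBD τ α β j (turn z (r / d j)) : G)) :
    s α 0 = c.eval d F * ((List.ofFn (circleVal τ j z c)).prod : Subgroup.center G) * s α 1 := by
  rw [Chain.eval, ← List.prod_ofFn_mul_center]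
  refine c.telescope s hs _ fun k => ?_
  rw [hrel _ _ _ (c.mem_left k) (c.mem_right k), mul_assoc, center_comm, ← mul_assoc]
  rfl

section Twisted

variable {F : (C.groupoid d).Arr → G} {α β γ : ι} {j : Fin n} {z : Disc} {w : PDisc}

open Classical in
/-- The value of `F` on the arrow from `B α` to `B β`. -/
def valBB (F : (C.groupoid d).Arr → G) (α β : ι) (y : Punctured pt) : G :=
  if h : (y : S) ∈ C.B α ∧ (y : S) ∈ C.B β then F (C.arrBB d α β y h.1 h.2) else 1

open Classical in
/-- The value of `F` on the arrow from `B α` to a point of `𝔇 j`. -/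
def valBD (F : (C.groupoid d).Arr → G) (α : ι) (j : Fin n) (z : Disc) : G :=
  if h : C.proj d j z ∈ C.B α then F (C.arrBD d α j z h) else 1

theorem valBB_eq {H : Type*} [Group H] {F : (C.groupoid d).Arr → H} {y : Punctured pt} (hα : (y : S) ∈ C.B α) (hβ : (y : S) ∈ C.B β) :
    valBB F α β y = F (C.arrBB d α β y hα hβ) := dif_pos ⟨hα, hβ⟩

theorem valBD_eq {H : Type*} [Group H] {F : (C.groupoid d).Arr → H} (h : C.proj d j z ∈ C.B α) :
    valBD F α j z = F (C.arrBD d α j z h) := dif_pos h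

theorem continuousOn_valBB (hF : Continuous F) (α β : ι) :
    ContinuousOn (valBB F α β) (C.U α ∩ C.U β) := by
  classical
  refine (continuousOn_dite (p := fun y : Punctured pt => (y : S) ∈ C.B α ∧ (y : S) ∈ C.B β)
    (fun y h => F (C.arrBB d α β y h.1 h.2)) 1 ?_).congr fun z _ => ?_
  · exact hF.comp ((C.continuous_arrBB (d := d) α β (V := C.B α ∩ C.B β) Set.inter_subset_left
        Set.inter_subset_right).comp (f := fun z : {y : Punctured pt // (y : S) ∈ C.B α ∧
          (y : S) ∈ C.B β} => (⟨(z : Punctured pt), z.2⟩ : ↥(C.B α ∩ C.B β))) (by fun_prop))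
  · unfold valBB; congr

theorem continuousOn_valBD (hF : Continuous F) (α : ι) (j : Fin n) :
    ContinuousOn (valBD F α j) {z | C.proj d j z ∈ C.B α} := by
  classical
  refine (continuousOn_dite (p := fun z => C.proj d j z ∈ C.B α)
    (fun z h => F (C.arrBD d α j z h)) 1 ?_).congr fun z _ => ?_
  · exact hF.comp (C.continuous_arrBD (d := d) α j)
  · unfold valBD; congr

theorem map_arrBB_mul (hF : τ.IsTwisted F) (hτ : C.TrivialOnPunctured τ) {y : S} (hα : y ∈ C.B α)
    (hβ : y ∈ C.B β) (hγ : y ∈ C.B γ) :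
    F (C.arrBB d α β y hα hβ) * F (C.arrBB d β γ y hβ hγ) = F (C.arrBB d α γ y hα hγ) := by
  have h := hF.map_mul (C.arrBB d α β y hα hβ) (C.arrBB d β γ y hβ hγ) rfl
  rw [arrBB_mul, hτ _ _ rfl ⟨rfl, rfl⟩ ⟨rfl, rfl⟩] at h
  simpa using h.symm

theorem map_arrBD (hF : τ.IsTwisted F) (hα : C.proj d j z ∈ C.B α) (hβ : C.proj d j z ∈ C.B β) :
    valBD F α j z = F (C.arrBB d α β _ hα hβ) * valBD F β j z * (C.tauBBD τ α β j z : G) := by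
  have h := hF.map_mul (C.arrBB d α β _ hα hβ) (C.arrBD d β j z hβ) rfl
  rw [arrBB_mul_arrBD] at h
  rw [valBD_eq hα, valBD_eq hβ, tauBBD_eq τ hα hβ, h]

variable [DiscreteTopology G]

/-- Local constancy and connectedness of the disc reduce every rotation to one at the centre. -/
theorem map_arrRot_eq (hF : τ.IsTwisted F) (z : Disc) (k : ℕ) :
    F (C.arrRot d j z k) = F (C.arrRot d j origin k) :=
  PreconnectedSpace.constant (f := fun z => F (C.arrRot d j z k)) inferInstance
    (hF.continuous.comp (C.continuous_arrRot (d := d) j k))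

theorem valBD_turn (hF : τ.IsTwisted F) (k : ℕ) (hα : C.proj d j z ∈ C.B α) :
    valBD F α j (turn z (k / d j))
      = valBD F α j z * F (C.arrRot d j origin k) * (C.tauBDR τ α j k z : G) := by
  have h := hF.map_mul (C.arrBD d α j z hα) (C.arrRot d j z k) rfl
  rw [arrBD_mul_arrRot, map_arrRot_eq hF] at h
  rw [valBD_eq hα, valBD_eq (C.mem_turn k hα), tauBDR_eq τ k hα, h]

theorem map_arrRot (hF : τ.IsTwisted F) (k : ℕ) :
    F (C.arrRot d j z k) = C.powVal τ j (F (C.arrRot d j origin 1)) k := by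
  rw [map_arrRot_eq hF]
  induction k with
  | zero => rw [powVal_zero, arrRot_zero]; exact hF.map_one _
  | succ k ih =>
    have h := hF.map_mul (C.arrRot d j origin 1) (C.arrRot d j (turn origin ((1 : ℕ) / d j)) k) rfl
    rw [arrRot_mul, tau_arrRot, map_arrRot_eq hF (turn _ _), ih, ← powVal_one_add] at h
    rw [add_comm]; exact h

/-- The d-fold rotation is a unit arrow. This is the source of the power relation in the set of
tuples. -/
theorem powVal_map_arrRot (hF : τ.IsTwisted F) :
    C.powVal τ j (F (C.arrRot d j origin 1)) (d j) = 1 := by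
  rw [← map_arrRot hF (z := origin), C.arrRot_congr j _ (rootLabel_self (d j)), arrRot_zero]
  exact hF.map_one _

theorem map_arrRot_pow (hF : τ.IsTwisted F) :
    F (C.arrRot d j origin 1) ^ (d j : ℕ) * (C.holPt τ j : G) = 1 := by
  have h := powVal_map_arrRot (j := j) hF
  rwa [powVal, holPow_self] at h

/-- The values of a twisted function over the punctured surface. -/
def localSystem (hF : τ.IsTwisted F) (hτ : C.TrivialOnPunctured τ) :
    LocalSystem (Punctured pt) ι G where
  U := C.U
  isOpen := C.isOpen_U
  cover := C.exists_mem_U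
  c := valBB F
  continuousOn := continuousOn_valBB hF.continuous
  mul α β γ y hα hβ hγ := by
    rw [valBB_eq hα hβ, valBB_eq hβ hγ, valBB_eq hα hγ]; exact map_arrBB_mul hF hτ hα hβ hγ

/-- Following the value on the arrow into the disc along the lifted circle produces F on the circle
and the twists between members; the last arrow ends one sheet further on and is brought back by the
generating rotation. The twists combine to the holonomy. -/
theorem valBD_eq_eval_circle (hF : τ.IsTwisted F) (hz : (z : ℂ) ^ (d j : ℕ) = w)
    (c : Chain C (C.circle j w) α α) :
    valBD F α j z = c.eval d F * (C.holLoop τ j w z hz c : G) * valBD F α j z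
      * F (C.arrRot d j origin 1) := by
  have tel := c.circle_telescope (τ := τ) (z := z) F (fun δ r => valBD F δ j (turn z (r / d j)))
    (fun δ => (continuousOn_valBD hF.continuous δ j).comp (continuous_turn_div z (d j)).continuousOn
      fun r hr => (proj_turn_mem hz r).mpr hr)
    (fun α β r hα hβ => by
      rw [map_arrBD hF ((proj_turn_mem hz r).mpr hα) ((proj_turn_mem hz r).mpr hβ)]
      rw [C.arrBB_congr (C.proj_turn j w z hz r)])
  have e0 : turn z (((0 : I) : ℝ) / d j) = z := by simp [turn_zero]
  have e1 : turn z (((1 : I) : ℝ) / d j) = turn z ((1 : ℕ) / d j) := by simp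
  simp only [e0, e1] at tel
  rw [valBD_turn hF 1 (start_mem_disc hz c)] at tel
  conv_lhs => rw [tel]
  rw [holLoop_eq, Subgroup.coe_mul]
  simp only [← mul_assoc]
  rw [mul_center_right_comm _ (C.tauBDR τ α j 1 z), mul_center_right_comm _ (C.tauBDR τ α j 1 z),
    mul_center_right_comm _ (C.tauBDR τ α j 1 z)]

end Twisted

end GoodCover
end

/-! ### Gauge transformations, monodromy on the generators, and normalisation -/

noncomputable section

open scoped IsMulCommutative

namespace LocalSystem

variable {Y : Type u} {ι : Type v} {G : Type w} [TopologicalSpace Y]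
    [TopologicalSpace G] [Group G] [DiscreteTopology G] {x y : Y}

theorem transport_symm (L : LocalSystem Y ι G) (γ : Path x y) {α β : ι} (hx : x ∈ L.U α)
    (hy : y ∈ L.U β) : L.transport γ.symm β α = (L.transport γ α β)⁻¹ := by
  rw [eq_inv_iff_mul_eq_one, ← L.transport_trans γ.symm γ hy hx hy, ← L.c_self hy,
    ← L.transport_refl hy hy]
  refine L.transport_homotopic ?_ hy hy
  have h : (γ.symm.trans γ.symm.symm).Homotopic (Path.refl y) :=
    ⟨(Path.Homotopy.reflTransSymm γ.symm).symm⟩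
  rwa [Path.symm_symm] at h

/-- Two local systems with the same monodromy are isomorphic. -/
theorem exists_gauge [PathConnectedSpace Y] (L M : LocalSystem Y ι G) (hU : M.U = L.U)
    (hj : ∀ α, ∀ y ∈ L.U α, ∀ y' ∈ L.U α, JoinedIn (L.U α) y y') {α₀ : ι} (hx : x ∈ L.U α₀)
    (hx' : x ∈ M.U α₀) (h : L.monodromy hx = M.monodromy hx') :
    ∃ φ : ι → G, (∀ α y, y ∈ L.U α → ∀ γ : Path x y,
      φ α = (L.transport γ α₀ α)⁻¹ * M.transport γ α₀ α) ∧
      ∀ α β y, y ∈ L.U α → y ∈ L.U β → L.c α β y = φ α * M.c α β y * (φ β)⁻¹ := by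
  have hM : ∀ {α y}, y ∈ L.U α → y ∈ M.U α := fun h => hU ▸ h
  have indep : ∀ α y, y ∈ L.U α → ∀ γ γ' : Path x y,
      (L.transport γ α₀ α)⁻¹ * M.transport γ α₀ α
        = (L.transport γ' α₀ α)⁻¹ * M.transport γ' α₀ α := by
    intro α y hy γ γ'
    have h1 := DFunLike.congr_fun h (GoodCover.loopClass (γ.trans γ'.symm))
    rw [monodromy_loopClass, monodromy_loopClass, L.transport_trans γ γ'.symm hx hy hx,
      M.transport_trans γ γ'.symm hx' (hM hy) hx', L.transport_symm γ' hx hy,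
      M.transport_symm γ' hx' (hM hy), eq_mul_inv_iff_mul_eq] at h1
    rw [← h1]
    group
  classical
  let p : ∀ y, Path x y := fun y => PathConnectedSpace.somePath x y
  let φ : ι → G := fun α => if h : (L.U α).Nonempty then
    (L.transport (p h.choose) α₀ α)⁻¹ * M.transport (p h.choose) α₀ α else 1
  have key : ∀ α y, y ∈ L.U α → ∀ γ : Path x y,
      φ α = (L.transport γ α₀ α)⁻¹ * M.transport γ α₀ α := by
    intro α y hy γ
    have hne : (L.U α).Nonempty := ⟨y, hy⟩
    obtain ⟨ε, hε⟩ := hj α _ hne.choose_spec y hy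
    rw [indep α y hy γ ((p hne.choose).trans ε),
      L.transport_trans _ ε hx hne.choose_spec hy, L.transport_of_subset ε hε,
      M.transport_trans _ ε hx' (hM hne.choose_spec) (hM hy),
      M.transport_of_subset ε (fun r => hM (hε r)), mul_one, mul_one]
    exact dif_pos hne
  refine ⟨φ, key, fun α β y hα hβ => ?_⟩
  have aux : ∀ N : LocalSystem Y ι G, x ∈ N.U α₀ → y ∈ N.U α → y ∈ N.U β →
      N.transport (p y) α₀ β = N.transport (p y) α₀ α * N.c α β y := by
    intro N h0 h1 h2
    rw [← N.transport_refl h1 h2, ← N.transport_trans _ _ h0 h1 h2]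
    exact N.transport_homotopic ⟨(Path.Homotopy.transRefl (p y)).symm⟩ h0 h2
  rw [key α y hα (p y), key β y hβ (p y), aux L hx hα hβ, aux M hx' (hM hα) (hM hβ)]
  group

end LocalSystem

theorem List.prod_ofFn_conj {G : Type*} [Group G] {N : ℕ} (f : ℕ → G) (a : Fin N → G) :
    (List.ofFn fun k : Fin N => f k * a k * (f (k + 1))⁻¹).prod
      = f 0 * (List.ofFn a).prod * (f N)⁻¹ := by
  induction N generalizing f with
  | zero => simp
  | succ N ih =>
    have := ih (fun k => f (k + 1)) (fun k => a k.succ)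
    simp only [List.ofFn_succ, List.prod_cons, Fin.val_zero, Fin.val_succ, zero_add] at this ⊢
    rw [this]
    group

namespace GoodCover

open TopGroupoid (BandedGerbe Cochain1)

variable {S : Type u} [TopologicalSpace S] [ChartedSpace ℂ S] {n : ℕ}
  {pt : Fin n → S} {ι : Type v} {d : Fin n → ℕ+} {G : Type w} [Group G] [TopologicalSpace G]
  [DiscreteTopology G] {C : GoodCover pt ι} {τ : BandedGerbe (C.groupoid d) G} {g : ℕ}

theorem Chain.eval_conj {H : Type*} [Group H] {x y : Punctured pt} {γ : Path x y} {α β : ι} (c : Chain C γ α β)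
    {F F' : (C.groupoid d).Arr → H} (f : ι → H) (h : ∀ α β y hα hβ,
      F (C.arrBB d α β y hα hβ) = f α * F' (C.arrBB d α β y hα hβ) * (f β)⁻¹) :
    c.eval d F = f α * c.eval d F' * (f β)⁻¹ := by
  have := List.prod_ofFn_conj (fun k => f (c.idx k)) (fun k => F' (c.arr d k))
  simp only [c.idx_zero, c.idx_last] at this
  rw [eval, eval, ← this]
  congr 2
  funext k
  exact h _ _ _ _ _

namespace GeneratorSystem

open Classical in
/-- A member of the cover that contains the base point; it is `base_idx` unless there are no
generators. -/
def idx (Λ : C.GeneratorSystem g) : ι :=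
  if Λ.base ∈ C.U Λ.base_idx then Λ.base_idx else (C.exists_mem_U Λ.base).choose

theorem base_mem (Λ : C.GeneratorSystem g) : Λ.base ∈ C.U Λ.idx := by
  unfold idx
  split_ifs with h
  · exact h
  · exact (C.exists_mem_U Λ.base).choose_spec

theorem idx_eq (Λ : C.GeneratorSystem g) {y : Punctured pt} {γ : Path Λ.base y} {α : ι}
    (c : Chain C γ Λ.base_idx α) : Λ.idx = Λ.base_idx := if_pos c.start_mem

variable (Λ : C.GeneratorSystem g) {z : Fin n → Disc}

/-- The loop `L j` around a marked point. -/
abbrev loop (j : Fin n) : Path Λ.base Λ.base :=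
  (Λ.l j).trans ((C.circle j (Λ.w j)).trans (Λ.l j).symm)

section Monodromy

variable (L : LocalSystem (Punctured pt) ι G) {F : (C.groupoid d).Arr → G}

theorem monodromy_a (hU : L.U = C.U) (hF : ∀ α β (y : Punctured pt) hα hβ,
      F (C.arrBB d α β y hα hβ) = L.c α β y) (hx : Λ.base ∈ L.U Λ.idx) (i : Fin g) :
    L.monodromy hx (loopClass (Λ.a i)) = (Λ.chain_a i).eval d F := by
  rw [(Λ.chain_a i).eval_eq_transport L hU hF, L.monodromy_loopClass, Λ.idx_eq (Λ.chain_a i)]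

theorem monodromy_b (hU : L.U = C.U) (hF : ∀ α β (y : Punctured pt) hα hβ,
      F (C.arrBB d α β y hα hβ) = L.c α β y) (hx : Λ.base ∈ L.U Λ.idx) (i : Fin g) :
    L.monodromy hx (loopClass (Λ.b i)) = (Λ.chain_b i).eval d F := by
  rw [(Λ.chain_b i).eval_eq_transport L hU hF, L.monodromy_loopClass, Λ.idx_eq (Λ.chain_b i)]

theorem monodromy_loop (hU : L.U = C.U) (hF : ∀ α β (y : Punctured pt) hα hβ,
      F (C.arrBB d α β y hα hβ) = L.c α β y) (hx : Λ.base ∈ L.U Λ.idx) (j : Fin n) :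
    L.monodromy hx (loopClass (Λ.loop j))
    = (Λ.chain_l j).eval d F * (Λ.chain_circle j).eval d F * ((Λ.chain_l j).eval d F)⁻¹ := by
  have h1 : C.circlePt j (Λ.w j) ∈ L.U (Λ.end_idx j) := by
    rw [hU]; exact (Λ.chain_circle j).start_mem
  rw [(Λ.chain_l j).eval_eq_transport L hU hF, (Λ.chain_circle j).eval_eq_transport L hU hF,
    L.monodromy_loopClass]
  rw [L.transport_trans _ _ hx h1 hx, L.transport_trans _ _ h1 h1 hx,
    L.transport_symm _ hx h1, Λ.idx_eq (Λ.chain_l j), mul_assoc]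

end Monodromy

theorem end_mem (hz : ∀ j, (z j : ℂ) ^ (d j : ℕ) = Λ.w j) (j : Fin n) : C.proj d j (z j) ∈ C.B (Λ.end_idx j) :=
  start_mem_disc (hz j) (Λ.chain_circle j)

variable {Λ} {hz : ∀ j, (z j : ℂ) ^ (d j : ℕ) = Λ.w j} {F F' : (C.groupoid d).Arr → G}

theorem normalised_iff {H : Type*} [Group H] {F : (C.groupoid d).Arr → H} : Λ.Normalised d F z hz ↔
    ∀ j, (Λ.chain_l j).eval d F = (valBD F (Λ.end_idx j) j (z j))⁻¹ := by
  refine forall_congr' fun j => ?_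
  rw [← mul_eq_one_iff_eq_inv, valBD_eq (Λ.end_mem hz j)]

/-- Normalisation says that conjugation by F(l_j) is conjugation by the inverse of the value on the
arrow into the disc, which turns the relation of `valBD_eq_eval_circle` into a formula for F(L_j) in
terms of σ_j alone. -/
theorem Normalised.monodromy_loop (hN : Λ.Normalised d F z hz) (hF : τ.IsTwisted F)
    (j : Fin n) :
    (Λ.chain_l j).eval d F * (Λ.chain_circle j).eval d F * ((Λ.chain_l j).eval d F)⁻¹
      = (F (C.arrRot d j origin 1))⁻¹
        * ((C.holLoop τ j (Λ.w j) (z j) (hz j) (Λ.chain_circle j))⁻¹ : Subgroup.center G) := by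
  have h := valBD_eq_eval_circle hF (hz j) (Λ.chain_circle j)
  rw [normalised_iff.mp hN j, inv_inv]
  rw [mul_center_right_comm, mul_center_right_comm] at h
  rw [InvMemClass.coe_inv, eq_mul_inv_iff_mul_eq, eq_inv_iff_mul_eq_one, mul_center_right_comm]
  simp only [mul_assoc] at h ⊢
  rw [← h, inv_mul_cancel]

/-- The relation between the values of a normalised twisted function on the generators. -/
theorem Normalised.prod_commutator (hN : Λ.Normalised d F z hz) (hF : τ.IsTwisted F)
    (hτ : C.TrivialOnPunctured τ) :
    (List.ofFn fun i => ⁅(Λ.chain_a i).eval d F, (Λ.chain_b i).eval d F⁆).prod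
      = ((List.ofFn fun j => C.holLoop τ j (Λ.w j) (z j) (hz j) (Λ.chain_circle j)).prod :
          Subgroup.center G)
        * (List.ofFn fun j => F (C.arrRot d j origin 1)).reverse.prod := by
  set L := localSystem hF hτ
  have hL : ∀ α β (y : Punctured pt) hα hβ, F (C.arrBB d α β y hα hβ) = L.c α β y :=
    fun _ _ _ hα hβ => (valBB_eq hα hβ).symm
  -- Only the fact that the surface word is a relation is needed here; its sufficiency enters when a
  -- representation is constructed.
  have hk := Λ.ker_eq.ge (Subgroup.subset_normalClosure rfl)
  rw [MonoidHom.mem_ker] at hk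
  have hx : Λ.base ∈ L.U Λ.idx := Λ.base_mem
  have h2 := congrArg (L.monodromy hx) hk
  simp only [surfaceWord, map_mul, map_list_prod, List.map_ofFn, Function.comp_def,
    map_commutatorElement, FreeGroup.lift_apply_of, Sum.elim_inl, Sum.elim_inr, map_one,
    Λ.monodromy_a L rfl hL, Λ.monodromy_b L rfl hL, Λ.monodromy_loop L rfl hL,
    hN.monodromy_loop hF, List.prod_ofFn_mul_center] at h2
  rw [mul_eq_one_iff_eq_inv, mul_inv_rev, List.prod_inv_reverse] at h2
  rw [h2]
  congr 1
  · rw [← InvMemClass.coe_inv, List.prod_inv]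
    simp [List.map_ofFn, Function.comp_def]
  · simp [List.map_ofFn, Function.comp_def]

/-- Every twisted function is equivalent to a normalised one. -/
theorem exists_normalised {H : Type*} [Group H] [TopologicalSpace H] (Λ : C.GeneratorSystem g)
    (hz : ∀ j, (z j : ℂ) ^ (d j : ℕ) = Λ.w j) (F : (C.groupoid d).Arr → H) :
    ∃ (φ : C.Obj → H) (F' : (C.groupoid d).Arr → H), Continuous φ ∧
      (∀ q, F' q = φ ((C.groupoid d).src q) * F q * (φ ((C.groupoid d).tgt q))⁻¹) ∧
      Λ.Normalised d F' z hz := by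
  -- A gauge by `k j` on the disc alone multiplies the value on the arrow into the disc by `(k j)⁻¹`
  -- on the right and leaves F(l_j) unchanged.
  let k : Fin n → H := fun j => (Λ.chain_l j).eval d F * valBD F (Λ.end_idx j) j (z j)
  let φ : C.Obj → H := Sum.elim (fun _ => 1) fun p => k p.1
  refine ⟨φ, fun q => φ ((C.groupoid d).src q) * F q * (φ ((C.groupoid d).tgt q))⁻¹, ?_,
    fun _ => rfl, ?_⟩
  · refine continuous_sum_dom.mpr ⟨continuous_const, ?_⟩
    exact (continuous_of_discreteTopology (f := k)).comp continuous_fst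
  · intro j
    rw [(Λ.chain_l j).eval_conj (F' := F) (fun _ => 1) fun _ _ _ _ _ => rfl]
    have : k j = (Λ.chain_l j).eval d F * valBD F (Λ.end_idx j) j (z j) := rfl
    rw [valBD_eq (Λ.end_mem hz j)] at this
    change 1 * _ * 1⁻¹ * (1 * _ * (k j)⁻¹) = 1
    rw [this]
    group

theorem exists_turn_eq {N : ℕ+} {z z' : Disc} (h : (z : ℂ) ^ (N : ℕ) = (z' : ℂ) ^ (N : ℕ))
    (h0 : (z' : ℂ) ≠ 0) : ∃ k : ℕ, z = turn z' (k / N) := by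
  obtain ⟨k, hk⟩ := exists_eq_rootLabel (N := N) (ζ := z / z') (by
    rw [div_pow, h, div_self (pow_ne_zero _ h0)])
  refine ⟨k, Subtype.ext ?_⟩
  rw [div_eq_iff h0] at hk
  exact hk

/-- Equivalent normalised twisted functions have conjugate tuples. -/
theorem Normalised.tuple_conj {z' : Fin n → Disc} {hz' : ∀ j, (z' j : ℂ) ^ (d j : ℕ) = Λ.w j}
    (hN : Λ.Normalised d F z hz) (hN' : Λ.Normalised d F' z' hz') (hF' : τ.IsTwisted F')
    {φ : C.Obj → G} (hφ : Continuous φ)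
    (h : ∀ q, F q = φ ((C.groupoid d).src q) * F' q * (φ ((C.groupoid d).tgt q))⁻¹) :
    ∃ k : G, (∀ i, (Λ.tuple d F).a i = k * (Λ.tuple d F').a i * k⁻¹) ∧
      (∀ i, (Λ.tuple d F).b i = k * (Λ.tuple d F').b i * k⁻¹) ∧
      ∀ j, (Λ.tuple d F).c j = k * (Λ.tuple d F').c j * k⁻¹ := by
  have hne : ∀ α, (C.B α).Nonempty := fun α => C.piece_nonempty (.inl α)
  let f : ι → G := fun α => φ (.inl ⟨α, (hne α).choose, (hne α).choose_spec⟩)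
  have hf : ∀ α y (hy : y ∈ C.B α), φ (.inl ⟨α, y, hy⟩) = f α := by
    intro α y hy
    have : ContractibleSpace (C.B α) := C.contractible_one (.inl α)
    exact PreconnectedSpace.constant (f := fun y : C.B α => φ (.inl ⟨α, y⟩)) inferInstance
      (hφ.comp (continuous_inl.comp continuous_sigmaMk)) (x := ⟨y, hy⟩)
  have hD : ∀ j z, φ (.inr (j, z)) = φ (.inr (j, origin)) := fun j z =>
    PreconnectedSpace.constant (f := fun z : Disc => φ (.inr (j, z))) inferInstance
      (hφ.comp (continuous_inr.comp (by fun_prop)))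
  have hB : ∀ α β y hα hβ, F (C.arrBB d α β y hα hβ)
      = f α * F' (C.arrBB d α β y hα hβ) * (f β)⁻¹ := by
    intro α β y hα hβ
    rw [h, ← hf α y hα, ← hf β y hβ]
    rfl
  refine ⟨f Λ.base_idx, fun i => (Λ.chain_a i).eval_conj f hB,
    fun i => (Λ.chain_b i).eval_conj f hB, fun j => ?_⟩
  have hmem := Λ.end_mem hz j
  have hmem' := Λ.end_mem hz' j
  have e1 := normalised_iff.mp hN j
  rw [(Λ.chain_l j).eval_conj f hB, normalised_iff.mp hN' j, valBD_eq hmem, h] at e1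
  -- The two normalisations may use different points over the end of l_j; these differ by a
  -- rotation.
  obtain ⟨k, hk⟩ := exists_turn_eq ((hz j).trans (hz' j).symm) (C.ne_zero_of_proj_mem d hmem')
  have e2 := valBD_turn hF' k hmem'
  rw [← hk, valBD_eq hmem, ← map_arrRot_eq hF' origin, map_arrRot hF'] at e2
  have e3 : φ ((C.groupoid d).src (C.arrBD d (Λ.end_idx j) j (z j) hmem)) = f (Λ.end_idx j) :=
    hf _ _ _
  have e4 : φ ((C.groupoid d).tgt (C.arrBD d (Λ.end_idx j) j (z j) hmem)) = φ (.inr (j, origin)) :=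
    hD _ _
  rw [e3, e4, e2] at e1
  have e5 : F (C.arrRot d j origin 1)
      = φ (.inr (j, origin)) * F' (C.arrRot d j origin 1) * (φ (.inr (j, origin)))⁻¹ := by
    refine (h _).trans ?_
    congr 2
    exact hD _ _
  change F (C.arrRot d j origin 1) = f Λ.base_idx * F' (C.arrRot d j origin 1) * (f Λ.base_idx)⁻¹
  rw [e5]
  generalize F' (C.arrRot d j origin 1) = x at *
  -- Comparing the two normalisations, the gauge on the disc is that at the base times a power of
  -- σ_j and a central element. The last two commute with σ_j, so the same element conjugates all
  -- entries of the tuple.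
  have e6 : φ (.inr (j, origin)) = f Λ.base_idx * (x ^ k *
      ((C.holPow τ j k * C.tauBDR τ (Λ.end_idx j) j k (z' j) : Subgroup.center G) : G)) := by
    rw [powVal, eq_inv_iff_mul_eq_one, ← mul_assoc, mul_inv_eq_one] at e1
    rw [← e1, Subgroup.coe_mul]
    group
  have e7 : ∀ t : Subgroup.center G, x ^ k * (t : G) * x = x * (x ^ k * (t : G)) := fun t => by
    rw [mul_center_right_comm, ← pow_succ, pow_succ', mul_assoc]
  rw [e6, mul_inv_rev, mul_assoc (f _) _ x, e7]
  group

end GeneratorSystem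

end GoodCover
end

/-! ### Normalised functions with conjugate tuples are equivalent -/

noncomputable section

open scoped IsMulCommutative

namespace GoodCover

open TopGroupoid (BandedGerbe Cochain1)

variable {S : Type u} [TopologicalSpace S] [ChartedSpace ℂ S] {n : ℕ}
  {pt : Fin n → S} {ι : Type v} {d : Fin n → ℕ+} {G : Type w} [Group G] [TopologicalSpace G]
  [DiscreteTopology G] {C : GoodCover pt ι} {τ : BandedGerbe (C.groupoid d) G} {g : ℕ}

/-- The pull-back of a local system to the universal cover of a punctured disc, twisted by the
cocycle: its sections extend the local system to the arrows that end in the disc. -/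
def discSystem (hτ : C.TrivialOnPunctured τ) (L : LocalSystem (Punctured pt) ι G)
    (hU : L.U = C.U) (j : Fin n) : LocalSystem HalfPlane ι G where
  U α := {u | C.proj d j (expDisc u) ∈ C.B α}
  isOpen α := (C.isOpen_B α).preimage ((C.continuous_proj d j).comp continuous_expDisc)
  cover u := C.exists_mem_U (C.projH d j u)
  c α β u := L.c α β (C.projH d j u) * (C.tauBBD τ α β j (expDisc u) : G)
  continuousOn α β := by
    have h1 : ContinuousOn (fun u => L.c α β (C.projH d j u))
        {u | C.proj d j (expDisc u) ∈ C.B α ∧ C.proj d j (expDisc u) ∈ C.B β} :=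
      (L.continuousOn α β).comp (C.projH d j).continuous.continuousOn
        fun u hu => by rw [hU]; exact hu
    have h2 : ContinuousOn (fun u => C.tauBBD τ α β j (expDisc u))
        {u | C.proj d j (expDisc u) ∈ C.B α ∧ C.proj d j (expDisc u) ∈ C.B β} :=
      (continuousOn_tauBBD τ α β j).comp continuous_expDisc.continuousOn fun u hu => hu
    exact (continuous_of_discreteTopology (f := fun p : G × Subgroup.center G =>
      p.1 * (p.2 : G))).comp_continuousOn (h1.prodMk h2)
  mul α β γ u hα hβ hγ := by
    rw [tauBBD_trans hτ hα hβ hγ, Subgroup.coe_mul, ← L.mul α β γ (C.projH d j u)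
      (by rw [hU]; exact hα) (by rw [hU]; exact hβ) (by rw [hU]; exact hγ), ← mul_assoc,
      mul_center_right_comm, ← mul_assoc]

theorem localSystem_U {H : Type*} [Group H] [TopologicalSpace H]
    {τ : BandedGerbe (C.groupoid d) H} {F : (C.groupoid d).Arr → H} (hF : τ.IsTwisted F)
    (hτ : C.TrivialOnPunctured τ) : (localSystem hF hτ).U = C.U := rfl

/-- The values of F on the arrows into a disc are, seen on the half-plane, nothing but a section of
the twisted system; hence they are determined by a single one of them. -/
theorem isSection_valBD {F : (C.groupoid d).Arr → G} (hF : τ.IsTwisted F)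
    (hτ : C.TrivialOnPunctured τ) (j : Fin n) :
    (discSystem hτ (localSystem hF hτ) (localSystem_U hF hτ) j).IsSection fun α u => valBD F α j (expDisc u) := by
  refine ⟨fun α => (continuousOn_valBD hF.continuous α j).comp continuous_expDisc.continuousOn
    fun u hu => hu, fun α β u hα hβ => ?_⟩
  change valBD F α j (expDisc u) = valBB F α β (C.projH d j u) * _ * valBD F β j (expDisc u)
  rw [map_arrBD hF hα hβ, mul_center_right_comm]
  congr 2
  exact (valBB_eq (y := C.projH d j u) hα hβ).symm

namespace GeneratorSystem

variable {Λ : C.GeneratorSystem g} {z : Fin n → Disc}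
  {hz : ∀ j, (z j : ℂ) ^ (d j : ℕ) = Λ.w j} {F F' : (C.groupoid d).Arr → G}

/-- Normalised twisted functions with the same tuple are equivalent. -/
theorem Normalised.exists_gauge_of_tuple_eq [PreconnectedSpace S] (hN : Λ.Normalised d F z hz)
    (hN' : Λ.Normalised d F' z hz) (hF : τ.IsTwisted F) (hF' : τ.IsTwisted F')
    (hτ : C.TrivialOnPunctured τ) (h : Λ.tuple d F = Λ.tuple d F') :
    ∃ φ : C.Obj → G, Continuous φ ∧
      ∀ q, F q = φ ((C.groupoid d).src q) * F' q * (φ ((C.groupoid d).tgt q))⁻¹ := by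
  have ha : ∀ i, (Λ.chain_a i).eval d F = (Λ.chain_a i).eval d F' :=
    fun i => congrArg (fun t => t.a i) h
  have hb : ∀ i, (Λ.chain_b i).eval d F = (Λ.chain_b i).eval d F' :=
    fun i => congrArg (fun t => t.b i) h
  have hc : ∀ j, F (C.arrRot d j origin 1) = F' (C.arrRot d j origin 1) :=
    fun j => congrArg (fun t => t.c j) h
  set L := localSystem hF hτ with hL
  set M := localSystem hF' hτ with hM
  have hLc : ∀ α β (y : Punctured pt) hα hβ, F (C.arrBB d α β y hα hβ) = L.c α β y :=
    fun _ _ _ hα hβ => (valBB_eq hα hβ).symm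
  have hMc : ∀ α β (y : Punctured pt) hα hβ, F' (C.arrBB d α β y hα hβ) = M.c α β y :=
    fun _ _ _ hα hβ => (valBB_eq hα hβ).symm
  have hx : Λ.base ∈ L.U Λ.idx := Λ.base_mem
  have hx' : Λ.base ∈ M.U Λ.idx := Λ.base_mem
  -- The monodromies agree on the generators: directly on a_i and b_i, and on L_j because
  -- normalisation expresses it through σ_j.
  have hmon : L.monodromy hx = M.monodromy hx' := by
    rw [← MonoidHom.cancel_right Λ.surjective]
    refine FreeGroup.ext_hom _ _ ?_
    rintro (i | i | j)
    · simp only [MonoidHom.comp_apply, FreeGroup.lift_apply_of, Sum.elim_inl]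
      rw [Λ.monodromy_a L rfl hLc, Λ.monodromy_a M rfl hMc, ha]
    · simp only [MonoidHom.comp_apply, FreeGroup.lift_apply_of, Sum.elim_inl, Sum.elim_inr]
      rw [Λ.monodromy_b L rfl hLc, Λ.monodromy_b M rfl hMc, hb]
    · simp only [MonoidHom.comp_apply, FreeGroup.lift_apply_of, Sum.elim_inr]
      rw [Λ.monodromy_loop L rfl hLc, Λ.monodromy_loop M rfl hMc, hN.monodromy_loop hF,
        hN'.monodromy_loop hF', hc]
  have := C.pathConnectedSpace_punctured Λ.base
  obtain ⟨f, hf1, hf2⟩ := L.exists_gauge M rfl C.joinedIn_U hx hx' hmon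
  have hBB : ∀ α β y hα hβ, F (C.arrBB d α β y hα hβ)
      = f α * F' (C.arrBB d α β y hα hβ) * (f β)⁻¹ := fun α β y hα hβ => by
    have := hf2 α β ⟨y, C.B_subset hα⟩ hα hβ
    rwa [← hLc α β _ hα hβ, ← hMc α β _ hα hβ] at this
  have hBD : ∀ α j u, C.proj d j u ∈ C.B α → valBD F α j u = f α * valBD F' α j u := by
    intro α j v hv
    have hend := Λ.end_mem hz j
    obtain ⟨u, rfl⟩ := exists_expDisc v (C.ne_zero_of_proj_mem d hv)
    obtain ⟨u₀, hu₀⟩ := exists_expDisc (z j) (C.ne_zero_of_proj_mem d hend)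
    have s1 := isSection_valBD hF hτ j
    -- Transporting the values of F' by the gauge f gives a second section of the same system; two
    -- sections over the half-plane agree if they agree at one place.
    have s2 : (discSystem hτ (localSystem hF hτ) (localSystem_U hF hτ) j).IsSection
        fun α u => f α * valBD F' α j (expDisc u) := by
      refine ⟨fun α => ?_, fun α β u hα hβ => ?_⟩
      · exact (continuous_of_discreteTopology (f := fun x => f α * x)).comp_continuousOn
          ((isSection_valBD hF' hτ j).1 α)
      · have e1 : valBD F' α j (expDisc u) = M.c α β (C.projH d j u)
            * (C.tauBBD τ α β j (expDisc u) : G) * valBD F' β j (expDisc u) :=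
          (isSection_valBD hF' hτ j).2 α β u hα hβ
        have e2 := hf2 α β (C.projH d j u) hα hβ
        change f α * valBD F' α j (expDisc u) = L.c α β (C.projH d j u)
          * (C.tauBBD τ α β j (expDisc u) : G) * (f β * valBD F' β j (expDisc u))
        rw [e1, e2, mul_center_right_comm, mul_center_right_comm]
        group
    have e := s1.div_eq s2 (α := α) (β := Λ.end_idx j) (x := u) (y := u₀) hv
      (show C.proj d j (expDisc u₀) ∈ _ by rw [hu₀]; exact hend)
    beta_reduce at e
    rw [hu₀] at e
    -- The place of comparison is the arrow at the end of l_j, where f is the quotient of the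
    -- transports along l_j and both transports are known from normalisation.
    have e0 : f (Λ.end_idx j) = valBD F (Λ.end_idx j) j (z j)
        * (valBD F' (Λ.end_idx j) j (z j))⁻¹ := by
      have := hf1 (Λ.end_idx j) (C.circlePt j (Λ.w j)) (Λ.chain_circle j).start_mem (Λ.l j)
      rw [Λ.idx_eq (Λ.chain_l j), ← (Λ.chain_l j).eval_eq_transport L rfl hLc,
        ← (Λ.chain_l j).eval_eq_transport M rfl hMc, normalised_iff.mp hN j,
        normalised_iff.mp hN' j, inv_inv] at this
      exact this
    rw [e0] at e
    have e3 : (valBD F α j (expDisc u))⁻¹ * (f α * valBD F' α j (expDisc u)) = 1 := by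
      rw [e]; group
    rw [inv_mul_eq_one] at e3
    exact e3
  -- No gauge is needed on the discs: both functions are normalised at the same points and take the
  -- same values on rotations.
  refine ⟨Sum.elim (fun p => f p.1) fun _ => 1, ?_, fun q => ?_⟩
  · refine continuous_sum_dom.mpr ⟨?_, continuous_const⟩
    exact continuous_sigma (f := fun p : Σ α, C.B α => f p.1) fun α =>
      show Continuous fun _ => f α from continuous_const
  · have hq : ∀ α j z (h : C.proj d j z ∈ C.B α), F (C.arrBD d α j z h)
        = f α * F' (C.arrBD d α j z h) := fun α j z h => by
      rw [← valBD_eq (F := F) h, ← valBD_eq (F := F') h, hBD α j z h]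
    rcases C.arr_cases q with ⟨α, β, y, hα, hβ, rfl⟩ | ⟨α, j, z, h, rfl⟩ | ⟨α, j, z, h, rfl⟩ |
      ⟨j, z, k, rfl⟩
    · exact hBB α β y hα hβ
    · rw [hq]
      change _ = f α * _ * 1⁻¹
      simp
    · rw [hF.map_inv, hF'.map_inv, hq]
      change _ = 1 * _ * (f α)⁻¹
      rw [← InvMemClass.coe_inv, one_mul, mul_center_right_comm, mul_inv_rev]
    · rw [map_arrRot hF, map_arrRot hF', hc]
      change _ = 1 * _ * 1⁻¹
      simp

/-- Normalised twisted functions with conjugate tuples are equivalent. -/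
theorem Normalised.exists_gauge [PreconnectedSpace S] (hN : Λ.Normalised d F z hz)
    (hN' : Λ.Normalised d F' z hz) (hF : τ.IsTwisted F) (hF' : τ.IsTwisted F')
    (hτ : C.TrivialOnPunctured τ) {k : G}
    (ha : ∀ i, (Λ.tuple d F).a i = k * (Λ.tuple d F').a i * k⁻¹)
    (hb : ∀ i, (Λ.tuple d F).b i = k * (Λ.tuple d F').b i * k⁻¹)
    (hc : ∀ j, (Λ.tuple d F).c j = k * (Λ.tuple d F').c j * k⁻¹) :
    ∃ φ : C.Obj → G, Continuous φ ∧
      ∀ q, F q = φ ((C.groupoid d).src q) * F' q * (φ ((C.groupoid d).tgt q))⁻¹ := by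
  -- A constant gauge conjugates the whole tuple and preserves normalisation, which reduces the
  -- claim to equal tuples.
  let F'' : (C.groupoid d).Arr → G := fun q => k * F' q * k⁻¹
  have hF'' : τ.IsTwisted F'' := hF'.conj (φ := fun _ => k) continuous_const fun _ => rfl
  have hev : ∀ {x y : Punctured pt} {γ : Path x y} {α β : ι} (c : Chain C γ α β),
      c.eval d F'' = k * c.eval d F' * k⁻¹ :=
    fun c => c.eval_conj (fun _ => k) fun _ _ _ _ _ => rfl
  have hN'' : Λ.Normalised d F'' z hz := fun j => by
    have := hN' j
    rw [hev]
    change _ * (k * F' _ * k⁻¹) = 1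
    rw [eq_inv_of_mul_eq_one_left this]
    group
  obtain ⟨φ, hφ, h⟩ := hN.exists_gauge_of_tuple_eq hN'' hF hF'' hτ (by
    have h1 : (Λ.tuple d F).a = (Λ.tuple d F'').a := funext fun i => (ha i).trans (hev _).symm
    have h2 : (Λ.tuple d F).b = (Λ.tuple d F'').b := funext fun i => (hb i).trans (hev _).symm
    have h3 : (Λ.tuple d F).c = (Λ.tuple d F'').c := funext fun i => hc i
    exact (Tuple.mk.injEq _ _ _ _ _ _).mpr ⟨h1, h2, h3⟩)
  refine ⟨fun x => φ x * k, (continuous_of_discreteTopology (f := fun x => x * k)).comp hφ,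
    fun q => ?_⟩
  rw [h]
  simp only [F'']
  group

end GeneratorSystem

end GoodCover
end

/-! ### Extending a local system to the arrows into a disc -/

noncomputable section

open scoped IsMulCommutative

namespace GoodCover

open TopGroupoid (BandedGerbe Cochain1)

/-- Translation of the half-plane by `2 π i t`. -/
def shift (u : HalfPlane) (t : ℝ) : HalfPlane :=
  ⟨u + 2 * Real.pi * t * Complex.I, by simpa using u.2⟩

theorem expDisc_shift (u : HalfPlane) (t : ℝ) : expDisc (shift u t) = turn (expDisc u) t := by
  refine Subtype.ext ?_
  simp only [expDisc, shift, turn]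
  rw [Complex.exp_add, mul_comm]

theorem shift_shift (u : HalfPlane) (s t : ℝ) : shift (shift u s) t = shift u (s + t) := by
  refine Subtype.ext ?_
  simp only [shift]
  push_cast
  ring

theorem shift_zero (u : HalfPlane) : shift u 0 = u := Subtype.ext (by simp [shift])

theorem continuous_shift : Continuous fun p : HalfPlane × ℝ => shift p.1 p.2 := by
  unfold shift; fun_prop

theorem exists_eq_shift {u v : HalfPlane} (h : expDisc u = expDisc v) : ∃ k : ℤ, u = shift v k := by
  obtain ⟨k, hk⟩ := Complex.exp_eq_exp_iff_exists_int.mp (congrArg Subtype.val h)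
  refine ⟨k, Subtype.ext ?_⟩
  rw [hk]
  simp only [shift]
  push_cast
  ring

/-- Needed so that continuity upstairs on the half-plane descends to the punctured disc. -/
theorem isOpenMap_expDisc : IsOpenMap expDisc := by
  intro V hV
  have h1 : IsOpen (Complex.exp '' (Subtype.val '' V)) :=
    Complex.isOpenMap_exp _ ((isOpen_lt Complex.continuous_re continuous_const).isOpenMap_subtype_val _ hV)
  have h2 : expDisc '' V = Subtype.val ⁻¹' (Complex.exp '' (Subtype.val '' V)) := by
    ext z
    constructor
    · rintro ⟨u, hu, rfl⟩
      exact ⟨u, ⟨u, hu, rfl⟩, rfl⟩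
    · rintro ⟨_, ⟨u, hu, rfl⟩, h⟩
      exact ⟨u, hu, Subtype.ext h⟩
  rw [h2]
  exact h1.preimage continuous_subtype_val

variable {S : Type u} [TopologicalSpace S] [ChartedSpace ℂ S] {n : ℕ}
  {pt : Fin n → S} {ι : Type v} {d : Fin n → ℕ+} {G : Type w} [Group G] [TopologicalSpace G]
  [DiscreteTopology G] {C : GoodCover pt ι} {τ : BandedGerbe (C.groupoid d) G}

/-- The values on the arrows over the punctured surface of a local system. -/
def systemVal (L : LocalSystem (Punctured pt) ι G) : (C.groupoid d).Arr → G
  | ⟨(.inl a, .inl b, _), _⟩ => L.c a.1 b.1 ⟨a.2, C.B_subset a.2.2⟩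
  | _ => 1

section Disc

variable {hτ : C.TrivialOnPunctured τ} {L : LocalSystem (Punctured pt) ι G} {hU : L.U = C.U}
  {j : Fin n} {s : ι → HalfPlane → G}

theorem proj_shift (u : HalfPlane) (k : ℕ) :
    C.proj d j (expDisc (shift u (k / d j))) = C.proj d j (expDisc u) := by
  rw [expDisc_shift, proj_turn_div]

theorem projH_shift (u : HalfPlane) (k : ℕ) : C.projH d j (shift u (k / d j)) = C.projH d j u :=
  Subtype.ext (proj_shift u k)

/-- Translation to the next sheet changes the twist by the factors in `tauBBD_mul_tauBDR`; dividing
by `tauBDR` restores the section condition. -/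
theorem isSection_shift (hs : (discSystem hτ L hU j).IsSection s) :
    (discSystem hτ L hU j).IsSection fun α u => s α (shift u ((1 : ℕ) / d j))
      * ((C.tauBDR τ α j 1 (expDisc u))⁻¹ : Subgroup.center G) := by
  refine ⟨fun α => ?_, fun α β u hα hβ => ?_⟩
  · have h1 : ContinuousOn (fun u => s α (shift u ((1 : ℕ) / d j)))
        ((discSystem hτ L hU j).U α) :=
      (hs.1 α).comp (continuous_shift.comp (continuous_id.prodMk continuous_const)).continuousOn
        fun u hu => by
          change C.proj d j (expDisc (shift u _)) ∈ C.B α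
          rw [proj_shift]; exact hu
    have h2 : ContinuousOn (fun u => C.tauBDR τ α j 1 (expDisc u)) ((discSystem hτ L hU j).U α) :=
      (continuousOn_tauBDR τ α j 1).comp continuous_expDisc.continuousOn fun u hu => hu
    exact (continuous_of_discreteTopology (f := fun p : G × Subgroup.center G =>
      p.1 * ((p.2⁻¹ : Subgroup.center G) : G))).comp_continuousOn (h1.prodMk h2)
  · have e : s α (shift u ((1 : ℕ) / d j)) = L.c α β (C.projH d j (shift u ((1 : ℕ) / d j)))
        * (C.tauBBD τ α β j (expDisc (shift u ((1 : ℕ) / d j))) : G)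
        * s β (shift u ((1 : ℕ) / d j)) :=
      hs.2 α β _ (by change C.proj d j (expDisc (shift u _)) ∈ C.B α; rw [proj_shift]; exact hα)
        (by change C.proj d j (expDisc (shift u _)) ∈ C.B β; rw [proj_shift]; exact hβ)
    have h := tauBBD_mul_tauBDR (τ := τ) 1 hα hβ
    rw [projH_shift, expDisc_shift] at e
    change s α (shift u ((1 : ℕ) / d j)) * _ = L.c α β (C.projH d j u)
        * (C.tauBBD τ α β j (expDisc u) : G) * _
    rw [e]
    have h' : C.tauBBD τ α β j (turn (expDisc u) ((1 : ℕ) / d j)) * (C.tauBDR τ α j 1 (expDisc u))⁻¹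
        = (C.tauBDR τ β j 1 (expDisc u))⁻¹ * C.tauBBD τ α β j (expDisc u) := by
      rw [mul_comm (_)⁻¹, ← div_eq_mul_inv, ← div_eq_mul_inv, div_eq_div_iff_mul_eq_mul, h, mul_comm]
    have h'' := congrArg (Subtype.val) h'
    rw [Subgroup.coe_mul, Subgroup.coe_mul] at h''
    rw [mul_center_right_comm, mul_assoc, h'', mul_center_right_comm]
    simp only [mul_assoc]

/-- The section and its corrected translate differ by a constant right factor. At `u₀` this factor
is found by telescoping around the lifted circle, and the hypothesis on the transport is arranged to
make it x. -/
theorem section_shift (hs : (discSystem hτ L hU j).IsSection s) {w : PDisc} {u₀ : HalfPlane} {α₀ : ι}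
    (hz : (expDisc u₀ : ℂ) ^ (d j : ℕ) = w) (c : Chain C (C.circle j w) α₀ α₀) {x : G}
    (hx : L.transport (C.circle j w) α₀ α₀ = s α₀ u₀ * x⁻¹
      * ((C.holLoop τ j w (expDisc u₀) hz c)⁻¹ : Subgroup.center G) * (s α₀ u₀)⁻¹)
    {α : ι} {u : HalfPlane} (hu : C.proj d j (expDisc u) ∈ C.B α) :
    s α (shift u ((1 : ℕ) / d j)) = s α u * x * (C.tauBDR τ α j 1 (expDisc u) : G) := by
  have hsv : ∀ α β (y : Punctured pt) hα hβ,
      systemVal L (C.arrBB d α β y hα hβ) = L.c α β y := fun _ _ _ _ _ => rfl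
  have e := hs.div_eq (isSection_shift hs) hu (start_mem_disc hz c)
  beta_reduce at e
  have tel := c.circle_telescope (τ := τ) (z := expDisc u₀) (systemVal (d := d) L)
    (fun δ r => s δ (shift u₀ (r / d j)))
    (fun δ => (hs.1 δ).comp (continuous_shift.comp (f := fun r : I => (u₀, (r : ℝ) / d j))
      (by fun_prop)).continuousOn fun r hr => by
        change C.proj d j (expDisc (shift u₀ _)) ∈ C.B δ
        rw [expDisc_shift]; exact (proj_turn_mem hz r).mpr hr)
    (fun α β r hα hβ => by
      have h1 : C.proj d j (expDisc (shift u₀ (r / d j))) = C.circle j w r := by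
        rw [expDisc_shift, C.proj_turn j w _ hz]
      have h2 : s α (shift u₀ (r / d j)) = L.c α β (C.projH d j (shift u₀ (r / d j)))
          * (C.tauBBD τ α β j (expDisc (shift u₀ (r / d j))) : G) * s β (shift u₀ (r / d j)) :=
        hs.2 α β _ (by change C.proj d j (expDisc _) ∈ C.B α; rw [h1]; exact hα)
          (by change C.proj d j (expDisc _) ∈ C.B β; rw [h1]; exact hβ)
      have h3 : C.projH d j (shift u₀ (r / d j)) = C.circle j w r := Subtype.ext h1
      rw [h2, hsv, h3, mul_center_right_comm, expDisc_shift])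
  have e0 : shift u₀ (((0 : I) : ℝ) / d j) = u₀ := by simp [shift_zero]
  have e1 : shift u₀ (((1 : I) : ℝ) / d j) = shift u₀ ((1 : ℕ) / d j) := by simp
  simp only [e0, e1] at tel
  rw [c.eval_eq_transport L hU hsv, hx, holLoop_eq] at tel
  have key : (s α₀ u₀)⁻¹ * (s α₀ (shift u₀ ((1 : ℕ) / d j))
      * ((C.tauBDR τ α₀ j 1 (expDisc u₀))⁻¹ : Subgroup.center G)) = x := by
    generalize s α₀ (shift u₀ ((1 : ℕ) / d j)) = b at *
    generalize C.tauBDR τ α₀ j 1 (expDisc u₀) = t at *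
    generalize (List.ofFn (circleVal τ j (expDisc u₀) c)).prod = q at *
    generalize s α₀ u₀ = a at *
    rw [mul_center_right_comm _ (t * q)⁻¹ a⁻¹, mul_assoc _ _ (q : G), ← Subgroup.coe_mul,
      mul_inv_rev, mul_comm q⁻¹, inv_mul_cancel_right, mul_center_right_comm _ t⁻¹ b] at tel
    have := congrArg (fun y => x * a⁻¹ * y) tel
    simpa [mul_assoc] using this.symm
  rw [key, ← mul_assoc, InvMemClass.coe_inv, mul_inv_eq_iff_eq_mul, inv_mul_eq_iff_eq_mul] at e
  rw [e, mul_assoc]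

theorem section_shift_nat {x : G}
    (h1 : ∀ α u, C.proj d j (expDisc u) ∈ C.B α →
      s α (shift u ((1 : ℕ) / d j)) = s α u * x * (C.tauBDR τ α j 1 (expDisc u) : G))
    (k : ℕ) {α : ι} {u : HalfPlane} (hu : C.proj d j (expDisc u) ∈ C.B α) :
    s α (shift u (k / d j)) = s α u * C.powVal τ j x k * (C.tauBDR τ α j k (expDisc u) : G) := by
  induction k with
  | zero => rw [powVal_zero, tauBDR_zero hu]; simp [shift_zero]
  | succ k ih =>
    have e : shift u ((k + 1 : ℕ) / d j) = shift (shift u (k / d j)) ((1 : ℕ) / d j) := by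
      rw [shift_shift]; congr 1; push_cast; ring
    have hm := congrArg Subtype.val (tauBDR_mul_tauBDR (τ := τ) k 1 hu)
    rw [Subgroup.coe_mul, Subgroup.coe_mul] at hm
    rw [e, h1 α _ (by rw [proj_shift]; exact hu), ih, expDisc_shift, powVal_add, powVal_one,
      mul_center_right_comm, mul_assoc _ (Subtype.val _), hm]
    simp only [mul_assoc]

/-- Translation by 2πi is the d-fold passage to the next sheet, which multiplies by `powVal` at d,
that is, by 1. So the section is invariant under the deck group of the exponential map. -/
theorem section_shift_int {x : G}
    (h1 : ∀ α u, C.proj d j (expDisc u) ∈ C.B α →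
      s α (shift u ((1 : ℕ) / d j)) = s α u * x * (C.tauBDR τ α j 1 (expDisc u) : G))
    (hx : C.powVal τ j x (d j) = 1) {α : ι} {u v : HalfPlane}
    (hu : C.proj d j (expDisc u) ∈ C.B α) (h : expDisc u = expDisc v) : s α u = s α v := by
  have nat : ∀ (k : ℕ) (u : HalfPlane), C.proj d j (expDisc u) ∈ C.B α →
      s α (shift u k) = s α u := by
    intro k u hu
    have e := section_shift_nat h1 (k * d j) hu
    have hl : rootLabel (d j) (k * d j) = rootLabel (d j) 0 := by
      rw [rootLabel_eq_pow, mul_comm, pow_mul, (isPrimitiveRoot_rootLabel (d j)).pow_eq_one, one_pow,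
        rootLabel_zero]
    rw [powVal_congr hx hl, tauBDR_congr hl hu, tauBDR_zero hu, powVal_zero] at e
    have hd : ((d j : ℕ) : ℝ) ≠ 0 := Nat.cast_ne_zero.mpr (d j).ne_zero
    rw [Nat.cast_mul, mul_div_cancel_right₀ _ hd] at e
    simpa using e
  obtain ⟨k, rfl⟩ := exists_eq_shift h
  obtain ⟨m, rfl | rfl⟩ := k.eq_nat_or_neg
  · rw [Int.cast_natCast]
    exact nat m v (by rw [← h]; exact hu)
  · have := nat m _ hu
    rw [shift_shift] at this
    rw [← this]
    simp [shift_zero]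

/-- Extension of a local system to the arrows that end in the disc `𝔇 j`. -/
theorem exists_discExtension (hτ : C.TrivialOnPunctured τ) (L : LocalSystem (Punctured pt) ι G)
    (hU : L.U = C.U) {x : G} (hx : C.powVal τ j x (d j) = 1) {w : PDisc} {z : Disc}
    (hz : (z : ℂ) ^ (d j : ℕ) = w) {α₀ : ι} (c : Chain C (C.circle j w) α₀ α₀) (K₀ : G)
    (hK : L.transport (C.circle j w) α₀ α₀ = K₀ * x⁻¹
      * ((C.holLoop τ j w z hz c)⁻¹ : Subgroup.center G) * K₀⁻¹) :
    ∃ K : ι → Disc → G, K α₀ z = K₀ ∧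
      (∀ α, ContinuousOn (K α) {z | C.proj d j z ∈ C.B α}) ∧
      (∀ α β (y : Punctured pt) z, C.proj d j z = y → (y : S) ∈ C.B α → (y : S) ∈ C.B β →
        K α z = L.c α β y * K β z * (C.tauBBD τ α β j z : G)) ∧
      ∀ α z (k : ℕ), C.proj d j z ∈ C.B α →
        K α (turn z (k / d j)) = K α z * C.powVal τ j x k * (C.tauBDR τ α j k z : G) := by
  classical
  have hmem := start_mem_disc hz c
  obtain ⟨u₀, rfl⟩ := exists_expDisc z (C.ne_zero_of_proj_mem d hmem)
  obtain ⟨s₀, hs₀⟩ := (discSystem hτ L hU j).exists_section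
  -- Right multiplication by a constant preserves sections and allows the value at `u₀` to be
  -- prescribed.
  obtain ⟨s, hs, hs1⟩ : ∃ s, (discSystem hτ L hU j).IsSection s ∧ s α₀ u₀ = K₀ := by
    refine ⟨fun α u => s₀ α u * ((s₀ α₀ u₀)⁻¹ * K₀), ⟨fun α => ?_, fun α β u hα hβ => ?_⟩, ?_⟩
    · exact (continuous_of_discreteTopology (f := fun g => g * ((s₀ α₀ u₀)⁻¹ * K₀))).comp_continuousOn
        (hs₀.1 α)
    · beta_reduce
      rw [hs₀.2 α β u hα hβ, mul_assoc]
    · simp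
  rw [← hs1] at hK ⊢
  have h1 := fun α u => section_shift hs hz c hK (α := α) (u := u)
  -- The section is evaluated at any logarithm of z. The default value occurs only at the centre,
  -- which lies over no point of any `B α`.
  let K : ι → Disc → G := fun α z => if h : ∃ u, expDisc u = z then s α h.choose else 1
  have hKs : ∀ α u, C.proj d j (expDisc u) ∈ C.B α → K α (expDisc u) = s α u := by
    intro α u hu
    have h : ∃ v, expDisc v = expDisc u := ⟨u, rfl⟩
    exact (dif_pos h).trans (section_shift_int h1 hx (by rw [h.choose_spec]; exact hu)
      h.choose_spec)
  refine ⟨K, hKs _ _ hmem, fun α => ?_, fun α β y z hy hα hβ => ?_, fun α z k hα => ?_⟩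
  · intro z hz
    obtain ⟨u, rfl⟩ := exists_expDisc z (C.ne_zero_of_proj_mem d hz)
    refine ContinuousAt.continuousWithinAt ?_
    have ho := (discSystem hτ L hU j).isOpen α
    have hc : ContinuousAt (s α) u := (hs.1 α).continuousAt (ho.mem_nhds hz)
    have hev : ∀ᶠ v in nhds u, s α v = K α (expDisc v) :=
      Filter.mem_of_superset (ho.mem_nhds hz) fun v hv => (hKs α v hv).symm
    have ht : Filter.Tendsto (fun v => K α (expDisc v)) (nhds u) (nhds (K α (expDisc u))) := by
      rw [hKs α u hz]
      exact Filter.Tendsto.congr' hev hc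
    -- Openness of the exponential map bounds the neighbourhoods of its value by images of
    -- neighbourhoods of u.
    exact Filter.Tendsto.mono_left (Filter.tendsto_map'_iff.mpr ht) (isOpenMap_expDisc.nhds_le u)
  · obtain ⟨u, rfl⟩ := exists_expDisc z (C.ne_zero_of_proj_mem d (hy ▸ hα))
    have hα' : C.proj d j (expDisc u) ∈ C.B α := hy ▸ hα
    have hβ' : C.proj d j (expDisc u) ∈ C.B β := hy ▸ hβ
    rw [hKs α u hα', hKs β u hβ']
    have e : s α u = L.c α β (C.projH d j u) * (C.tauBBD τ α β j (expDisc u) : G) * s β u :=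
      hs.2 α β u hα' hβ'
    rw [e, mul_center_right_comm]
    have : C.projH d j u = y := Subtype.ext hy
    rw [this]
  · obtain ⟨u, rfl⟩ := exists_expDisc z (C.ne_zero_of_proj_mem d hα)
    rw [← expDisc_shift, hKs α u hα, hKs α _ (by rw [proj_shift]; exact hα),
      section_shift_nat h1 k hα]

end Disc

end GoodCover
end

/-! ### Multiplicativity and inverse arrows; the glued function -/

noncomputable section

open scoped IsMulCommutative

namespace TopGroupoid.BandedGerbe

variable {Q : TopGroupoid.{u', v'}} {G : Type w} [Group G] [TopologicalSpace G]

/-- The function `F` is twisted-multiplicative on the pair `(q, r)`. -/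
def IsMulAt (τ : BandedGerbe Q G) (F : Q.Arr → G) (q r : Q.Arr) (h : Q.tgt q = Q.src r) : Prop :=
  F (Q.mul q r h) = F q * F r * (τ.tau q r h : G)

variable {τ : BandedGerbe Q G} {F : Q.Arr → G}

theorem mul_mul_inv {q r : Q.Arr} (h : Q.tgt q = Q.src r) :
    Q.mul (Q.mul q r h) (Q.inv r) ((Q.tgt_mul q r h).trans (Q.src_inv r).symm) = q := by
  rw [Q.mul_assoc q r (Q.inv r) h (Q.src_inv r).symm]
  conv_rhs => rw [← Q.mul_one q]
  congr 1
  rw [Q.mul_inv, h]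

theorem inv_mul_mul {q r : Q.Arr} (h : Q.tgt q = Q.src r) :
    Q.mul (Q.inv q) (Q.mul q r h) ((Q.tgt_inv q).trans (Q.src_mul q r h).symm) = r := by
  rw [← Q.mul_assoc (Q.inv q) q r (Q.tgt_inv q) h]
  conv_rhs => rw [← Q.one_mul r]
  congr 1
  rw [Q.inv_mul, h]

/-- Since q = (qr)r⁻¹, multiplicativity there can be solved for F(qr). The cocycle identity for q,
r, r⁻¹ matches the central factors. -/
theorem IsMulAt.of_mul_inv {q r : Q.Arr} (h : Q.tgt q = Q.src r)
    (hr : F (Q.inv r) = (F r)⁻¹ * ((τ.tau r (Q.inv r) (Q.src_inv r).symm : Subgroup.center G) : G)⁻¹)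
    (hqr : τ.IsMulAt F (Q.mul q r h) (Q.inv r) ((Q.tgt_mul q r h).trans (Q.src_inv r).symm)) :
    τ.IsMulAt F q r h := by
  rw [IsMulAt, mul_mul_inv, hr] at hqr
  have hc := τ.cocycle q r (Q.inv r) h (Q.src_inv r).symm
  have h1 : τ.tau q (Q.mul r (Q.inv r) (Q.src_inv r).symm) (h.trans (Q.src_mul _ _ _).symm) = 1 := by
    refine (τ.tau_congr rfl ?_ _).trans (τ.one_right q)
    rw [Q.mul_inv, h]
  rw [h1, _root_.mul_one] at hc
  rw [IsMulAt, hqr, ← hc]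
  generalize τ.tau q r h = a
  generalize τ.tau (Q.mul q r h) (Q.inv r) _ = b
  rw [← InvMemClass.coe_inv, _root_.mul_assoc _ _ (b : G), _root_.mul_assoc _ _ (b : G),
    ← Subgroup.coe_mul, _root_.mul_inv_rev, _root_.mul_comm b⁻¹, inv_mul_cancel_right]
  rw [← _root_.mul_assoc, GoodCover.mul_center_right_comm, InvMemClass.coe_inv,
    inv_mul_cancel_right, inv_mul_cancel_right]

/-- The mirror image, from r = q⁻¹(qr) and the cocycle identity for q⁻¹, q, r. -/
theorem IsMulAt.of_inv_mul {q r : Q.Arr} (h : Q.tgt q = Q.src r)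
    (hq : F (Q.inv q) = (F q)⁻¹ * ((τ.tau q (Q.inv q) (Q.src_inv q).symm : Subgroup.center G) : G)⁻¹)
    (hqr : τ.IsMulAt F (Q.inv q) (Q.mul q r h) ((Q.tgt_inv q).trans (Q.src_mul q r h).symm)) :
    τ.IsMulAt F q r h := by
  rw [IsMulAt, inv_mul_mul, hq] at hqr
  have hc := τ.cocycle (Q.inv q) q r (Q.tgt_inv q) h
  have h1 : τ.tau (Q.mul (Q.inv q) q (Q.tgt_inv q)) r ((Q.tgt_mul _ _ _).trans h) = 1 := by
    refine (τ.tau_congr ?_ rfl _).trans (τ.one_left r)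
    rw [Q.inv_mul, h]
  rw [h1, _root_.mul_one, tau_inv] at hc
  rw [IsMulAt, hqr, hc]
  generalize τ.tau q r h = a
  generalize τ.tau (Q.inv q) (Q.mul q r h) _ = b
  rw [← InvMemClass.coe_inv, GoodCover.mul_center_right_comm, _root_.mul_assoc _ _ (b : G),
    ← Subgroup.coe_mul, _root_.mul_inv_rev, _root_.mul_comm b⁻¹, inv_mul_cancel_right]
  rw [← _root_.mul_assoc, InvMemClass.coe_inv, inv_mul_cancel_right, mul_inv_cancel_left]

end TopGroupoid.BandedGerbe

namespace GoodCover

open TopGroupoid (BandedGerbe Cochain1)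

variable {S : Type u} [TopologicalSpace S] [ChartedSpace ℂ S] {n : ℕ}
  {pt : Fin n → S} {ι : Type v} {d : Fin n → ℕ+} {G : Type w} [Group G] [TopologicalSpace G]
  {C : GoodCover pt ι} {τ : BandedGerbe (C.groupoid d) G}

/-- An exponent with a given root of unity as label. -/
def rootExp (N : ℕ+) (ζ : ℂ) : ℕ := Classical.epsilon fun k => ζ = rootLabel N k

theorem rootLabel_rootExp (N : ℕ+) (k : ℕ) : rootLabel N (rootExp N (rootLabel N k)) = rootLabel N k :=
  (Classical.epsilon_spec (p := fun i => rootLabel N k = rootLabel N i) ⟨k, rfl⟩).symm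

/-- The point of the surface under an object of the groupoid. -/
def objProj (C : GoodCover pt ι) (d : Fin n → ℕ+) : C.Obj → S :=
  Sum.elim (fun a => a.2) fun p => C.proj d p.1 p.2

/-- The point of the disc, for an object in one of the discs. -/
def discPt (C : GoodCover pt ι) : C.Obj → Disc := Sum.elim (fun _ => origin) Prod.snd

theorem continuous_objProj (C : GoodCover pt ι) (d : Fin n → ℕ+) : Continuous (C.objProj d) := by
  refine continuous_sum_dom.mpr ⟨continuous_sigma fun α => continuous_subtype_val, ?_⟩
  refine continuous_prod_of_discrete_left.mpr fun j => C.continuous_proj d j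

theorem continuous_discPt (C : GoodCover pt ι) : Continuous C.discPt :=
  continuous_sum_dom.mpr ⟨continuous_const, continuous_snd⟩

/-- The function on arrows given by a local system over the punctured surface, its extensions `K`
to the discs, and the values `x` on the generators of the stabilisers. -/
def glue (τ : BandedGerbe (C.groupoid d) G) (L : LocalSystem (Punctured pt) ι G)
    (K : Fin n → ι → Disc → G) (x : Fin n → G) : (C.groupoid d).Arr → G
  | ⟨(.inl a, .inl b, _), _⟩ => L.c a.1 b.1 ⟨a.2, C.B_subset a.2.2⟩
  | ⟨(.inl a, .inr (j, z), _), _⟩ => K j a.1 z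
  | ⟨(.inr (j, z), .inl a, ζ), h⟩ => (K j a.1 z)⁻¹ *
    ((τ.tau ((C.groupoid d).inv ⟨(.inr (j, z), .inl a, ζ), h⟩) ⟨(.inr (j, z), .inl a, ζ), h⟩
      ((C.groupoid d).tgt_inv _) : Subgroup.center G) : G)⁻¹
  | ⟨(.inr (j, _), .inr _, ζ), _⟩ => C.powVal τ j (x j) (rootExp (d j) ζ)

section Glue

variable {L : LocalSystem (Punctured pt) ι G} {K : Fin n → ι → Disc → G} {x : Fin n → G}

theorem glue_arrBD {α : ι} {j : Fin n} {z : Disc} (h : C.proj d j z ∈ C.B α) :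
    glue τ L K x (C.arrBD d α j z h) = K j α z := rfl

theorem glue_arrRot (hx : ∀ j, C.powVal τ j (x j) (d j) = 1) (j : Fin n) (z : Disc) (k : ℕ) :
    glue τ L K x (C.arrRot d j z k) = C.powVal τ j (x j) k :=
  powVal_congr (hx j) (rootLabel_rootExp (d j) k)

theorem inv_inv_arr (q : (C.groupoid d).Arr) :
    (C.groupoid d).inv ((C.groupoid d).inv q) = q :=
  Subtype.ext (Prod.ext rfl (Prod.ext rfl (inv_inv _)))

theorem glue_inv_arrBD {α : ι} {j : Fin n} {z : Disc} (h : C.proj d j z ∈ C.B α) :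
    glue τ L K x ((C.groupoid d).inv (C.arrBD d α j z h)) = (K j α z)⁻¹ *
      ((τ.tau (C.arrBD d α j z h) ((C.groupoid d).inv (C.arrBD d α j z h)) rfl :
        Subgroup.center G) : G)⁻¹ := by
  change (K j α z)⁻¹ * ((τ.tau ((C.groupoid d).inv ((C.groupoid d).inv (C.arrBD d α j z h))) _ _ :
    Subgroup.center G) : G)⁻¹ = _
  congr 3
  exact τ.tau_congr (inv_inv_arr _) rfl _

/-- The arrows decompose into open pieces according to the members in which their ends lie, and on
each piece only one clause of the definition applies. -/
theorem continuous_glue [DiscreteTopology G] (hU : L.U = C.U)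
    (hK : ∀ j α, ContinuousOn (K j α) {z | C.proj d j z ∈ C.B α}) :
    Continuous (glue τ L K x) := by
  let P : (ι ⊕ Fin n) × (ι ⊕ Fin n) → Set (C.groupoid d).Arr := fun p =>
    {q | C.cls q.1.1 = p.1 ∧ C.cls q.1.2.1 = p.2}
  have hP : ∀ p, IsOpen (P p) := fun p =>
    ((C.isLocallyConstant_cls.comp_continuous (C.groupoid d).continuous_src).isOpen_fiber p.1).inter
      ((C.isLocallyConstant_cls.comp_continuous (C.groupoid d).continuous_tgt).isOpen_fiber p.2)
  have hPP : ∀ q, q ∈ P (C.cls q.1.1, C.cls q.1.2.1) := fun q => ⟨rfl, rfl⟩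
  suffices h : ∀ p, ContinuousOn (glue τ L K x) (P p) from
    continuous_iff_continuousAt.mpr fun q => (h _).continuousAt ((hP _).mem_nhds (hPP q))
  have hsrc : ∀ p, Continuous fun q : P p => (C.groupoid d).src q := fun p =>
    (C.groupoid d).continuous_src.comp continuous_subtype_val
  have htgt : ∀ p, Continuous fun q : P p => (C.groupoid d).tgt q := fun p =>
    (C.groupoid d).continuous_tgt.comp continuous_subtype_val
  rintro ⟨α | j, β | k⟩ <;> rw [continuousOn_iff_continuous_domRestrict]
  · have hm : ∀ q : P (.inl α, .inl β), C.objProj d ((C.groupoid d).src q) ∈ C.B α ∧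
        C.objProj d ((C.groupoid d).src q) ∈ C.B β := by
      rintro ⟨⟨⟨a | a, b | b, ζ⟩, hq⟩, h1, h2⟩
      · obtain rfl : a.1 = α := Sum.inl_injective h1
        obtain rfl : b.1 = β := Sum.inl_injective h2
        refine ⟨a.2.2, ?_⟩
        have : (a.2 : S) = b.2 := hq.1
        change (a.2 : S) ∈ _
        rw [this]; exact b.2.2
      · cases h2
      · cases h1
      · cases h1
    have := (L.continuousOn α β).comp_continuous (f := fun q : P (.inl α, .inl β) =>
      (⟨C.objProj d ((C.groupoid d).src q), C.B_subset (hm q).1⟩ : Punctured pt))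
      (((C.continuous_objProj d).comp (hsrc _)).subtype_mk _) (fun q => by rw [hU]; exact hm q)
    refine this.congr ?_
    rintro ⟨⟨⟨a | a, b | b, ζ⟩, hq⟩, h1, h2⟩
    · obtain rfl : a.1 = α := Sum.inl_injective h1
      obtain rfl : b.1 = β := Sum.inl_injective h2
      rfl
    · cases h2
    · cases h1
    · cases h1
  · have hm : ∀ q : P (.inl α, .inr k), C.proj d k (C.discPt ((C.groupoid d).tgt q)) ∈ C.B α := by
      rintro ⟨⟨⟨a | a, b | ⟨j, z⟩, ζ⟩, hq⟩, h1, h2⟩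
      · cases h2
      · obtain rfl : a.1 = α := Sum.inl_injective h1
        obtain rfl : j = k := Sum.inr_injective h2
        have : (a.2 : S) = C.proj d j z := hq.1
        change C.proj d j z ∈ _
        rw [← this]; exact a.2.2
      · cases h1
      · cases h1
    have := (hK k α).comp_continuous (f := fun q : P (.inl α, .inr k) =>
      C.discPt ((C.groupoid d).tgt q)) (C.continuous_discPt.comp (htgt _)) hm
    refine this.congr ?_
    rintro ⟨⟨⟨a | a, b | ⟨j, z⟩, ζ⟩, hq⟩, h1, h2⟩
    · cases h2
    · obtain rfl : a.1 = α := Sum.inl_injective h1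
      obtain rfl : j = k := Sum.inr_injective h2
      rfl
    · cases h1
    · cases h1
  · have hm : ∀ q : P (.inr j, .inl β), C.proj d j (C.discPt ((C.groupoid d).src q)) ∈ C.B β := by
      rintro ⟨⟨⟨a | ⟨k, z⟩, b | b, ζ⟩, hq⟩, h1, h2⟩
      · cases h1
      · cases h1
      · obtain rfl : b.1 = β := Sum.inl_injective h2
        obtain rfl : k = j := Sum.inr_injective h1
        have : (b.2 : S) = C.proj d k z := hq.1
        change C.proj d k z ∈ _
        rw [← this]; exact b.2.2
      · cases h2
    have h1 := (hK j β).comp_continuous (f := fun q : P (.inr j, .inl β) =>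
      C.discPt ((C.groupoid d).src q)) (C.continuous_discPt.comp (hsrc _)) hm
    have h2 := tau_continuous_comp τ (f := fun q : P (.inr j, .inl β) => (C.groupoid d).inv q)
      (g := fun q => q) ((C.groupoid d).continuous_inv.comp continuous_subtype_val)
      continuous_subtype_val fun q => (C.groupoid d).tgt_inv _
    have := (continuous_of_discreteTopology (f := fun p : G × Subgroup.center G =>
      p.1⁻¹ * (p.2 : G)⁻¹)).comp (h1.prodMk h2)
    refine this.congr ?_
    rintro ⟨⟨⟨a | ⟨k, z⟩, b | b, ζ⟩, hq⟩, h1, h2⟩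
    · cases h1
    · cases h1
    · obtain rfl : b.1 = β := Sum.inl_injective h2
      obtain rfl : k = j := Sum.inr_injective h1
      rfl
    · cases h2
  -- On arrows within a disc the label ranges over a finite, hence discrete, set, so the arbitrary
  -- choice of exponent does no harm to continuity.
  · have hfin : Finite {ζ : ℂ // ζ ^ (d j : ℕ) = 1} := by
      have := (Polynomial.nthRootsFinset (d j) (1 : ℂ)).finite_toSet
      refine Set.Finite.to_subtype (this.subset fun ζ hζ => ?_)
      exact (Polynomial.mem_nthRootsFinset (d j).pos (1 : ℂ)).mpr hζ
    have hm : ∀ q : P (.inr j, .inr k), q.1.1.2.2 ^ (d j : ℕ) = 1 := by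
      rintro ⟨⟨⟨a | ⟨i, z⟩, b | b, ζ⟩, hq⟩, h1, h2⟩
      · cases h1
      · cases h1
      · cases h2
      · obtain rfl : i = j := Sum.inr_injective h1
        exact hq.2.1
    have hlab : Continuous fun q : (C.groupoid d).Arr => q.1.2.2 :=
      show Continuous fun q : C.Arr d => q.1.2.2 by fun_prop
    have h1 : Continuous fun q : P (.inr j, .inr k) =>
        (⟨q.1.1.2.2, hm q⟩ : {ζ : ℂ // ζ ^ (d j : ℕ) = 1}) :=
      Continuous.subtype_mk (hlab.comp continuous_subtype_val) _
    have := (continuous_of_discreteTopology (f := fun ζ : {ζ : ℂ // ζ ^ (d j : ℕ) = 1} =>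
      C.powVal τ j (x j) (rootExp (d j) ζ))).comp h1
    refine this.congr ?_
    rintro ⟨⟨⟨a | ⟨i, z⟩, b | b, ζ⟩, hq⟩, h1, h2⟩
    · cases h1
    · cases h1
    · cases h2
    · obtain rfl : i = j := Sum.inr_injective h1
      rfl

end Glue

end GoodCover
end

/-! ### Multiplicativity of the glued function -/

noncomputable section

open scoped IsMulCommutative

namespace GoodCover

open TopGroupoid (BandedGerbe Cochain1)

variable {S : Type u} [TopologicalSpace S] [ChartedSpace ℂ S] {n : ℕ}
  {pt : Fin n → S} {ι : Type v} {d : Fin n → ℕ+} {G : Type w} [Group G] [TopologicalSpace G]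
  {C : GoodCover pt ι} {τ : BandedGerbe (C.groupoid d) G}

section Glue

variable {L : LocalSystem (Punctured pt) ι G} {K : Fin n → ι → Disc → G} {x : Fin n → G}

/-- Sorting composable pairs by whether their three objects lie over the punctured surface (B) or in
a disc (D), the types BBB, BBD, BDD and DDD are the hypotheses on L, K and x. The others follow by
inverting an arrow: BDB from BBD, all DB* from those starting with BD, and DDB from DBD. -/
theorem isTwisted_glue [DiscreteTopology G] (hτ : C.TrivialOnPunctured τ) (hU : L.U = C.U)
    (hx : ∀ j, C.powVal τ j (x j) (d j) = 1)
    (hK : ∀ j α, ContinuousOn (K j α) {z | C.proj d j z ∈ C.B α})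
    (hK1 : ∀ j α β (y : Punctured pt) z, C.proj d j z = y → (y : S) ∈ C.B α → (y : S) ∈ C.B β →
        K j α z = L.c α β y * K j β z * (C.tauBBD τ α β j z : G))
    (hK2 : ∀ j α z (k : ℕ), C.proj d j z ∈ C.B α → K j α (turn z (k / d j))
        = K j α z * C.powVal τ j (x j) k * (C.tauBDR τ α j k z : G)) :
    τ.IsTwisted (glue τ L K x) := by
  set F := glue τ L K x with hF
  have hFrot : ∀ j z k, F (C.arrRot d j z k) = C.powVal τ j (x j) k := glue_arrRot hx
  have hFBD : ∀ α j z h, F (C.arrBD d α j z h) = K j α z := fun _ _ _ _ => rfl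
  have hLm : ∀ α β γ (y : Punctured pt), (y : S) ∈ C.B α → (y : S) ∈ C.B β → (y : S) ∈ C.B γ →
      L.c α β y * L.c β γ y = L.c α γ y := by
    intro α β γ y hα hβ hγ
    exact L.mul α β γ y (by rw [hU]; exact hα) (by rw [hU]; exact hβ) (by rw [hU]; exact hγ)
  -- multiplicativity on the pairs from which all others are obtained by inverting arrows
  have hBB : ∀ q r (h : (C.groupoid d).tgt q = (C.groupoid d).src r), ((C.groupoid d).src q).isLeft → ((C.groupoid d).tgt q).isLeft →
      τ.IsMulAt F q r h := by
    intro q r h h1 h2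
    obtain ⟨α, β, y, hα, hβ, rfl⟩ := OverPunctured.exists_eq (C := C) (q := q) ⟨h1, h2⟩
    rcases C.arr_cases r with ⟨β', γ, y', hβ', hγ, rfl⟩ | ⟨β', j, z, hz, rfl⟩ | ⟨γ, j, z, hz, rfl⟩ |
      ⟨j, z, k, rfl⟩
    · obtain ⟨rfl, rfl⟩ := arrBB_composable h
      rw [BandedGerbe.IsMulAt, arrBB_mul, hτ _ _ _ ⟨rfl, rfl⟩ ⟨rfl, rfl⟩]
      change L.c α γ ⟨y, _⟩ = L.c α β ⟨y, _⟩ * L.c β γ ⟨y, _⟩ * _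
      rw [hLm α β γ ⟨y, _⟩ hα hβ hγ]
      simp
    · obtain ⟨rfl, h3⟩ := Sigma.mk.inj (Sum.inl_injective h)
      obtain rfl : y = C.proj d j z := congrArg Subtype.val (eq_of_heq h3)
      rw [BandedGerbe.IsMulAt, arrBB_mul_arrBD]
      change K j α z = L.c α β ⟨C.proj d j z, _⟩ * K j β z * _
      rw [← tauBBD_eq τ hα hz]
      exact hK1 j α β ⟨C.proj d j z, _⟩ z rfl hα hβ
    · cases h
    · cases h
  have hBD : ∀ q r (h : (C.groupoid d).tgt q = (C.groupoid d).src r), ((C.groupoid d).src q).isLeft → ((C.groupoid d).tgt q).isRight →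
      ((C.groupoid d).tgt r).isRight → τ.IsMulAt F q r h := by
    intro q r h h1 h2 h3
    rcases C.arr_cases q with ⟨α, β, y, hα, hβ, rfl⟩ | ⟨α, j, z, hz, rfl⟩ | ⟨γ, j, z, hz, rfl⟩ |
      ⟨j, z, k, rfl⟩
    · exact Bool.noConfusion h2
    · rcases C.arr_cases r with ⟨β', γ, y', hβ', hγ, rfl⟩ | ⟨β', j', z', hz', rfl⟩ |
        ⟨γ, j', z', hz', rfl⟩ | ⟨j', z', k, rfl⟩
      · exact Bool.noConfusion h3
      · cases h
      · exact Bool.noConfusion h3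
      · obtain ⟨rfl, rfl⟩ := Prod.mk.inj (Sum.inr_injective h)
        rw [BandedGerbe.IsMulAt, arrBD_mul_arrRot, hFrot, hFBD, hFBD,
          ← tauBDR_eq τ k hz]
        exact hK2 j α z k hz
    · exact Bool.noConfusion h1
    · exact Bool.noConfusion h1
  have hDD : ∀ q r (h : (C.groupoid d).tgt q = (C.groupoid d).src r), ((C.groupoid d).src q).isRight → ((C.groupoid d).tgt q).isRight →
      ((C.groupoid d).tgt r).isRight → τ.IsMulAt F q r h := by
    intro q r h h1 h2 h3
    rcases C.arr_cases q with ⟨α, β, y, hα, hβ, rfl⟩ | ⟨α, j, z, hz, rfl⟩ | ⟨γ, j, z, hz, rfl⟩ |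
      ⟨j, z, k, rfl⟩
    · exact Bool.noConfusion h2
    · exact Bool.noConfusion h1
    · exact Bool.noConfusion h2
    · rcases C.arr_cases r with ⟨β', γ, y', hβ', hγ, rfl⟩ | ⟨β', j', z', hz', rfl⟩ |
        ⟨γ, j', z', hz', rfl⟩ | ⟨j', z', k', rfl⟩
      · exact Bool.noConfusion h3
      · cases h
      · exact Bool.noConfusion h3
      · obtain ⟨rfl, rfl⟩ := Prod.mk.inj (Sum.inr_injective h)
        rw [BandedGerbe.IsMulAt, arrRot_mul, hFrot, hFrot, hFrot,
          tau_arrRot, powVal_add]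
  have hone : ∀ a, F ((C.groupoid d).one a) = 1 := by
    rintro (⟨α, y, hy⟩ | ⟨j, z⟩)
    · have := hLm α α α ⟨y, C.B_subset hy⟩ hy hy hy
      exact mul_eq_left.mp this
    · have := hFrot j z 0
      rw [arrRot_zero, powVal_zero] at this
      exact this
  -- Where multiplicativity on (q, q⁻¹) is already known this is formal; on arrows leaving a disc it
  -- is built into the definition of `glue`.
  have hinv : ∀ q, F ((C.groupoid d).inv q) = (F q)⁻¹ *
      ((τ.tau q ((C.groupoid d).inv q) ((C.groupoid d).src_inv q).symm : Subgroup.center G) : G)⁻¹ := by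
    have of : ∀ q, τ.IsMulAt F q ((C.groupoid d).inv q) ((C.groupoid d).src_inv q).symm → F ((C.groupoid d).inv q) = (F q)⁻¹ *
        ((τ.tau q ((C.groupoid d).inv q) ((C.groupoid d).src_inv q).symm : Subgroup.center G) : G)⁻¹ := by
      intro q h
      rw [BandedGerbe.IsMulAt, (C.groupoid d).mul_inv, hone] at h
      rw [eq_mul_inv_iff_mul_eq]
      exact eq_inv_of_mul_eq_one_right ((mul_assoc _ _ _).symm.trans h.symm)
    intro q
    rcases C.arr_cases q with ⟨α, β, y, hα, hβ, rfl⟩ | ⟨α, j, z, hz, rfl⟩ | ⟨γ, j, z, hz, rfl⟩ |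
      ⟨j, z, k, rfl⟩
    · exact of _ (hBB _ _ _ rfl rfl)
    · exact glue_inv_arrBD hz
    · have h1 := glue_inv_arrBD (τ := τ) (L := L) (K := K) (x := x) hz
      have h2 : F ((C.groupoid d).inv ((C.groupoid d).inv (C.arrBD d γ j z hz))) = K j γ z :=
        congrArg F (inv_inv_arr (C.arrBD d γ j z hz))
      have h3 : τ.tau ((C.groupoid d).inv (C.arrBD d γ j z hz)) ((C.groupoid d).inv ((C.groupoid d).inv (C.arrBD d γ j z hz)))
          ((C.groupoid d).src_inv _).symm = τ.tau (C.arrBD d γ j z hz) ((C.groupoid d).inv (C.arrBD d γ j z hz)) rfl :=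
        (τ.tau_congr rfl (inv_inv_arr _) _).trans (τ.tau_inv _)
      rw [h2, h3]
      change K j γ z = (glue τ L K x _)⁻¹ * _
      rw [h1, mul_inv_rev, inv_inv, inv_inv, ← center_comm, mul_inv_cancel_right]
    · exact of _ (hDD _ _ _ rfl rfl rfl)
  have hDB : ∀ q r (h : (C.groupoid d).tgt q = (C.groupoid d).src r), ((C.groupoid d).src q).isLeft → ((C.groupoid d).tgt q).isRight →
      τ.IsMulAt F q r h := by
    intro q r h h1 h2
    rcases h3 : ((C.groupoid d).tgt r).isRight
    · exact BandedGerbe.IsMulAt.of_mul_inv h (hinv r) (hBB _ _ _ h1 (Sum.isRight_eq_false.mp h3))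
    · exact hBD q r h h1 h2 h3
  refine ⟨continuous_glue hU hK, fun q r h => ?_⟩
  change τ.IsMulAt F q r h
  have hleft : ∀ q r (h : (C.groupoid d).tgt q = (C.groupoid d).src r), ((C.groupoid d).tgt q).isLeft → τ.IsMulAt F q r h := by
    intro q r h h2
    rcases h1 : ((C.groupoid d).src q).isRight
    · exact hBB q r h (Sum.isRight_eq_false.mp h1) h2
    · exact BandedGerbe.IsMulAt.of_inv_mul h (hinv q) (hDB _ _ _ h2 h1)
  rcases h2 : ((C.groupoid d).tgt q).isRight
  · exact hleft q r h (Sum.isRight_eq_false.mp h2)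
  rcases h1 : ((C.groupoid d).src q).isRight
  · exact hDB q r h (Sum.isRight_eq_false.mp h1) h2
  rcases h3 : ((C.groupoid d).tgt r).isRight
  · exact BandedGerbe.IsMulAt.of_mul_inv h (hinv r) (hleft _ _ _ (Sum.isRight_eq_false.mp h3))
  · exact hDD q r h h1 h2 h3

end Glue

end GoodCover
end

/-! ### Every admissible tuple is realised -/

noncomputable section

open scoped IsMulCommutative

namespace GoodCover

open TopGroupoid (BandedGerbe Cochain1)

variable {S : Type u} [TopologicalSpace S] [ChartedSpace ℂ S] {n : ℕ}
  {pt : Fin n → S} {ι : Type v} {d : Fin n → ℕ+} {G : Type w} [Group G] [TopologicalSpace G]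
  {C : GoodCover pt ι} {g : ℕ}

/-- The representation of the fundamental group with given values on the generators. -/
theorem GeneratorSystem.exists_monoidHom {H : Type*} [Group H] (Λ : C.GeneratorSystem g)
    (t : Tuple H g n)
    (ht : surfaceWord t.a t.b t.c = 1) :
    ∃ ρ : (FundamentalGroup (Punctured pt) Λ.base)ᵐᵒᵖ →* H, (∀ i, ρ (loopClass (Λ.a i)) = t.a i) ∧
      (∀ i, ρ (loopClass (Λ.b i)) = t.b i) ∧ ∀ j, ρ (loopClass (Λ.loop j)) = t.c j := by
  let φ : FreeGroup (Fin g ⊕ Fin g ⊕ Fin n) →* H :=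
    FreeGroup.lift (Sum.elim t.a (Sum.elim t.b t.c))
  have hφ : (FreeGroup.lift (Sum.elim (fun i => loopClass (Λ.a i))
    (Sum.elim (fun i => loopClass (Λ.b i)) fun j => loopClass (Λ.loop j)))).ker ≤ φ.ker := by
    rw [Λ.ker_eq]
    refine Subgroup.normalClosure_le_normal (Set.singleton_subset_iff.mpr ?_)
    change φ _ = 1
    rw [← ht]
    simp only [φ, surfaceWord, map_mul, map_list_prod, List.map_ofFn, Function.comp_def,
      map_commutatorElement, FreeGroup.lift_apply_of, Sum.elim_inl, Sum.elim_inr]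
  have key := MonoidHom.liftOfRightInverse_comp_apply _ _
    (Function.rightInverse_surjInv Λ.surjective) ⟨φ, hφ⟩
  refine ⟨MonoidHom.liftOfRightInverse _ _ (Function.rightInverse_surjInv Λ.surjective) ⟨φ, hφ⟩,
    fun i => ?_, fun i => ?_, fun j => ?_⟩
  · have := key (FreeGroup.of (.inl i))
    simpa [φ] using this
  · have := key (FreeGroup.of (.inr (.inl i)))
    simpa [φ] using this
  · have := key (FreeGroup.of (.inr (.inr j)))
    simpa [φ] using this

variable [DiscreteTopology G] {τ : BandedGerbe (C.groupoid d) G}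

/-- Every tuple that satisfies the relations comes from a normalised twisted function. -/
theorem GeneratorSystem.exists_tuple_eq [PreconnectedSpace S] (Λ : C.GeneratorSystem g)
    {z : Fin n → Disc} (hz : ∀ j, (z j : ℂ) ^ (d j : ℕ) = Λ.w j) (hτ : C.TrivialOnPunctured τ)
    (t : Tuple G g n)
    (h1 : (List.ofFn fun i => ⁅t.a i, t.b i⁆).prod
      = ((List.ofFn fun j => C.holLoop τ j (Λ.w j) (z j) (hz j) (Λ.chain_circle j)).prod :
          Subgroup.center G) * (List.ofFn t.c).reverse.prod)
    (h2 : ∀ j, t.c j ^ (d j : ℕ) * (C.holPt τ j : G) = 1) :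
    ∃ F, τ.IsTwisted F ∧ Λ.Normalised d F z hz ∧ Λ.tuple d F = t := by
  have hx : ∀ j, C.powVal τ j (t.c j) (d j) = 1 := fun j => by
    rw [powVal, holPow_self, h2]
  -- The loops L_j are sent to the values forced by `Normalised.monodromy_loop`; the equation for
  -- the tuple is then exactly the surface relation.
  obtain ⟨ρ, ha, hb, hc⟩ := Λ.exists_monoidHom ⟨t.a, t.b, fun j => (t.c j)⁻¹ *
    ((C.holLoop τ j (Λ.w j) (z j) (hz j) (Λ.chain_circle j))⁻¹ : Subgroup.center G)⟩ (by
      simp only [surfaceWord, List.prod_ofFn_mul_center]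
      rw [h1, mul_eq_one_iff_eq_inv, mul_inv_rev, List.prod_inv_reverse]
      congr 1
      · rw [← InvMemClass.coe_inv, List.prod_inv]
        simp [List.map_ofFn, Function.comp_def]
      · simp [List.map_ofFn, Function.comp_def])
  dsimp only at ha hb hc
  have := C.pathConnectedSpace_punctured Λ.base
  obtain ⟨L, hU, hL⟩ := LocalSystem.exists_monodromy_eq Λ.base C.U C.isOpen_U C.exists_mem_U
    C.joinedIn_U_inter C.homotopic_of_mem_U ρ
  have hbase : Λ.base ∈ L.U Λ.idx := by rw [hU]; exact Λ.base_mem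
  have hsv : ∀ α β (y : Punctured pt) hα hβ,
      systemVal (d := d) L (C.arrBB d α β y hα hβ) = L.c α β y := fun _ _ _ _ _ => rfl
  -- The inverse of the transport along l_j plays the role of `K₀`. Prescribing it as the value on
  -- the arrow into the disc also makes the resulting function normalised.
  have hloop : ∀ j, L.transport (C.circle j (Λ.w j)) (Λ.end_idx j) (Λ.end_idx j)
      = (L.transport (Λ.l j) Λ.base_idx (Λ.end_idx j))⁻¹ * (t.c j)⁻¹
      * ((C.holLoop τ j (Λ.w j) (z j) (hz j) (Λ.chain_circle j))⁻¹ : Subgroup.center G)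
      * ((L.transport (Λ.l j) Λ.base_idx (Λ.end_idx j))⁻¹)⁻¹ := by
    intro j
    have := Λ.monodromy_loop L hU hsv hbase j
    rw [hL, hc, (Λ.chain_l j).eval_eq_transport L hU hsv,
      (Λ.chain_circle j).eval_eq_transport L hU hsv] at this
    rw [mul_assoc _ _ (Subtype.val _), this]
    group
  choose K hK0 hK hK1 hK2 using fun j => exists_discExtension hτ L hU (hx j) (hz j)
    (Λ.chain_circle j) _ (hloop j)
  have hg : ∀ α β (y : Punctured pt) hα hβ,
      glue τ L K t.c (C.arrBB d α β y hα hβ) = L.c α β y := fun _ _ _ _ _ => rfl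
  refine ⟨glue τ L K t.c, isTwisted_glue hτ hU hx hK hK1 hK2, ?_, ?_⟩
  · refine normalised_iff.mpr fun j => ?_
    rw [valBD_eq (Λ.end_mem hz j), glue_arrBD, hK0, inv_inv,
      (Λ.chain_l j).eval_eq_transport L hU hg]
  · refine (Tuple.mk.injEq _ _ _ t.a t.b t.c).mpr ⟨funext fun i => ?_, funext fun i => ?_,
      funext fun j => ?_⟩
    · rw [← Λ.monodromy_a L hU hg hbase, hL, ha]
    · rw [← Λ.monodromy_b L hU hg hbase, hL, hb]
    · rw [glue_arrRot hx, powVal_one]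

end GoodCover
end

noncomputable section

open scoped IsMulCommutative

namespace GoodCover

open TopGroupoid (BandedGerbe Cochain1)

variable {S : Type u} [TopologicalSpace S] [ChartedSpace ℂ S] {n : ℕ}
  {pt : Fin n → S} {ι : Type v} {d m : Fin n → ℕ+} {G : Type w} [Group G] [TopologicalSpace G]
  {C : GoodCover pt ι} {g : ℕ}

/-! ## Pull-back along the covering of orbifolds -/

/-- The map `z ↦ z ^ m` of the disc. -/
def powDisc (m : ℕ+) (z : Disc) : Disc := ⟨(z : ℂ) ^ (m : ℕ), pow_mem m z⟩

theorem proj_powDisc (j : Fin n) (z : Disc) :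
    C.proj d j (powDisc (m j) z) = C.proj (m * d) j z := C.proj_root d m j z

theorem rootMap_arrBB {α β : ι} {y : S} (hα : y ∈ C.B α) (hβ : y ∈ C.B β) :
    (C.rootMap d m).arr (C.arrBB (m * d) α β y hα hβ) = C.arrBB d α β y hα hβ :=
  Subtype.ext (Prod.ext rfl (Prod.ext rfl (one_pow _)))

theorem rootMap_arrBD {α : ι} {j : Fin n} {z : Disc} (h : C.proj (m * d) j z ∈ C.B α) :
    (C.rootMap d m).arr (C.arrBD (m * d) α j z h)
      = C.arrBD d α j (powDisc (m j) z) (by rw [proj_powDisc]; exact h) := by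
  refine Subtype.ext (Prod.ext ?_ (Prod.ext rfl ?_))
  · exact congrArg Sum.inl (Sigma.ext rfl (heq_of_eq (Subtype.ext (proj_powDisc j z).symm)))
  · exact congrArg (fun k => (z : ℂ) ^ k) (max_eq_right (m j).2)

theorem powDisc_turn (j : Fin n) (z : Disc) (t : ℝ) :
    powDisc (m j) (turn z (t / (m * d) j)) = turn (powDisc (m j) z) (t / d j) := by
  refine Subtype.ext ?_
  simp only [powDisc, turn]
  rw [mul_pow, ← Complex.exp_nat_mul]
  have h1 : ((m j : ℕ) : ℂ) ≠ 0 := Nat.cast_ne_zero.mpr (m j).ne_zero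
  have h2 : ((d j : ℕ) : ℂ) ≠ 0 := Nat.cast_ne_zero.mpr (d j).ne_zero
  congr 2
  push_cast [Pi.mul_apply, PNat.mul_coe]
  field_simp

theorem rootMap_arrRot {j : Fin n} {z : Disc} (k : ℕ) :
    (C.rootMap d m).arr (C.arrRot (m * d) j z k) = C.arrRot d j (powDisc (m j) z) k := by
  refine Subtype.ext (Prod.ext rfl (Prod.ext ?_ ?_))
  · exact congrArg (fun z => Sum.inr (j, z)) (powDisc_turn j z k)
  · change Complex.exp _ ^ max (m j : ℕ) (m j) = Complex.exp _
    rw [max_self, ← Complex.exp_nat_mul]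
    have h1 : ((m j : ℕ) : ℂ) ≠ 0 := Nat.cast_ne_zero.mpr (m j).ne_zero
    have h2 : ((d j : ℕ) : ℂ) ≠ 0 := Nat.cast_ne_zero.mpr (d j).ne_zero
    congr 1
    push_cast [Pi.mul_apply, PNat.mul_coe]
    field_simp

variable {τ : BandedGerbe (C.groupoid d) G}

theorem TrivialOnPunctured.pullback (hτ : C.TrivialOnPunctured τ) :
    C.TrivialOnPunctured (τ.pullback (C.rootMap d m)) := by
  intro q r h hq hr
  obtain ⟨α, β, y, hα, hβ, rfl⟩ := hq.exists_eq
  obtain ⟨β', γ, y', hβ', hγ, rfl⟩ := hr.exists_eq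
  exact hτ _ _ _ ⟨rfl, rfl⟩ ⟨rfl, rfl⟩

theorem stab_pullback (j : Fin n) (a b : ℕ) :
    C.stab (τ.pullback (C.rootMap d m)) j a b = C.stab τ j a b := by
  have h : powDisc (m j) origin = origin := Subtype.ext (zero_pow (m j).ne_zero)
  have e : ∀ k, (C.rootMap d m).arr (C.arrRot (m * d) j origin k) = C.arrRot d j origin k := by
    intro k; rw [rootMap_arrRot, h]
  exact τ.tau_congr (e a) (e b) _

/-- The generating rotation upstairs maps to the generating rotation downstairs, but has order m·d:
the product runs through m full periods. -/
theorem holPt_pullback (j : Fin n) :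
    C.holPt (τ.pullback (C.rootMap d m)) j = C.holPt τ j ^ (m j : ℕ) := by
  rw [← holPow_self, ← holPow_mul, holPow, holPow]
  refine Finset.prod_congr ?_ fun i _ => stab_pullback j 1 i
  rw [Pi.mul_apply, PNat.mul_coe]

theorem holLoop_pullback {j : Fin n} {w : PDisc} {z : Disc} (hz : (z : ℂ) ^ ((m * d) j : ℕ) = w)
    (hz' : (powDisc (m j) z : ℂ) ^ (d j : ℕ) = w) {α : ι} (c : Chain C (C.circle j w) α α) :
    C.holLoop (τ.pullback (C.rootMap d m)) j w z hz c
      = C.holLoop τ j w (powDisc (m j) z) hz' c := by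
  rw [holLoop, holLoop]
  congr 1
  · exact τ.tau_congr (rootMap_arrBD _) (rootMap_arrRot 1) _
  · congr 2
    funext k
    refine τ.tau_congr (rootMap_arrBB _ _) ((rootMap_arrBD _).trans ?_) _
    exact C.arrBD_congr (powDisc_turn j z _) _

/-- The circle and its chain are the same upstairs and downstairs. The image of the chosen point
upstairs may differ from z, but only by a rotation, which `holLoop_turn` allows. -/
theorem holLoop_pullback_eq [DiscreteTopology G] {j : Fin n} {w : PDisc} {z z' : Disc}
    (hz : (z : ℂ) ^ (d j : ℕ) = w) (hz' : (z' : ℂ) ^ ((m * d) j : ℕ) = w) {α : ι}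
    (c : Chain C (C.circle j w) α α) :
    C.holLoop (τ.pullback (C.rootMap d m)) j w z' hz' c = C.holLoop τ j w z hz c := by
  have h1 : (powDisc (m j) z' : ℂ) ^ (d j : ℕ) = w := by
    rw [← hz']; simp [powDisc, pow_mul]
  rw [holLoop_pullback hz' h1]
  obtain ⟨k, hk⟩ := GeneratorSystem.exists_turn_eq (h1.trans hz.symm) (fun h0 => by
    rw [h0, zero_pow (d j).ne_zero] at hz
    exact w.2.2 hz.symm)
  have : ∀ (y : Disc) (hy : (y : ℂ) ^ (d j : ℕ) = w), y = turn z (k / d j) →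
      C.holLoop τ j w y hy c = C.holLoop τ j w z hz c := by
    rintro _ hy rfl
    exact holLoop_turn hz c k hy
  exact this _ h1 hk

theorem exists_root (N : ℕ+) (w : PDisc) : ∃ z : Disc, (z : ℂ) ^ (N : ℕ) = w := by
  obtain ⟨z, hz⟩ := IsAlgClosed.exists_pow_nat_eq (w : ℂ) N.pos
  refine ⟨⟨z, ?_⟩, hz⟩
  have h := w.2.1
  rw [mem_ball_zero_iff] at h ⊢
  rw [← hz, norm_pow] at h
  exact (pow_lt_one_iff_of_nonneg (norm_nonneg z) N.ne_zero).mp h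

end GoodCover

/-! ## Classification of liftings -/

namespace TopGroupoid

variable {Q : TopGroupoid.{u, v}} {G : Type w} [Group G] [TopologicalSpace G] [DiscreteTopology G]

/-- Functions on the arrows related by a gauge transformation. -/
def GaugeEquiv (Q : TopGroupoid.{u, v}) (F F' : Q.Arr → G) : Prop :=
  ∃ φ : Q.Obj → G, Continuous φ ∧ ∀ q, F q = φ (Q.src q) * F' q * (φ (Q.tgt q))⁻¹

theorem GaugeEquiv.symm {F F' : Q.Arr → G} (h : Q.GaugeEquiv F F') : Q.GaugeEquiv F' F := by
  obtain ⟨φ, hφ, h⟩ := h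
  refine ⟨fun x => (φ x)⁻¹, continuous_of_discreteTopology.comp hφ, fun q => ?_⟩
  rw [h q]; group

theorem GaugeEquiv.trans {F F' F'' : Q.Arr → G} (h : Q.GaugeEquiv F F')
    (h' : Q.GaugeEquiv F' F'') : Q.GaugeEquiv F F'' := by
  obtain ⟨φ, hφ, h⟩ := h
  obtain ⟨φ', hφ', h'⟩ := h'
  refine ⟨fun x => φ x * φ' x, (continuous_of_discreteTopology (f := fun p : G × G => p.1 * p.2)).comp
    (hφ.prodMk hφ'), fun q => ?_⟩
  rw [h q, h' q]; group

theorem gaugeEquiv_mul_center {H : Type*} [Group H] [TopologicalSpace H] {F F' : Q.Arr → H}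
    (t : Q.Arr → Subgroup.center H) :
    Q.GaugeEquiv (fun q => F q * (t q : H)) (fun q => F' q * (t q : H)) ↔ Q.GaugeEquiv F F' := by
  refine exists_congr fun φ => and_congr_right fun _ => forall_congr' fun q => ?_
  rw [← _root_.mul_assoc, GoodCover.mul_center_right_comm _ (t q), mul_left_inj]

end TopGroupoid

namespace GoodCover

open TopGroupoid (BandedGerbe Cochain1)

variable {S : Type u} [TopologicalSpace S] [ChartedSpace ℂ S] {n : ℕ}
  {pt : Fin n → S} {ι : Type v} {d : Fin n → ℕ+} {G : Type w} [Group G] [TopologicalSpace G]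
  [DiscreteTopology G] {C : GoodCover pt ι} {g : ℕ} {τ τ' : BandedGerbe (C.groupoid d) G}

/-- Liftings are classified by tuples up to conjugation. -/
theorem exists_liftingClass_equiv [PreconnectedSpace S] (Λ : C.GeneratorSystem g)
    (z : Fin n → Disc) (hz : ∀ j, (z j : ℂ) ^ (d j : ℕ) = Λ.w j) {ψ : Cochain1 (C.groupoid d) G}
    (hψ : τ.CohomologousVia τ' ψ) (hτ : C.TrivialOnPunctured τ') (m : Fin n → ℕ+) :
    ∃ Φ : τ.LiftingClass (C.rootMap d m) ≃
        Quotient (conjSetoid (chi g d m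
          (fun j => C.holLoop τ' j (Λ.w j) (z j) (hz j) (Λ.chain_circle j))
          (fun j => C.holPt τ' j))),
      ∀ (f : τ.Lifting (C.rootMap d m)) (f' : τ'.Lifting (C.rootMap d m))
        (z' : Fin n → Disc) (hz' : ∀ j, (z' j : ℂ) ^ ((m * d) j : ℕ) = Λ.w j),
        (∀ q, f'.F q = f.F q * (ψ.val ((C.rootMap d m).arr q) : G)) →
        Λ.Normalised (m * d) f'.F z' hz' →
        ∃ ht : Λ.tuple (m * d) f'.F ∈ chi g d m
            (fun j => C.holLoop τ' j (Λ.w j) (z j) (hz j) (Λ.chain_circle j))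
            (fun j => C.holPt τ' j),
          Φ (Quotient.mk _ f) = Quotient.mk _ ⟨Λ.tuple (m * d) f'.F, ht⟩ := by
  set T : Set (Tuple G g n) := chi g d m
    (fun j => C.holLoop τ' j (Λ.w j) (z j) (hz j) (Λ.chain_circle j)) (fun j => C.holPt τ' j) with hT
  let p := C.rootMap d m
  have hτp : C.TrivialOnPunctured (τ'.pullback p) := hτ.pullback
  -- Auxiliary points for normalising representatives; the points in the final statement are
  -- arbitrary and are compared with these by `tuple_conj`.
  choose y hy using fun j => exists_root ((m * d) j) (Λ.w j)
  let tw : τ.Lifting p → (C.groupoid (m * d)).Arr → G := fun f q => f.F q * (ψ.val (p.arr q) : G)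
  have htw : ∀ f, (τ'.pullback p).IsTwisted (tw f) := fun f =>
    (hψ.isTwisted p fun _ => rfl).mp f.isTwisted
  have hmem : ∀ {F : (C.groupoid (m * d)).Arr → G} {z' : Fin n → Disc}
      {hz' : ∀ j, (z' j : ℂ) ^ ((m * d) j : ℕ) = Λ.w j}, (τ'.pullback p).IsTwisted F →
      Λ.Normalised (m * d) F z' hz' → Λ.tuple (m * d) F ∈ T := by
    intro F z' hz' hF hN
    refine ⟨?_, fun j => ?_⟩
    · have := hN.prod_commutator hF hτp
      simp only [p, holLoop_pullback_eq (hz _) (hz' _)] at this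
      exact this
    · have := map_arrRot_pow hF (j := j)
      rw [holPt_pullback] at this
      exact this
  -- a normalised representative of each lifting
  have hex : ∀ f, ∃ F, (τ'.pullback p).IsTwisted F ∧ Λ.Normalised (m * d) F y hy ∧
      (C.groupoid (m * d)).GaugeEquiv F (tw f) := by
    intro f
    obtain ⟨φ, F, hφ, hF, hN⟩ := Λ.exists_normalised hy (tw f)
    exact ⟨F, (htw f).conj hφ hF, hN, φ, hφ, hF⟩
  choose R hR hRN hRe using hex
  let Ψ : τ.Lifting p → Quotient (conjSetoid T) := fun f => Quotient.mk _ ⟨_, hmem (hR f) (hRN f)⟩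
  -- The class of the tuple may be computed from any normalised representative, with any choice of
  -- points over the ends of the l_j. This gives both well-definedness and the final formula.
  have hΨ : ∀ f (F : (C.groupoid (m * d)).Arr → G) (z' : Fin n → Disc)
      (hz' : ∀ j, (z' j : ℂ) ^ ((m * d) j : ℕ) = Λ.w j) (hF : (τ'.pullback p).IsTwisted F)
      (hN : Λ.Normalised (m * d) F z' hz'), (C.groupoid (m * d)).GaugeEquiv F (tw f) →
      Ψ f = Quotient.mk _ ⟨_, hmem hF hN⟩ := by
    intro f F z' hz' hF hN he
    obtain ⟨φ, hφ, h⟩ := (hRe f).trans he.symm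
    exact Quotient.sound ((hRN f).tuple_conj hN hF hφ h)
  have hequiv : ∀ f f', (BandedGerbe.Lifting.setoid τ p) f f' ↔
      (C.groupoid (m * d)).GaugeEquiv (tw f) (tw f') := fun f f' =>
    (TopGroupoid.gaugeEquiv_mul_center fun q => ψ.val (p.arr q)).symm
  have hwd : ∀ f f', (BandedGerbe.Lifting.setoid τ p) f f' → Ψ f = Ψ f' := fun f f' h =>
    hΨ f _ y hy (hR f') (hRN f') ((hRe f').trans ((hequiv f f').mp h).symm)
  refine ⟨Equiv.ofBijective (Quotient.lift Ψ hwd) ⟨?_, ?_⟩, ?_⟩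
  · rintro ⟨f⟩ ⟨f'⟩ h
    obtain ⟨k, h1, h2, h3⟩ := Quotient.exact (show Ψ f = Ψ f' from h)
    refine Quotient.sound ((hequiv f f').mpr ?_)
    have := (hRN f).exists_gauge (hRN f') (hR f) (hR f') hτp h1 h2 h3
    exact ((hRe f).symm.trans this).trans (hRe f')
  · rintro ⟨t, ht⟩
    obtain ⟨F, hF, hN, rfl⟩ := Λ.exists_tuple_eq (τ := τ'.pullback p) hy hτp t (by
      simp only [p, holLoop_pullback_eq (hz _) (hy _)]
      exact ht.1) (fun j => by rw [holPt_pullback]; exact ht.2 j)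
    -- Removing ψ turns the realised function, which is twisted for τ', into the component of a
    -- lifting of τ.
    let F₀ : (C.groupoid (m * d)).Arr → G := fun q =>
      F q * (((ψ.val (p.arr q))⁻¹ : Subgroup.center G) : G)
    have hF₀ : ∀ q, F q = F₀ q * (ψ.val (p.arr q) : G) := fun q => by simp [F₀]
    let f := BandedGerbe.Lifting.mk' τ p F₀ ((hψ.isTwisted p hF₀).mpr hF)
    exact ⟨Quotient.mk _ f, hΨ f F y hy hF hN ⟨fun _ => 1, continuous_const, fun q => by
      rw [hF₀, one_mul, inv_one, mul_one]; rfl⟩⟩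
  · intro f f' z' hz' hf hN
    have hF' := f'.isTwisted
    refine ⟨hmem hF' hN, hΨ f f'.F z' hz' hF' hN ⟨fun _ => 1, continuous_const, fun q => ?_⟩⟩
    rw [hf]; simp [tw, p]

end GoodCover
end

/-! ### The main theorem -/

theorem theorem4p6 {S : Type*} [TopologicalSpace S] [T2Space S] [CompactSpace S] [ConnectedSpace S]
    [ChartedSpace ℂ S] [IsManifold 𝓘(ℂ) ω S] {n g : ℕ} (X : OrbiStructure S n)
    {ι : Type*} [Finite ι] (C : GoodCover X.pt ι) (Λ : C.GeneratorSystem g)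
    (z : Fin n → Disc) (hz : ∀ j, (z j : ℂ) ^ (X.ord j : ℕ) = Λ.w j)
    {G : Type*} [Group G] [Finite G] [TopologicalSpace G] [DiscreteTopology G]
    (τ : TopGroupoid.BandedGerbe (C.groupoid X.ord) G) :
    (0 < n → ∃ τ' ψ, τ.CohomologousVia τ' ψ ∧ C.TrivialOnPunctured τ') ∧
    ∀ τ' ψ, τ.CohomologousVia τ' ψ → C.TrivialOnPunctured τ' → ∀ m : Fin n → ℕ+,
      ∃ Φ : τ.LiftingClass (C.rootMap X.ord m) ≃
          Quotient (conjSetoid (chi g X.ord m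
            (fun j => C.holLoop τ' j (Λ.w j) (z j) (hz j) (Λ.chain_circle j))
            (fun j => C.holPt τ' j))),
        ∀ (f : τ.Lifting (C.rootMap X.ord m)) (f' : τ'.Lifting (C.rootMap X.ord m))
          (z' : Fin n → Disc) (hz' : ∀ j, (z' j : ℂ) ^ ((m * X.ord) j : ℕ) = Λ.w j),
          (∀ q, f'.F q = f.F q * (ψ.val ((C.rootMap X.ord m).arr q) : G)) →
          Λ.Normalised (m * X.ord) f'.F z' hz' →
          ∃ ht : Λ.tuple (m * X.ord) f'.F ∈ chi g X.ord m
              (fun j => C.holLoop τ' j (Λ.w j) (z j) (hz j) (Λ.chain_circle j))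
              (fun j => C.holPt τ' j),
            Φ (Quotient.mk _ f) = Quotient.mk _ ⟨Λ.tuple (m * X.ord) f'.F, ht⟩ := by
  exact ⟨fun hn => C.exists_trivialOnPunctured hn τ, fun _ _ hψ hτ m =>
    GoodCover.exists_liftingClass_equiv Λ z hz hψ hτ m⟩
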